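/- **Setting.** Consider two-dimensional topological gravity with two primary fields $\mathcal O_0,\mathcal O_1$ and $\eta_{ab}=\delta_{a+b,1}$. Its large phase space is the jet space with coordinates $u^a_n=\partial^nu^a$ ($n\ge0$, $a=0,1$), $u^0=v$, $u^1=u$, and total derivative $\partial u^a_n=u^a_{n+1}$. Put $\mathcal U=\begin{bmatrix}v&u\\ \phi(u)&v\end{bmatrix}$ (rows labelled by the lower index $a$ of $\mathcal U_a^b$), $\mathcal C=(\partial\mathcal U)^{-1}$, $\Delta=\det\partial\mathcal U=(\partial v)^2-\phi'(u)(\partial u)^2$, and define vector fields $\eth_{k,a}$ by $\sum_kz^k\,\eth_{k,a}u^b_n=\big((\partial+z\,\partial\mathcal U)^n\partial\mathcal U\big)_a^b$, $\partial_{0,a}=\eth_{0,a}$. Indices are raised and lowered with $\eta$, repeated indices are summed. The correlators are $\langle\langle\mathcal O_a\mathcal O_b\rangle\rangle_0=\mathcal U_{ab}$, $\langle\langle\mathcal O_a\rangle\rangle_1=\partial_{0,a}F_1$ with $F_1=\frac1{24}\log\Delta+\psi(u)$, and their derivatives under the $\partial_{0,c}$. All functions are considered for $u\notin(-\infty,0]$,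 $\Delta\ne0$. A *genus $2$ potential* is a function $F_2$ that is holomorphic in $(v,u)$ for $u\notin(-\infty,0]$, a Laurent polynomial in $\Delta$ and polynomial in the $u^a_n$, $n>0$, and that satisfies the string equation $\partial F_2/\partial u^0=0$, the dilaton equation $\sum_n n\,u^a_n\,\partial F_2/\partial u^a_n=2F_2$, and the genus $2$ topological recursion relations $$\eth_{k,a}F_2=\mathcal R_{k,a}\quad(k\ge2),\qquad \eth_{1,a}\eth_{1,b}F_2-3\langle\langle\mathcal O_a\mathcal O_b\mathcal O^c\rangle\rangle_0\,\eth_{1,c}F_2=\mathcal R_{1,1,a,b},$$ where $\mathcal R_{k,a}=0$ for $k>4$ and $$\begin{aligned} \mathcal R_{2,a}&=\langle\langle\mathcal O_a\mathcal O_b\mathcal O_c\rangle\rangle_0\big(\tfrac7{10}\langle\langle\mathcal O^b\rangle\rangle_1\langle\langle\mathcal O^c\rangle\rangle_1+\tfrac1{10}\langle\langle\mathcal O^b\mathcal O^c\rangle\rangle_1\big)+\tfrac{13}{240}\langle\langle\mathcal O_a\mathcal O_b\mathcal O_c\mathcal O^c\rangle\rangle_0\langle\langle\mathcal O^b\rangle\rangle_1\\&\quad-\tfrac1{240}\langle\langle\mathcal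 O_a\mathcal O^b\rangle\rangle_1\langle\langle\mathcal O_b\mathcal O_c\mathcal O^c\rangle\rangle_0+\tfrac1{960}\langle\langle\mathcal O_a\mathcal O_b\mathcal O^b\mathcal O_c\mathcal O^c\rangle\rangle_0,\\ \mathcal R_{3,a}&=\langle\langle\mathcal O_a\mathcal O_b\mathcal O_c\rangle\rangle_0\big(\tfrac1{20}\langle\langle\mathcal O^b\rangle\rangle_1\langle\langle\mathcal O^c\mathcal O^d\mathcal O_d\rangle\rangle_0+\tfrac1{480}\langle\langle\mathcal O^b\mathcal O^c\mathcal O^d\mathcal O_d\rangle\rangle_0\big)+\tfrac1{1152}\langle\langle\mathcal O_a\mathcal O^b\mathcal O^c\mathcal O_c\rangle\rangle_0\langle\langle\mathcal O_b\mathcal O^d\mathcal O_d\rangle\rangle_0,\\ \mathcal R_{4,a}&=\tfrac1{1152}\langle\langle\mathcal O_a\mathcal O^b\mathcal O^c\rangle\rangle_0\langle\langle\mathcal O_b\mathcal O_c\mathcal O^d\rangle\rangle_0\langle\langle\mathcal O_d\mathcal O^e\mathcal O_e\rangle\rangle_0,\\ \mathcal R_{1,1,a,b}&=\tfrac{13}{10}\langle\langle\mathcal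 O_a\mathcal O_b\mathcal O_c\mathcal O_d\rangle\rangle_0\langle\langle\mathcal O^c\rangle\rangle_1\langle\langle\mathcal O^d\rangle\rangle_1+\tfrac45\big(\langle\langle\mathcal O_a\mathcal O_c\rangle\rangle_1\langle\langle\mathcal O_d\rangle\rangle_1+\tfrac1{24}\langle\langle\mathcal O_a\mathcal O_c\mathcal O_d\rangle\rangle_1\big)\langle\langle\mathcal O_b\mathcal O^c\mathcal O^d\rangle\rangle_0\\ &\quad+\tfrac45\langle\langle\mathcal O_a\mathcal O^c\mathcal O^d\rangle\rangle_0\big(\langle\langle\mathcal O_b\mathcal O_c\rangle\rangle_1\langle\langle\mathcal O_d\rangle\rangle_1+\tfrac1{24}\langle\langle\mathcal O_b\mathcal O_c\mathcal O_d\rangle\rangle_1\big)\\ &\quad-\tfrac45\langle\langle\mathcal O_a\mathcal O_b\mathcal O_c\rangle\rangle_0\big(\langle\langle\mathcal O^c\mathcal O_d\rangle\rangle_1\langle\langle\mathcal O^d\rangle\rangle_1+\tfrac1{24}\langle\langle\mathcal O^c\mathcal O_d\mathcal O^d\rangle\rangle_1\big)\\ &\quad+\tfrac1{48}\langle\langle\mathcal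 O_a\mathcal O_c\mathcal O_d\mathcal O^d\rangle\rangle_0\langle\langle\mathcal O^c\mathcal O_b\rangle\rangle_1+\tfrac1{48}\langle\langle\mathcal O_a\mathcal O_c\rangle\rangle_1\langle\langle\mathcal O_b\mathcal O^c\mathcal O_d\mathcal O^d\rangle\rangle_0\\ &\quad+\tfrac{23}{240}\langle\langle\mathcal O_a\mathcal O_b\mathcal O_c\mathcal O_d\mathcal O^d\rangle\rangle_0\langle\langle\mathcal O^c\rangle\rangle_1-\tfrac1{80}\langle\langle\mathcal O_a\mathcal O_b\mathcal O_c\rangle\rangle_1\langle\langle\mathcal O^c\mathcal O^d\mathcal O_d\rangle\rangle_0\\ &\quad+\tfrac7{30}\langle\langle\mathcal O_a\mathcal O_b\mathcal O_c\mathcal O_d\rangle\rangle_0\langle\langle\mathcal O^c\mathcal O^d\rangle\rangle_1+\tfrac1{576}\langle\langle\mathcal O_a\mathcal O_b\mathcal O_c\mathcal O^c\mathcal O_d\mathcal O^d\rangle\rangle_0. \end{aligned}$$ Put $$\begin{aligned}F_{2,0}&=\tfrac1{1152}\partial^2\langle\langle\mathcal O_a\mathcal O_b\mathcal O_c\mathcal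 O_d\rangle\rangle_0\mathcal C^{ab}\mathcal C^{cd}-\tfrac1{1152}\partial^2\langle\langle\mathcal O_a\mathcal O_b\rangle\rangle_0\,\partial\langle\langle\mathcal O_c\mathcal O_d\mathcal O_e\mathcal O_f\rangle\rangle_0\mathcal C^{ac}\mathcal C^{bd}\mathcal C^{ef}\\&\quad-\tfrac1{360}\partial^2\langle\langle\mathcal O_a\mathcal O_b\mathcal O_c\rangle\rangle_0\,\partial\langle\langle\mathcal O_d\mathcal O_e\mathcal O_f\rangle\rangle_0\mathcal C^{ad}\mathcal C^{be}\mathcal C^{cf}\\&\quad+\tfrac1{360}\partial^2\langle\langle\mathcal O_a\mathcal O_b\rangle\rangle_0\,\partial\langle\langle\mathcal O_c\mathcal O_d\mathcal O_e\rangle\rangle_0\,\partial\langle\langle\mathcal O_f\mathcal O_g\mathcal O_h\rangle\rangle_0\mathcal C^{ac}\mathcal C^{bf}\mathcal C^{dg}\mathcal C^{eh}\end{aligned}$$ and, with $\Psi=24\psi$ and $\Psi_a=\partial_{0,a}\Psi$, $\Psi_{ab}=\partial_{0,a}\partial_{0,b}\Psi$, $$\begin{aligned}F_{2,1}&=\tfrac1{576}\Big((\tfrac12\partial\Psi_{ab}+\tfrac45\,\partial\Psi_a\,\Psi_b)\mathcal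 C^{ab}+\partial^2\langle\langle\mathcal O_a\mathcal O_b\rangle\rangle_0(\tfrac65\Psi_{cd}-\tfrac1{10}\Psi_c\Psi_d)\mathcal C^{ac}\mathcal C^{bd}\\ &\quad+(\tfrac7{10}\partial^2\langle\langle\mathcal O_a\mathcal O_b\mathcal O_c\rangle\rangle_0\Psi_d-\tfrac3{10}\partial\langle\langle\mathcal O_a\mathcal O_b\mathcal O_c\rangle\rangle_0\,\partial\Psi_d)\mathcal C^{ab}\mathcal C^{cd}\\ &\quad+\partial^2\langle\langle\mathcal O_a\mathcal O_b\rangle\rangle_0\,\partial\langle\langle\mathcal O_c\mathcal O_d\mathcal O_e\rangle\rangle_0\,\Psi_f(\tfrac3{10}\mathcal C^{af}\mathcal C^{bc}\mathcal C^{de}-\tfrac{23}{10}\mathcal C^{ac}\mathcal C^{bd}\mathcal C^{ef})+\tfrac1{10}(\partial u)^4\phi''\,\Psi''\,\Delta^{-1}\Big).\end{aligned}$$ Let $f_2=F_2-F_{2,0}-F_{2,1}$ and let $h_a(u)$ be $\partial f_2/\partial(\partial u^a)$ at $(\partial v,\partial u)=(1,0)$ with all higher jets zero. For a charge $d$ let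 $\mu=\mathrm{diag}(-\tfrac d2,\tfrac d2)$, let $R$ be a matrix whose only possibly nonzero entry is $R_0^1=r$, and put $\mathcal E^0=v$, $\mathcal E^1=(1-d)u+r$, $\mathcal V=\mathcal U+[\mu,\mathcal U]+R$. The genus $2$ Virasoro constraints are $$L_0Z=0:\quad\mathcal L_0F_2=0,\qquad L_1Z=0:\quad\mathcal L_1F_2+\tfrac12(\tfrac14-\mu^2)^{ab}\big(\langle\langle\mathcal O_a\rangle\rangle_1\langle\langle\mathcal O_b\rangle\rangle_1+\langle\langle\mathcal O_a\mathcal O_b\rangle\rangle_1\big)=0,$$ where the vector fields $\mathcal L_0,\mathcal L_1$ on the jet space are given by $\mathcal L_0u^a=-\mathcal E^a$, $[\partial,\mathcal L_0]=\frac{1-d}2\partial$ and $\mathcal L_1u^a=-\mathcal E^b\mathcal E^c\,\partial\mathcal U_b^a/\partial u^c$, $[\partial,\mathcal L_1]=\big((\mu+\frac12)(\mu+\frac32)\big)_0^b\,\eth_{1,b}+\big((\mu+\frac12)\mathcal V+\mathcal V(\mu+\frac12)\big)_0^b\,\eth_{0,b}$. **Theorem.** (1) Let $d\in\mathbb C$,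 $d\ne\pm1$, $r=0$, $\phi(u)=u^{(1+d)/(1-d)}$, $\psi(u)=\frac{d(3d-1)}{24(d-1)}\log u$, and let $F_2$ be a genus $2$ potential satisfying $L_0Z=0$ in genus $2$. (a) There are constants $C_0,C_1$ with $h_a(u)=C_a\,u^{((1+a)d-3)/(1-d)}$. (b) If also $L_1Z=0$ holds in genus $2$, then $h_1=0$ and $$h_0=-\frac{d(3d-1)(3d-5)(d-2)}{5760(d+1)}\,u^{(d-3)/(1-d)},$$ and $F_2$ is completely determined: $F_2=F_{2,0}+F_{2,1}+\tfrac12\big((\partial v)^2+\phi'(u)(\partial u)^2\big)h_0(u)$. (c) Independently of $L_1Z=0$, the equation $$\phi'h_0'-\tfrac12\phi''h_0-\tfrac1{48}\psi''''-\tfrac35\psi'''\psi'+\tfrac9{10}(\psi'')^2=0,$$ to which the Belorousski–Pandharipande equation reduces in this situation, holds if and only if $h_0$ is given by the formula in (b), i.e. it yields the same constant $C_0$. (2) Let $d=1$, $r=2$, $\phi(u)=e^u$, $\psi(u)=-\frac1{24}u$ (the $\mathbb{CP}^1$ case). If a genus $2$ potential $F_2$ satisfies $L_0Z=L_1Z=0$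 in genus $2$, then $h_0=h_1=0$ and $F_2=F_{2,0}+F_{2,1}$. -/

import Mathlib

noncomputable section

namespace TopGrav

/-! ### The jet space (large phase space) of a background with two primary fields -/

/-- A point of the infinite jet space of the two-primary Frobenius manifold.  The coordinate
`x n a` is `u^a_n = ∂ⁿ u^a`, where `u^0 = v` and `u^1 = u`. -/
abbrev Jet : Type := ℕ → Fin 2 → ℂ

/-- The action `X F` of a vector field `X` (given by its coefficients `X u^a_n`) on a function `F`:
for `F` depending on finitely many jet coordinates this is `∑ X^a_n ∂F/∂u^a_n`. -/
def along (X : Jet → Jet) (F : Jet → ℂ) : Jet → ℂ := fun x => lineDeriv ℂ F x (X x)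

/-- The total derivative `∂ = ∂_{0,0}`: `∂ u^a_n = u^a_{n+1}`. -/
def shift : Jet → Jet := fun x n a => x (n + 1) a

/-- `∂F`. -/
def tot (F : Jet → ℂ) : Jet → ℂ := along shift F

/-- `∂` applied to a matrix of functions, entry by entry. -/
def totMat (M : Jet → Matrix (Fin 2) (Fin 2) ℂ) : Jet → Matrix (Fin 2) (Fin 2) ℂ :=
  fun x => Matrix.of fun a b => tot (fun y => M y a b) x

/-- The coordinate vector field `∂/∂u^a_n`. -/
def coordField (n : ℕ) (a : Fin 2) : Jet → Jet := fun _ => Pi.single n (Pi.single a 1)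

/-- Raising or lowering an index with `η_{ab} = δ_{a+b,1}`. -/
def dual (a : Fin 2) : Fin 2 := 1 - a

/-! ### Genus zero -/

/-- The matrix `𝒰_a^b = ⟨⟨O_a O^b⟩⟩_0`: first row `(v, u)`, second row `(φ(u), v)`. -/
def U (φ : ℂ → ℂ) (x : Jet) : Matrix (Fin 2) (Fin 2) ℂ :=
  !![x 0 0, x 0 1; φ (x 0 1), x 0 0]

/-- `∂𝒰`. -/
def dU (φ : ℂ → ℂ) : Jet → Matrix (Fin 2) (Fin 2) ℂ := totMat (U φ)

/-- `Δ = det ∂𝒰`. -/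
def Δ (φ : ℂ → ℂ) (x : Jet) : ℂ := (dU φ x).det

/-- The domain of the correlation functions: `u ∉ (-∞, 0]` and `Δ ≠ 0`. -/
def domain (φ : ℂ → ℂ) : Set Jet := {x | x 0 1 ∈ Complex.slitPlane ∧ Δ φ x ≠ 0}

/-- The propagator `𝒞 = (∂𝒰)⁻¹` with raised index: `𝒞^{ab} = η^{ac} 𝒞_c^b`. -/
def C (φ : ℂ → ℂ) (a b : Fin 2) (x : Jet) : ℂ := (dU φ x)⁻¹ (dual a) b

/-- The coefficient of `z^k` in the matrix `(∂ + z ∂𝒰)ⁿ ∂𝒰`; the arguments are `n` and `k`. -/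
def faa (φ : ℂ → ℂ) : ℕ → ℕ → Jet → Matrix (Fin 2) (Fin 2) ℂ
  | 0, 0 => dU φ
  | 0, _ + 1 => fun _ => 0
  | n + 1, 0 => totMat (faa φ n 0)
  | n + 1, k + 1 => fun x => totMat (faa φ n (k + 1)) x + dU φ x * faa φ n k x

/-- The vector field `ð_{k,a}` on the jet space: `∑_k z^k ð_{k,a} u^b_n = ((∂ + z∂𝒰)ⁿ ∂𝒰)_a^b`. -/
def ethField (φ : ℂ → ℂ) (k : ℕ) (a : Fin 2) : Jet → Jet := fun x n b => faa φ n k x a b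

/-- `ð_{k,a} F`.  For `k = 0` this is `∂_{0,a} F`. -/
def eth (φ : ℂ → ℂ) (k : ℕ) (a : Fin 2) (F : Jet → ℂ) : Jet → ℂ := along (ethField φ k a) F

/-- The genus 0 correlators `⟨⟨O_a O_b O_{c₁} O_{c₂} ⋯⟩⟩_0`, where `l = [c₁, c₂, …]`. -/
def cor0 (φ : ℂ → ℂ) (a b : Fin 2) : List (Fin 2) → Jet → ℂ
  | [] => fun x => U φ x a (dual b)
  | c :: l => eth φ 0 c (cor0 φ a b l)

/-! ### Genus one: `F₁ = (1/24) log Δ + ψ(u)` -/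

/-- `∂_{0,a} ∂_{0,c₁} ∂_{0,c₂} ⋯ ψ(u)`, where `l = [c₁, c₂, …]`. -/
def psiD (φ ψ : ℂ → ℂ) (a : Fin 2) : List (Fin 2) → Jet → ℂ
  | [] => eth φ 0 a (fun x => ψ (x 0 1))
  | c :: l => eth φ 0 c (psiD φ ψ a l)

/-- The genus 1 correlators `⟨⟨O_a O_{c₁} O_{c₂} ⋯⟩⟩_1`, where `l = [c₁, c₂, …]`.  The one-point
function is `∂_{0,a} F₁`, with the derivative of `log Δ` written as a logarithmic derivative, so
that no branch of the logarithm is involved. -/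
def cor1 (φ ψ : ℂ → ℂ) (a : Fin 2) : List (Fin 2) → Jet → ℂ
  | [] => fun x => (1 / 24) * (eth φ 0 a (Δ φ) x / Δ φ x) + psiD φ ψ a [] x
  | c :: l => eth φ 0 c (cor1 φ ψ a l)

/-! ### The genus two topological recursion relations -/

/-- The right-hand side `ℛ_{k,a}`, `k ≥ 2`, of the first relation. -/
def R21 (φ ψ : ℂ → ℂ) (k : ℕ) (a : Fin 2) (x : Jet) : ℂ :=
  match k with
  | 2 => ∑ b, ∑ c,
      (cor0 φ a b [c] x *
          (7 / 10 * cor1 φ ψ (dual b) [] x * cor1 φ ψ (dual c) [] x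
            + 1 / 10 * cor1 φ ψ (dual b) [dual c] x)
        + 13 / 240 * cor0 φ a b [c, dual c] x * cor1 φ ψ (dual b) [] x
        - 1 / 240 * cor1 φ ψ a [dual b] x * cor0 φ b c [dual c] x
        + 1 / 960 * cor0 φ a b [dual b, c, dual c] x)
  | 3 => ∑ b, ∑ c, ∑ d,
      (cor0 φ a b [c] x *
          (1 / 20 * cor1 φ ψ (dual b) [] x * cor0 φ (dual c) (dual d) [d] x
            + 1 / 480 * cor0 φ (dual b) (dual c) [dual d, d] x))
      + ∑ b, ∑ c, ∑ d,
        1 / 1152 * cor0 φ a (dual b) [dual c, c] x * cor0 φ b (dual d) [d] x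
  | 4 => ∑ b, ∑ c, ∑ d, ∑ e,
      1 / 1152 * cor0 φ a (dual b) [dual c] x * cor0 φ b c [dual d] x
        * cor0 φ d (dual e) [e] x
  | _ => 0

/-- The right-hand side `ℛ_{1,1,a,b}` of the second relation. -/
def R22 (φ ψ : ℂ → ℂ) (a b : Fin 2) (x : Jet) : ℂ :=
  ∑ c, ∑ d,
    (13 / 10 * cor0 φ a b [c, d] x * cor1 φ ψ (dual c) [] x * cor1 φ ψ (dual d) [] x
      + 4 / 5 * (cor1 φ ψ a [c] x * cor1 φ ψ d [] x + 1 / 24 * cor1 φ ψ a [c, d] x)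
          * cor0 φ b (dual c) [dual d] x
      + 4 / 5 * cor0 φ a (dual c) [dual d] x
          * (cor1 φ ψ b [c] x * cor1 φ ψ d [] x + 1 / 24 * cor1 φ ψ b [c, d] x)
      - 4 / 5 * cor0 φ a b [c] x
          * (cor1 φ ψ (dual c) [d] x * cor1 φ ψ (dual d) [] x
            + 1 / 24 * cor1 φ ψ (dual c) [d, dual d] x)
      + 1 / 48 * cor0 φ a c [d, dual d] x * cor1 φ ψ (dual c) [b] x
      + 1 / 48 * cor1 φ ψ a [c] x * cor0 φ b (dual c) [d, dual d] x
      + 23 / 240 * cor0 φ a b [c, d, dual d] x * cor1 φ ψ (dual c) [] x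
      - 1 / 80 * cor1 φ ψ a [b, c] x * cor0 φ (dual c) (dual d) [d] x
      + 7 / 30 * cor0 φ a b [c, d] x * cor1 φ ψ (dual c) [dual d] x
      + 1 / 576 * cor0 φ a b [c, dual c, d, dual d] x)

/-- The class of functions in which correlators live: holomorphic in `(v, u)` for
`u ∉ (-∞, 0]`, Laurent polynomial in `Δ`, polynomial in the other coordinates `u^a_n`, `n > 0`
(the polynomial variable `(n, a)` stands for `u^a_{n+1}`). -/
def HasCorrelatorForm (φ : ℂ → ℂ) (F : Jet → ℂ) : Prop :=
  ∃ (m : ℕ) (p : MvPolynomial (ℕ × Fin 2) (ℂ × ℂ → ℂ)),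
    (∀ s, DifferentiableOn ℂ (p.coeff s) {q : ℂ × ℂ | q.2 ∈ Complex.slitPlane}) ∧
    ∀ x ∈ domain φ,
      F x = (Δ φ x)⁻¹ ^ m *
        MvPolynomial.eval (fun i : ℕ × Fin 2 => x (i.1 + 1) i.2)
          (p.map (Pi.evalRingHom (fun _ : ℂ × ℂ => ℂ) (x 0 0, x 0 1)))

/-- `F` is a genus 2 potential for the background `(φ, ψ)`: it has the form of a correlation
function and satisfies both genus 2 topological recursion relations, the string equation
(`ℒ_{-1} = -∂/∂u^0`) and the dilaton equation (`𝒟 = ∑ n u^a_n ∂/∂u^a_n`). -/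
structure IsGenusTwoPotential (φ ψ : ℂ → ℂ) (F : Jet → ℂ) : Prop where
  form : HasCorrelatorForm φ F
  trr21 : ∀ k ≥ 2, ∀ a, ∀ x ∈ domain φ, eth φ k a F x = R21 φ ψ k a x
  trr22 : ∀ a b, ∀ x ∈ domain φ,
    eth φ 1 a (eth φ 1 b F) x - 3 * ∑ c, cor0 φ a b [dual c] x * eth φ 1 c F x = R22 φ ψ a b x
  string : ∀ x ∈ domain φ, along (fun y => -coordField 0 0 y) F x = 0
  dilaton : ∀ x ∈ domain φ, along (fun y n a => (n : ℂ) * y n a) F x = 2 * F x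

/-! ### The particular solution `F_{2,0} + F_{2,1}` and the functions `h_a` -/

/-- The universal part `F_{2,0}`. -/
def F20 (φ : ℂ → ℂ) (x : Jet) : ℂ :=
  1 / 1152 * (∑ a, ∑ b, ∑ c, ∑ d,
      tot (tot (cor0 φ a b [c, d])) x * C φ a b x * C φ c d x)
  - 1 / 1152 * (∑ a, ∑ b, ∑ c, ∑ d, ∑ e, ∑ f,
      tot (tot (cor0 φ a b [])) x * tot (cor0 φ c d [e, f]) x
        * C φ a c x * C φ b d x * C φ e f x)
  - 1 / 360 * (∑ a, ∑ b, ∑ c, ∑ d, ∑ e, ∑ f,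
      tot (tot (cor0 φ a b [c])) x * tot (cor0 φ d e [f]) x
        * C φ a d x * C φ b e x * C φ c f x)
  + 1 / 360 * (∑ a, ∑ b, ∑ c, ∑ d, ∑ e, ∑ f, ∑ g, ∑ h,
      tot (tot (cor0 φ a b [])) x * tot (cor0 φ c d [e]) x * tot (cor0 φ f g [h]) x
        * C φ a c x * C φ b f x * C φ d g x * C φ e h x)

/-- The contribution `F_{2,1}`, as a function of `Ψ` where `F₁ = (1/24) (log Δ + Ψ(u))`. -/
def F21aux (φ Ψ : ℂ → ℂ) (x : Jet) : ℂ :=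
  1 / 576 *
    ((∑ a, ∑ b,
        (1 / 2 * tot (psiD φ Ψ a [b]) x + 4 / 5 * tot (psiD φ Ψ a []) x * psiD φ Ψ b [] x)
          * C φ a b x)
    + (∑ a, ∑ b, ∑ c, ∑ d,
        tot (tot (cor0 φ a b [])) x
          * (6 / 5 * psiD φ Ψ c [d] x - 1 / 10 * psiD φ Ψ c [] x * psiD φ Ψ d [] x)
          * C φ a c x * C φ b d x)
    + (∑ a, ∑ b, ∑ c, ∑ d,
        (7 / 10 * tot (tot (cor0 φ a b [c])) x * psiD φ Ψ d [] x
          - 3 / 10 * tot (cor0 φ a b [c]) x * tot (psiD φ Ψ d []) x)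
          * C φ a b x * C φ c d x)
    + (∑ a, ∑ b, ∑ c, ∑ d, ∑ e, ∑ f,
        tot (tot (cor0 φ a b [])) x * tot (cor0 φ c d [e]) x * psiD φ Ψ f [] x
          * (3 / 10 * C φ a f x * C φ b c x * C φ d e x
            - 23 / 10 * C φ a c x * C φ b d x * C φ e f x))
    + 1 / 10 * x 1 1 ^ 4 * iteratedDeriv 2 φ (x 0 1) * iteratedDeriv 2 Ψ (x 0 1)
        * (Δ φ x)⁻¹)

/-- The contribution `F_{2,1}`, for `F₁ = (1/24) log Δ + ψ(u)`. -/
def F21 (φ ψ : ℂ → ℂ) : Jet → ℂ := F21aux φ (fun u => 24 * ψ u)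

/-- The point of the small phase space with coordinates `(v, u)`: `∂v = 1`, and `∂u` and all
higher jets vanish. -/
def smallPoint (v u : ℂ) : Jet
  | 0 => ![v, u]
  | 1 => ![1, 0]
  | _ + 2 => 0

/-- `h_a = ∂f₂/∂(∂u^a)` at `(∂v, ∂u) = (1, 0)`, where `f₂ = F₂ - F_{2,0} - F_{2,1}`. -/
def hFun (φ ψ : ℂ → ℂ) (F : Jet → ℂ) (a : Fin 2) (v u : ℂ) : ℂ :=
  along (coordField 1 a) (fun x => F x - (F20 φ x + F21 φ ψ x)) (smallPoint v u)

/-! ### The Virasoro constraints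

`d` is the charge and `r` is the entry `R[1]_0^1`, the only possible non-zero entry of `R[1]`. -/

/-- `μ = diag(-d/2, d/2)`. -/
def μ (d : ℂ) : Fin 2 → ℂ := ![-d / 2, d / 2]

/-- `R[1]`. -/
def R1 (r : ℂ) : Matrix (Fin 2) (Fin 2) ℂ := !![0, r; 0, 0]

/-- The Euler vector field `ℰ^a = (1 - d_a) u^a + R[1]_0^a`, with `d_a = μ_a - μ_0`. -/
def euler (d r : ℂ) (a : Fin 2) (x : Jet) : ℂ := (1 - (μ d a - μ d 0)) * x 0 a + R1 r 0 a

/-- `𝒱 = 𝒰 + [μ, 𝒰] + R[1]`. -/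
def V (φ : ℂ → ℂ) (d r : ℂ) (x : Jet) : Matrix (Fin 2) (Fin 2) ℂ :=
  U φ x + (Matrix.diagonal (μ d) * U φ x - U φ x * Matrix.diagonal (μ d)) + R1 r

/-- The multiplication tensor `𝒜_{bc}^a = ∂𝒰_b^a/∂u^c`. -/
def A (φ : ℂ → ℂ) (b c a : Fin 2) : Jet → ℂ := along (coordField 0 c) (fun y => U φ y b a)

/-- The coefficient `ℒ₀ u^a_n`, from `ℒ₀ u^a = -ℰ^a` and `[∂, ℒ₀] = ((1-d)/2) ∂`. -/
def ell0 (d r : ℂ) : ℕ → Fin 2 → Jet → ℂ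
  | 0, a => fun x => -euler d r a x
  | n + 1, a => fun x => tot (ell0 d r n a) x - (1 - d) / 2 * x (n + 1) a

/-- The vector field `ℒ₀` on the jet space. -/
def L0 (d r : ℂ) : Jet → Jet := fun x n a => ell0 d r n a x

/-- The coefficient `ℒ₁ u^a_n`, from `ℒ₁ u^a = -ℰ^b ℰ^c 𝒜_{bc}^a` and
`[∂, ℒ₁] = ((μ+1/2)(μ+3/2))_0^b ð_{1,b} + ((μ+1/2)𝒱 + 𝒱(μ+1/2))_0^b ð_{0,b}`. -/
def ell1 (φ : ℂ → ℂ) (d r : ℂ) : ℕ → Fin 2 → Jet → ℂ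
  | 0, a => fun x => -∑ b, ∑ c, euler d r b x * euler d r c x * A φ b c a x
  | n + 1, a => fun x => tot (ell1 φ d r n a) x
      - ∑ b, (Matrix.diagonal (fun i => (μ d i + 1 / 2) * (μ d i + 3 / 2)) 0 b
                * eth φ 1 b (fun y => y n a) x
              + (Matrix.diagonal (fun i => μ d i + 1 / 2) * V φ d r x
                  + V φ d r x * Matrix.diagonal (fun i => μ d i + 1 / 2)) 0 b
                * eth φ 0 b (fun y => y n a) x)

/-- The vector field `ℒ₁` on the jet space. -/
def L1 (φ : ℂ → ℂ) (d r : ℂ) : Jet → Jet := fun x n a => ell1 φ d r n a x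

/-- The constraint `L₀Z = 0` in genus 2: `ℒ₀F₂ = 0`. -/
def VirasoroL0 (φ : ℂ → ℂ) (d r : ℂ) (F : Jet → ℂ) : Prop :=
  ∀ x ∈ domain φ, along (L0 d r) F x = 0

/-- The constraint `L₁Z = 0` in genus 2:
`ℒ₁F₂ + (1/2) (1/4 - μ²)^{ab} (⟨⟨O_a⟩⟩_1 ⟨⟨O_b⟩⟩_1 + ⟨⟨O_a O_b⟩⟩_1) = 0`. -/
def VirasoroL1 (φ ψ : ℂ → ℂ) (d r : ℂ) (F : Jet → ℂ) : Prop :=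
  ∀ x ∈ domain φ,
    along (L1 φ d r) F x
      + 1 / 2 * ∑ a, ∑ b, Matrix.diagonal (fun i => 1 / 4 - μ d i ^ 2) (dual a) b
          * (cor1 φ ψ a [] x * cor1 φ ψ b [] x + cor1 φ ψ a [b] x) = 0

/-! ### The Belorousski-Pandharipande equation and the backgrounds -/

/-- The left-hand side of the ordinary differential equation for `h_0` to which the
Belorousski-Pandharipande equation reduces for two primaries. -/
def bpExpr (φ ψ h : ℂ → ℂ) (u : ℂ) : ℂ :=
  deriv φ u * deriv h u - 1 / 2 * iteratedDeriv 2 φ u * h u - 1 / 48 * iteratedDeriv 4 ψ u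
    - 3 / 5 * iteratedDeriv 3 ψ u * deriv ψ u + 9 / 10 * iteratedDeriv 2 ψ u ^ 2

/-- `φ` for charge `d ≠ 1`. -/
def phiD (d : ℂ) (u : ℂ) : ℂ := u ^ ((1 + d) / (1 - d))

/-- `ψ` for charge `d ≠ 1`. -/
def psiFun (d : ℂ) (u : ℂ) : ℂ := d * (3 * d - 1) / (24 * (d - 1)) * Complex.log u

/-- `φ` for the `ℂP¹`-model. -/
def phiCP1 (u : ℂ) : ℂ := Complex.exp u

/-- `ψ` for the `ℂP¹`-model. -/
def psiCP1 (u : ℂ) : ℂ := -(1 / 24) * u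

/-- The asserted value of `h_0` for charge `d ≠ 1`. -/
def h0Value (d : ℂ) (u : ℂ) : ℂ :=
  -(d * (3 * d - 1) * (3 * d - 5) * (d - 2)) / (5760 * (d + 1)) * u ^ ((d - 3) / (1 - d))

end TopGrav

end

/-! The explicit function `F20 + F21` solves every equation imposed on a genus 2 potential, so the
theorem is about the difference `remainder` between an arbitrary potential and this particular
solution. That difference satisfies the homogeneous equations, and these leave very little room.

That the particular solution works is a finite computation. With `s` a square root of `φ'`, the
matrix `∂𝒰` has eigenvalues `p = ∂v + s ∂u` and `q = ∂v - s ∂u`, and `Δ = p q`. Homogeneity of the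
background expresses the derivatives of `s`, `φ` and `ψ` through `s`, `d` and the Euler component
`ℰ¹`. Hence all correlators lie in one ring of Laurent polynomials, closed under the vector fields
concerned, with the charge `d` as one of the variables. A single computation in that ring therefore
serves all charges and the `ℂP¹` model. The ring is implemented on lists, its operations and
derivations are proved sound (`LPoly.hasDerivAt_eval`, `Background.represents_along`), and the
identities are decided by the kernel.

The homogeneous problem is solved by hand. The field `ð_{k,a}` starts at jet order `k` with the
invertible block `(∂𝒰)^(k+1)`. Annihilation by all `ð_{k,a}` with `k ≥ 2` thus removes the jets of
order at least 2 (`lineDeriv_eq_zero_of_eth`), and the string equation removes `v`. The dilaton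
equation makes the remainder homogeneous of degree 2, that is `q² g(p/q)` for fixed `u`. The `(0,0)`
component of the second recursion then becomes `z g'' = g'`, so `g = α z² + β` and the remainder is
`α(u) p² + β(u) q²` (`remainder_quadratic`). Its coefficients are equivalent to `h_0` and `h_1`.

The Virasoro constraints act on these two functions of `u`. `L₀` gives first order equations whose
solutions on the slit plane are multiples of powers of `u` (`deriv_of_virasoroL0`). `L₁` gives two
linear algebraic equations (`eq_of_virasoroL1`), because the particular solution corrected by the
asserted `h_0` satisfies the same inhomogeneous equation. The Belorousski-Pandharipande expression,
evaluated on a multiple of the right power, is affine in the constant with nonzero slope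
(`bpExpr_eq`). -/

/-! ### Computable Laurent polynomials

A computable model of `ℚ[τ₀, τ₁, …][ρ₀^{±1}, ρ₁^{±1}, …]` (with denominators powers of `5760`),
its evaluation at complex values of the variables, and its derivations. -/

noncomputable section

namespace LPoly

/-- A monomial: integer exponents of the invertible variables `ρ i` and natural exponents of the
other variables `τ i`. -/
structure Mon where
  u : List ℤ
  e : List ℕ

/-- The product of integer powers. -/
def evalZ : (ℕ → ℂ) → List ℤ → ℂ
  | _, [] => 1
  | ρ, a :: l => ρ 0 ^ a * evalZ (fun i => ρ (i + 1)) l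

/-- The product of natural powers. -/
def evalN : (ℕ → ℂ) → List ℕ → ℂ
  | _, [] => 1
  | τ, a :: l => τ 0 ^ a * evalN (fun i => τ (i + 1)) l

/-- The values of the variables. -/
structure Env where
  ρ : ℕ → ℂ
  τ : ℕ → ℂ

def Mon.eval (v : Env) (m : Mon) : ℂ := evalZ v.ρ m.u * evalN v.τ m.e

/-- Missing entries count as exponent zero, so lists of different length may be added. The recursors
are written out so that the kernel can unfold them directly. -/
def addZ (l : List ℤ) : List ℤ → List ℤ :=
  List.rec (fun m => m) (fun a l ih m =>
    List.rec (a :: l) (fun b m _ => Int.add a b :: ih m) m) l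

def addN (l : List ℕ) : List ℕ → List ℕ :=
  List.rec (fun m => m) (fun a l ih m =>
    List.rec (a :: l) (fun b m _ => Nat.add a b :: ih m) m) l

def Mon.mul (a b : Mon) : Mon := ⟨addZ a.u b.u, addN a.e b.e⟩

/-- `Nat.beq` and `Nat.ble` are evaluated by the kernel on binary literals. -/
def cmpNat (a b : ℕ) : Ordering := match Nat.beq a b with
  | true => .eq
  | false => match Nat.ble a b with
    | true => .lt
    | false => .gt

def cmpInt : ℤ → ℤ → Ordering
  | .ofNat a, .ofNat b => cmpNat a b
  | .negSucc a, .negSucc b => cmpNat b a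
  | .ofNat _, .negSucc _ => .gt
  | .negSucc _, .ofNat _ => .lt

/-- The comparison of a list with the zero list. -/
def cmpN0 : List ℕ → Ordering
  | [] => .eq
  | b :: m => match cmpNat b 0 with
    | .eq => cmpN0 m
    | o => o

def cmpZ0 : List ℤ → Ordering
  | [] => .eq
  | b :: m => match cmpInt b 0 with
    | .eq => cmpZ0 m
    | o => o

def cmpN (l : List ℕ) : List ℕ → Ordering :=
  List.rec (fun m => (cmpN0 m).swap) (fun a l ih m =>
    List.rec (cmpN0 (a :: l)) (fun b m _ => match cmpNat a b with
      | .eq => ih m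
      | o => o) m) l

def cmpZ (l : List ℤ) : List ℤ → Ordering :=
  List.rec (fun m => (cmpZ0 m).swap) (fun a l ih m =>
    List.rec (cmpZ0 (a :: l)) (fun b m _ => match cmpInt a b with
      | .eq => ih m
      | o => o) m) l

/-- Soundness uses only that `.eq` forces equal values. That this is an ordering matters just for
normal forms, hence for the success of the zero test. -/
def Mon.cmp (a b : Mon) : Ordering := match cmpN a.e b.e with
  | .eq => cmpZ a.u b.u
  | o => o

/-- Sums of terms. -/
abbrev Terms := List (ℤ × Mon)

def evalT (v : Env) : Terms → ℂ
  | [] => 0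
  | t :: P => t.1 * t.2.eval v + evalT v P

/-- One step of merging sorted lists: `t` is the head of the first summand and `k` stands for adding
its tail. Cancelling terms are dropped, so that a vanishing sum normalises to the empty list. -/
def addAux (t : ℤ × Mon) (k : Terms → Terms) (Q : Terms) : Terms :=
  List.rec (t :: k []) (fun t' Q ih => match t.2.cmp t'.2 with
    | .lt => t :: k (t' :: Q)
    | .gt => t' :: ih
    | .eq => match Int.add t.1 t'.1 with
      | .ofNat 0 => k Q
      | c => (c, t.2) :: k Q) Q

def addT (P : Terms) : Terms → Terms :=
  List.rec (fun Q => Q) (fun t _ ih => addAux t ih) P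

def mulT1 (t : ℤ × Mon) (P : Terms) : Terms :=
  List.rec [] (fun t' _ ih => (Int.mul t.1 t'.1, t.2.mul t'.2) :: ih) P

def mulT (P Q : Terms) : Terms :=
  List.rec [] (fun t _ ih => addT (mulT1 t Q) ih) P

def smulT (c : ℤ) : Terms → Terms
  | [] => []
  | t :: P => (Int.mul c t.1, t.2) :: smulT c P

/-- A Laurent polynomial: `5760 ^ (-k)` times a sum of terms. -/
structure Poly where
  k : ℕ
  t : Terms

def Poly.eval (v : Env) (P : Poly) : ℂ := ((5760 : ℂ) ^ P.k)⁻¹ * evalT v P.t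

def zero : Poly := ⟨0, []⟩

def add (P Q : Poly) : Poly := match P.t with
  | [] => Q
  | _ => match Q.t with
    | [] => P
    | _ => match Nat.beq P.k Q.k with
      | true => ⟨P.k, addT P.t Q.t⟩
      | false => match Nat.ble P.k Q.k with
        | true => ⟨Q.k, addT (smulT (Int.ofNat (5760 ^ (Q.k - P.k))) P.t) Q.t⟩
        | false => ⟨P.k, addT P.t (smulT (Int.ofNat (5760 ^ (P.k - Q.k))) Q.t)⟩

def mul (P Q : Poly) : Poly := ⟨P.k + Q.k, mulT P.t Q.t⟩

/-- The rational number `n / m`, for `m` dividing `5760`. -/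
def rat (n : ℤ) (m : ℕ) : Poly := ⟨1, [(Int.mul n (Int.ofNat (5760 / m)), ⟨[], []⟩)]⟩

def sub (P Q : Poly) : Poly := add P ⟨Q.k, smulT (-1) Q.t⟩

def mon (c : ℤ) (u : List ℤ) (e : List ℕ) : Poly := ⟨0, [(c, ⟨u, e⟩)]⟩

/-- A one-sided test: an empty list evaluates to zero, and nothing is claimed about a nonempty one.
-/
def isZero (P : Poly) : Bool := match P.t with
  | [] => true
  | _ => false

/-- The partial derivative of a product of natural powers, as a multiple of such a product. -/
def pdN : ℕ → List ℕ → ℕ × List ℕ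
  | _, [] => (0, [])
  | 0, a :: l => (a, (a - 1) :: l)
  | i + 1, a :: l => match pdN i l with
    | (c, m) => (c, a :: m)

def pdZ : ℕ → List ℤ → ℤ × List ℤ
  | _, [] => (0, [])
  | 0, a :: l => (a, (a - 1) :: l)
  | i + 1, a :: l => match pdZ i l with
    | (c, m) => (c, a :: m)

/-- The partial derivative with respect to `τ i`. -/
def pdTN (i : ℕ) : Terms → Terms
  | [] => []
  | t :: P => match pdN i t.2.e with
    | (0, _) => pdTN i P
    | (c, m) => (Int.mul t.1 (Int.ofNat c), ⟨t.2.u, m⟩) :: pdTN i P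

/-- The partial derivative with respect to `ρ i`. -/
def pdTZ (i : ℕ) : Terms → Terms
  | [] => []
  | t :: P => match pdZ i t.2.u with
    | (.ofNat 0, _) => pdTZ i P
    | (c, m) => (Int.mul t.1 c, ⟨m, t.2.e⟩) :: pdTZ i P

/-- The chain rule: `δ i`, for `i ∈ l`, are the derivatives of the variables. -/
def chain (pd : ℕ → Terms → Terms) (δ : ℕ → Poly) (P : Poly) : ℕ → Poly
  | 0 => zero
  | n + 1 => match pd n P.t with
    | [] => chain pd δ P n
    | Q => add (mul (δ n) ⟨P.k, Q⟩) (chain pd δ P n)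

/-- The maximal number of variables in a monomial. -/
def width : Terms → ℕ
  | [] => 0
  | t :: P => max t.2.e.length (width P)

def widthZ : Terms → ℕ
  | [] => 0
  | t :: P => max t.2.u.length (widthZ P)

/-- The derivation with `ρ i ↦ δρ i` and `τ i ↦ δτ i`. -/
def der (δρ δτ : ℕ → Poly) (P : Poly) : Poly :=
  add (chain pdTZ δρ P (widthZ P.t)) (chain pdTN δτ P (width P.t))

/-! #### Soundness -/

theorem addZ_nil (m : List ℤ) : addZ [] m = m := rfl

theorem addZ_cons_nil (a : ℤ) (l : List ℤ) : addZ (a :: l) [] = a :: l := rfl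

theorem addZ_cons_cons (a b : ℤ) (l m : List ℤ) :
    addZ (a :: l) (b :: m) = (a + b) :: addZ l m := rfl

theorem addN_nil (m : List ℕ) : addN [] m = m := rfl

theorem addN_cons_nil (a : ℕ) (l : List ℕ) : addN (a :: l) [] = a :: l := rfl

theorem addN_cons_cons (a b : ℕ) (l m : List ℕ) :
    addN (a :: l) (b :: m) = (a + b) :: addN l m := rfl

theorem cmpN_cons_cons (a b : ℕ) (l m : List ℕ) :
    cmpN (a :: l) (b :: m) = match cmpNat a b with
      | .eq => cmpN l m
      | o => o := rfl

theorem cmpZ_cons_cons (a b : ℤ) (l m : List ℤ) :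
    cmpZ (a :: l) (b :: m) = match cmpInt a b with
      | .eq => cmpZ l m
      | o => o := rfl

theorem addAux_cons (t t' : ℤ × Mon) (k : Terms → Terms) (Q : Terms) :
    addAux t k (t' :: Q) = match t.2.cmp t'.2 with
      | .lt => t :: k (t' :: Q)
      | .gt => t' :: addAux t k Q
      | .eq => match Int.add t.1 t'.1 with
        | .ofNat 0 => k Q
        | c => (c, t.2) :: k Q := rfl

theorem mulT1_cons (t t' : ℤ × Mon) (P : Terms) :
    mulT1 t (t' :: P) = (t.1 * t'.1, t.2.mul t'.2) :: mulT1 t P := rfl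

theorem mulT_cons (t : ℤ × Mon) (P Q : Terms) :
    mulT (t :: P) Q = addT (mulT1 t Q) (mulT P Q) := rfl

theorem evalZ_addZ {ρ : ℕ → ℂ} (h : ∀ i, ρ i ≠ 0) (l m : List ℤ) :
    evalZ ρ (addZ l m) = evalZ ρ l * evalZ ρ m := by
  induction l generalizing ρ m with
  | nil => simp [addZ_nil, evalZ]
  | cons a l ih =>
    cases m with
    | nil => simp [addZ_cons_nil, evalZ]
    | cons b m =>
      simp only [addZ_cons_cons, evalZ, ih (fun i => h (i + 1)), zpow_add₀ (h 0)]
      ring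

theorem evalN_addN (τ : ℕ → ℂ) (l m : List ℕ) :
    evalN τ (addN l m) = evalN τ l * evalN τ m := by
  induction l generalizing τ m with
  | nil => simp [addN_nil, evalN]
  | cons a l ih =>
    cases m with
    | nil => simp [addN_cons_nil, evalN]
    | cons b m =>
      simp only [addN_cons_cons, evalN, ih, pow_add]
      ring

theorem cmpNat_eq {a b : ℕ} (h : cmpNat a b = .eq) : a = b := by
  unfold cmpNat at h
  split at h
  · exact Nat.eq_of_beq_eq_true ‹_›
  · split at h <;> cases h

theorem cmpInt_eq {a b : ℤ} (h : cmpInt a b = .eq) : a = b := by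
  cases a <;> cases b <;> simp only [cmpInt] at h
  · rw [cmpNat_eq h]
  · cases h
  · cases h
  · rw [cmpNat_eq h]

theorem evalN_of_cmpN0 {m : List ℕ} (h : cmpN0 m = .eq) (τ : ℕ → ℂ) : evalN τ m = 1 := by
  induction m generalizing τ with
  | nil => rfl
  | cons b m ih =>
    simp only [cmpN0] at h
    split at h
    · rename_i h0; simp [evalN, ih h, cmpNat_eq h0]
    · simp_all

theorem evalZ_of_cmpZ0 {m : List ℤ} (h : cmpZ0 m = .eq) (ρ : ℕ → ℂ) : evalZ ρ m = 1 := by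
  induction m generalizing ρ with
  | nil => rfl
  | cons b m ih =>
    simp only [cmpZ0] at h
    split at h
    · rename_i h0; simp [evalZ, ih h, cmpInt_eq h0]
    · simp_all

theorem evalN_of_cmpN {l m : List ℕ} (h : cmpN l m = .eq) (τ : ℕ → ℂ) :
    evalN τ l = evalN τ m := by
  induction l generalizing m τ with
  | nil =>
    change (cmpN0 m).swap = .eq at h
    rw [Ordering.swap_eq_eq] at h
    rw [evalN_of_cmpN0 h, evalN]
  | cons a l ih =>
    cases m with
    | nil => rw [evalN_of_cmpN0 h, evalN]
    | cons b m =>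
      rw [cmpN_cons_cons] at h
      split at h
      · rename_i h0; rw [evalN, evalN, ih h, cmpNat_eq h0]
      · simp_all

theorem evalZ_of_cmpZ {l m : List ℤ} (h : cmpZ l m = .eq) (ρ : ℕ → ℂ) :
    evalZ ρ l = evalZ ρ m := by
  induction l generalizing m ρ with
  | nil =>
    change (cmpZ0 m).swap = .eq at h
    rw [Ordering.swap_eq_eq] at h
    rw [evalZ_of_cmpZ0 h, evalZ]
  | cons a l ih =>
    cases m with
    | nil => rw [evalZ_of_cmpZ0 h, evalZ]
    | cons b m =>
      rw [cmpZ_cons_cons] at h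
      split at h
      · rename_i h0; rw [evalZ, evalZ, ih h, cmpInt_eq h0]
      · simp_all

theorem Mon.eval_of_cmp {a b : Mon} (h : a.cmp b = .eq) (v : Env) : a.eval v = b.eval v := by
  unfold Mon.cmp at h
  split at h
  · rw [Mon.eval, Mon.eval, evalN_of_cmpN ‹_›, evalZ_of_cmpZ h]
  · simp_all

/-- All invertible variables have non-zero values. -/
def Env.Good (v : Env) : Prop := ∀ i, v.ρ i ≠ 0

theorem Mon.eval_mul {v : Env} (h : v.Good) (a b : Mon) :
    (a.mul b).eval v = a.eval v * b.eval v := by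
  simp only [Mon.mul, Mon.eval, evalZ_addZ h, evalN_addN]
  ring

/-- Only the effect of the continuation on values is assumed, so no invariant about sorted lists is
required. -/
theorem evalT_addAux (v : Env) (t : ℤ × Mon) (P : Terms) (k : Terms → Terms)
    (hk : ∀ Q, evalT v (k Q) = evalT v P + evalT v Q) (Q : Terms) :
    evalT v (addAux t k Q) = t.1 * t.2.eval v + evalT v P + evalT v Q := by
  induction Q with
  | nil => change evalT v (t :: k []) = _; simp [evalT, hk]
  | cons t' Q ih =>
    rw [addAux_cons]
    split
    · simp only [evalT, hk]; ring
    · simp only [evalT, ih]; ring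
    · rename_i hc
      have e := Mon.eval_of_cmp hc v
      split
      · rename_i h0
        have h1 : (t.1 : ℂ) + t'.1 = 0 := by
          have : t.1 + t'.1 = 0 := h0
          exact_mod_cast this
        rw [hk, evalT, ← e]
        linear_combination (-t.2.eval v) * h1
      · simp only [evalT, hk, ← e, Int.add_def]
        push_cast
        ring

theorem evalT_addT (v : Env) (P Q : Terms) : evalT v (addT P Q) = evalT v P + evalT v Q := by
  induction P generalizing Q with
  | nil => change evalT v Q = _; simp [evalT]
  | cons t P ih =>
    change evalT v (addAux t (addT P) Q) = _
    rw [evalT_addAux v t P _ ih, evalT]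

theorem evalT_mulT1 {v : Env} (h : v.Good) (t : ℤ × Mon) (P : Terms) :
    evalT v (mulT1 t P) = t.1 * t.2.eval v * evalT v P := by
  induction P with
  | nil => change evalT v [] = _; simp [evalT]
  | cons t' P ih =>
    simp only [mulT1_cons, evalT, ih, Mon.eval_mul h]
    push_cast
    ring

theorem evalT_mulT {v : Env} (h : v.Good) (P Q : Terms) :
    evalT v (mulT P Q) = evalT v P * evalT v Q := by
  induction P with
  | nil => change evalT v [] = _; simp [evalT]
  | cons t P ih =>
    simp only [mulT_cons, evalT, evalT_addT, evalT_mulT1 h, ih]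
    ring

theorem evalT_smulT (v : Env) (c : ℤ) (P : Terms) : evalT v (smulT c P) = c * evalT v P := by
  induction P with
  | nil => simp [smulT, evalT]
  | cons t P ih =>
    simp only [smulT, evalT, ih, Int.mul_def]
    push_cast
    ring

@[simp] theorem eval_zero (v : Env) : zero.eval v = 0 := by simp [zero, Poly.eval, evalT]

theorem eval_add (v : Env) (P Q : Poly) : (add P Q).eval v = P.eval v + Q.eval v := by
  -- Passage to the larger of the two denominators.
  have key : ∀ a b : ℕ, a ≤ b → ((5760 : ℂ) ^ b)⁻¹ * 5760 ^ (b - a) = (5760 ^ a)⁻¹ := by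
    intro a b hab
    obtain ⟨c, rfl⟩ := Nat.exists_eq_add_of_le hab
    rw [Nat.add_sub_cancel_left, pow_add]
    field_simp
  unfold add
  split
  · rename_i h; simp [Poly.eval, h, evalT]
  split
  · rename_i h; simp [Poly.eval, h, evalT]
  split
  · rename_i h
    have h : P.k = Q.k := Nat.eq_of_beq_eq_true h
    simp only [Poly.eval, evalT_addT, h]; ring
  split
  · rename_i h
    have h : P.k ≤ Q.k := Nat.le_of_ble_eq_true h
    simp only [Poly.eval, evalT_addT, evalT_smulT, ← key _ _ h, Int.ofNat_eq_natCast]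
    push_cast; ring
  · rename_i h
    have h : Q.k ≤ P.k := by
      by_contra h'
      exact h' (by have := Nat.ble_eq_true_of_le (by omega : P.k ≤ Q.k); rw [this] at h; cases h)
    simp only [Poly.eval, evalT_addT, evalT_smulT, ← key _ _ h, Int.ofNat_eq_natCast]
    push_cast; ring

theorem eval_mul {v : Env} (h : v.Good) (P Q : Poly) :
    (mul P Q).eval v = P.eval v * Q.eval v := by
  simp only [mul, Poly.eval, evalT_mulT h, pow_add, mul_inv]
  ring

theorem eval_sub (v : Env) (P Q : Poly) : (sub P Q).eval v = P.eval v - Q.eval v := by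
  rw [sub, eval_add]
  simp only [Poly.eval, evalT_smulT]
  push_cast; ring

theorem eval_rat (v : Env) (n : ℤ) (m : ℕ) (h : m ∣ 5760) :
    (rat n m).eval v = n / m := by
  obtain ⟨c, hc⟩ := h
  have hm : m ≠ 0 := by rintro rfl; simp at hc
  have hm' : (m : ℂ) ≠ 0 := by exact_mod_cast hm
  have hc' : (5760 : ℂ) = m * c := by exact_mod_cast hc
  have h0 : (m * c : ℂ) ≠ 0 := by rw [← hc']; norm_num
  have hdiv : 5760 / m = c := by rw [hc]; exact Nat.mul_div_cancel_left c (Nat.pos_of_ne_zero hm)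
  simp only [rat, Poly.eval, evalT, Mon.eval, evalZ, evalN, hdiv, Int.mul_def, pow_one,
    Int.ofNat_eq_natCast]
  rw [hc']
  have : (c : ℂ) ≠ 0 := right_ne_zero_of_mul h0
  push_cast
  field_simp
  ring

theorem eval_mon (v : Env) (c : ℤ) (u : List ℤ) (e : List ℕ) :
    (mon c u e).eval v = c * (evalZ v.ρ u * evalN v.τ e) := by
  simp [mon, Poly.eval, evalT, Mon.eval]

theorem eval_eq_zero_of_isZero {P : Poly} (h : isZero P = true) (v : Env) : P.eval v = 0 := by
  unfold isZero at h
  split at h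
  · rename_i h0; simp [Poly.eval, h0, evalT]
  · cases h

theorem eval_eq_of_isZero_sub {P Q : Poly} (h : isZero (sub P Q) = true) (v : Env) :
    P.eval v = Q.eval v := by
  have := eval_eq_zero_of_isZero h v
  rw [eval_sub] at this
  exact sub_eq_zero.1 this

/-- The summation range may exceed the length of the list, since `pdN` returns coefficient zero
there. This lets monomials of different width share one range. -/
theorem hasDerivAt_evalN {τ : ℂ → ℕ → ℂ} {δ : ℕ → ℂ} {t : ℂ} (l : List ℕ)
    (h : ∀ i < l.length, HasDerivAt (fun z => τ z i) (δ i) t) (n : ℕ) (hn : l.length ≤ n) :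
    HasDerivAt (fun z => evalN (τ z) l)
      (∑ i ∈ Finset.range n, δ i * ((pdN i l).1 * evalN (τ t) (pdN i l).2)) t := by
  induction l generalizing τ δ n with
  | nil => simpa [evalN, pdN] using hasDerivAt_const t (1 : ℂ)
  | cons a l ih =>
    obtain ⟨n, rfl⟩ : ∃ k, n = k + 1 := ⟨n - 1, by simp at hn; omega⟩
    have h0 := (h 0 (by simp)).pow a
    have h1 := ih (τ := fun z i => τ z (i + 1)) (δ := fun i => δ (i + 1))
      (fun i hi => h (i + 1) (by simpa using hi)) n (by simpa using hn)
    have h2 := h0.mul h1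
    simp only [evalN]
    refine HasDerivAt.congr_deriv h2 ?_
    rw [Finset.sum_range_succ', Finset.mul_sum, add_comm]
    congr 1
    · refine Finset.sum_congr rfl fun i _ => ?_
      simp only [pdN, evalN, Pi.pow_apply]; ring
    · simp only [pdN, evalN]; ring

theorem hasDerivAt_evalZ {ρ : ℂ → ℕ → ℂ} {δ : ℕ → ℂ} {t : ℂ} (l : List ℤ)
    (h0 : ∀ i, ρ t i ≠ 0)
    (h : ∀ i < l.length, HasDerivAt (fun z => ρ z i) (δ i) t) (n : ℕ) (hn : l.length ≤ n) :
    HasDerivAt (fun z => evalZ (ρ z) l)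
      (∑ i ∈ Finset.range n, δ i * ((pdZ i l).1 * evalZ (ρ t) (pdZ i l).2)) t := by
  induction l generalizing ρ δ n with
  | nil => simpa [evalZ, pdZ] using hasDerivAt_const t (1 : ℂ)
  | cons a l ih =>
    obtain ⟨n, rfl⟩ : ∃ k, n = k + 1 := ⟨n - 1, by simp at hn; omega⟩
    have h1 := (hasDerivAt_zpow a (ρ t 0) (Or.inl (h0 0))).comp t (h 0 (by simp))
    have h2 := ih (ρ := fun z i => ρ z (i + 1)) (δ := fun i => δ (i + 1)) (fun i => h0 (i + 1))
      (fun i hi => h (i + 1) (by simpa using hi)) n (by simpa using hn)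
    have h3 := h1.mul h2
    simp only [evalZ]
    refine HasDerivAt.congr_deriv h3 ?_
    rw [Finset.sum_range_succ', Finset.mul_sum, add_comm]
    congr 1
    · refine Finset.sum_congr rfl fun i _ => ?_
      simp only [pdZ, evalZ, Function.comp_apply]; ring
    · simp only [pdZ, evalZ]; ring

theorem evalT_pdTN (v : Env) (i : ℕ) (t : ℤ × Mon) (P : Terms) :
    evalT v (pdTN i (t :: P))
      = t.1 * (evalZ v.ρ t.2.u * ((pdN i t.2.e).1 * evalN v.τ (pdN i t.2.e).2))
        + evalT v (pdTN i P) := by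
  rw [pdTN]
  split
  · rename_i h; simp [h]
  · rename_i h; simp [h, evalT, Mon.eval]; ring

theorem evalT_pdTZ (v : Env) (i : ℕ) (t : ℤ × Mon) (P : Terms) :
    evalT v (pdTZ i (t :: P))
      = t.1 * ((pdZ i t.2.u).1 * evalZ v.ρ (pdZ i t.2.u).2 * evalN v.τ t.2.e)
        + evalT v (pdTZ i P) := by
  rw [pdTZ]
  split
  · rename_i h; simp [h]
  · rename_i h; simp [h, evalT, Mon.eval]; ring

theorem hasDerivAt_evalT {v : ℂ → Env} {δρ δτ : ℕ → ℂ} {t : ℂ} (P : Terms) (h0 : (v t).Good)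
    {m n : ℕ} (hm : widthZ P ≤ m) (hn : width P ≤ n)
    (hρ : ∀ i < widthZ P, HasDerivAt (fun z => (v z).ρ i) (δρ i) t)
    (hτ : ∀ i < width P, HasDerivAt (fun z => (v z).τ i) (δτ i) t) :
    HasDerivAt (fun z => evalT (v z) P)
      (∑ i ∈ Finset.range m, δρ i * evalT (v t) (pdTZ i P)
        + ∑ i ∈ Finset.range n, δτ i * evalT (v t) (pdTN i P)) t := by
  induction P with
  | nil => simpa [evalT, pdTZ, pdTN] using hasDerivAt_const t (0 : ℂ)
  | cons a P ih =>
    simp only [widthZ, width, max_le_iff] at hm hn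
    simp only [widthZ, width, lt_max_iff] at hρ hτ
    have h1 := hasDerivAt_evalZ (ρ := fun z => (v z).ρ) a.2.u h0 (fun i hi => hρ i (Or.inl hi)) m hm.1
    have h2 := hasDerivAt_evalN (τ := fun z => (v z).τ) a.2.e (fun i hi => hτ i (Or.inl hi)) n hn.1
    have h3 := ((h1.mul h2).const_mul (a.1 : ℂ)).add
      (ih hm.2 hn.2 (fun i hi => hρ i (Or.inr hi)) (fun i hi => hτ i (Or.inr hi)))
    simp only [evalT]
    refine HasDerivAt.congr_deriv h3 ?_
    simp only [evalT_pdTZ, evalT_pdTN, mul_add, Finset.sum_add_distrib, Finset.mul_sum,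
      Finset.sum_mul]
    have e1 : ∀ i ∈ Finset.range m, (a.1 : ℂ) * (δρ i * ((pdZ i a.2.u).1 *
        evalZ (v t).ρ (pdZ i a.2.u).2) * evalN (v t).τ a.2.e) = δρ i * (a.1 * ((pdZ i a.2.u).1 *
        evalZ (v t).ρ (pdZ i a.2.u).2 * evalN (v t).τ a.2.e)) := fun i _ => by ring
    have e2 : ∀ i ∈ Finset.range n, (a.1 : ℂ) * (evalZ (v t).ρ a.2.u * (δτ i * ((pdN i a.2.e).1 *
        evalN (v t).τ (pdN i a.2.e).2))) = δτ i * (a.1 * (evalZ (v t).ρ a.2.u * ((pdN i a.2.e).1 *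
        evalN (v t).τ (pdN i a.2.e).2))) := fun i _ => by ring
    rw [Finset.sum_congr rfl e1, Finset.sum_congr rfl e2]
    ring

theorem eval_chain {v : Env} (h0 : v.Good) (pd : ℕ → Terms → Terms) (δ : ℕ → Poly) (P : Poly)
    (n : ℕ) : (chain pd δ P n).eval v
      = ((5760 : ℂ) ^ P.k)⁻¹ * ∑ i ∈ Finset.range n, (δ i).eval v * evalT v (pd i P.t) := by
  induction n with
  | zero => simp [chain]
  | succ n ih =>
    rw [chain, Finset.sum_range_succ]
    split
    · rename_i h; rw [ih, h]; simp [evalT]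
    · rw [eval_add, eval_mul h0, ih]; simp only [Poly.eval]; ring

/-- `der` computes derivatives. -/
theorem hasDerivAt_eval {v : ℂ → Env} {δρ δτ : ℕ → Poly} {t : ℂ} (P : Poly) (h0 : (v t).Good)
    (hρ : ∀ i < widthZ P.t, HasDerivAt (fun z => (v z).ρ i) ((δρ i).eval (v t)) t)
    (hτ : ∀ i < width P.t, HasDerivAt (fun z => (v z).τ i) ((δτ i).eval (v t)) t) :
    HasDerivAt (fun z => P.eval (v z)) ((der δρ δτ P).eval (v t)) t := by
  have := (hasDerivAt_evalT P.t h0 le_rfl le_rfl hρ hτ).const_mul ((5760 : ℂ) ^ P.k)⁻¹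
  refine HasDerivAt.congr_deriv this ?_
  rw [der, eval_add, eval_chain h0, eval_chain h0]
  ring

end LPoly

end

/-! ### The correlation functions as Laurent polynomials

The invertible variables are `s`, `y`, `p₀ = v₁ + s u₁` and `q₀ = v₁ - s u₁`, where `s² = φ'(u)` and
`y = s ℰ¹`.  The other variables are `d`, `v`, `u`, `φ(u)`, `24 ψ(u)` and, for `n > 0`,
`pₙ = v_{n+1} + s u_{n+1}`, `qₙ = v_{n+1} - s u_{n+1}`. -/

noncomputable section

namespace TopGrav.Sym

open LPoly

/-- A case distinction that the kernel reduces at once, in place of vector notation. -/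
def pick {α : Type*} (x y : α) : Fin 2 → α
  | ⟨0, _⟩ => x
  | ⟨_ + 1, _⟩ => y

def sum2 (f : Fin 2 → Poly) : Poly := add (f 0) (f 1)

/-- A list with `n` zeros followed by a one. -/
def unitList : ℕ → List ℕ
  | 0 => [1]
  | n + 1 => 0 :: unitList n

def half : Poly := rat 1 2

/-- The symbols for `u^a_n`. -/
def jet : ℕ → Fin 2 → Poly
  | 0, a => pick (mon 1 [] [0, 1]) (mon 1 [] [0, 0, 1]) a
  | 1, a => pick (mul half (add (mon 1 [0, 0, 1] []) (mon 1 [0, 0, 0, 1] [])))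
      (mul half (sub (mon 1 [-1, 0, 1] []) (mon 1 [-1, 0, 0, 1] []))) a
  | n + 2, a => pick
      (mul half (add (mon 1 [] (unitList (5 + 2 * n))) (mon 1 [] (unitList (6 + 2 * n)))))
      (mul half (sub (mon 1 [-1] (unitList (5 + 2 * n))) (mon 1 [-1] (unitList (6 + 2 * n))))) a

/-- The derivative of `s`, from the derivative of `u`. -/
def derS (c : Poly) : Poly := mul (mon 1 [2, -1] [1]) c

/-- The derivatives of the invertible variables along the vector field with coefficients `X`. -/
def derU (X : ℕ → Fin 2 → Poly) : ℕ → Poly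
  | 0 => derS (X 0 1)
  | 1 => mul (mon 1 [1] []) (X 0 1)
  | 2 => add (X 1 0) (add (mul (mon 1 [1] []) (X 1 1)) (mul (derS (X 0 1)) (jet 1 1)))
  | 3 => sub (X 1 0) (add (mul (mon 1 [1] []) (X 1 1)) (mul (derS (X 0 1)) (jet 1 1)))
  | _ => zero

/-- The symbol `-24 ψ'(u) ℰ¹`. -/
def psiCoeff : Poly := add (mon 3 [] [2]) (mon (-1) [] [1])

/-- The derivatives of the other variables: `a = 0` for `pₙ`, `a = 1` for `qₙ`. -/
def derJ (X : ℕ → Fin 2 → Poly) (n : ℕ) : ℕ → Poly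
  | 0 => add (X (n + 2) 0)
      (add (mul (mon 1 [1] []) (X (n + 2) 1)) (mul (derS (X 0 1)) (jet (n + 2) 1)))
  | 1 => sub (X (n + 2) 0)
      (add (mul (mon 1 [1] []) (X (n + 2) 1)) (mul (derS (X 0 1)) (jet (n + 2) 1)))
  | i + 2 => derJ X (n + 1) i

/-- The indices 0 to 4 are `d`, `v`, `u`, `φ`, `24 ψ`, and `pₙ`, `qₙ` alternate afterwards. Entry 4
uses `1/ℰ¹ = s/y`. -/
def derE (X : ℕ → Fin 2 → Poly) : ℕ → Poly
  | 0 => zero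
  | 1 => X 0 0
  | 2 => X 0 1
  | 3 => mul (mon 1 [2] []) (X 0 1)
  | 4 => mul (mul (mon (-1) [1, -1] []) psiCoeff) (X 0 1)
  | i + 5 => derJ X 0 i

def deriv (X : ℕ → Fin 2 → Poly) (P : Poly) : Poly := der (derU X) (derE X) P

def tot (P : Poly) : Poly := deriv (fun n a => jet (n + 1) a) P

def U : Fin 2 → Fin 2 → Poly
  | a, b => pick (pick (jet 0 0) (jet 0 1) b) (pick (mon 1 [] [0, 0, 0, 1]) (jet 0 0) b) a

def dU : Fin 2 → Fin 2 → Poly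
  | a, b => pick (pick (jet 1 0) (jet 1 1) b) (pick (mul (mon 1 [2] []) (jet 1 1)) (jet 1 0) b) a

def faa : ℕ → ℕ → Fin 2 → Fin 2 → Poly
  | 0, 0, a, b => dU a b
  | 0, _ + 1, _, _ => zero
  | n + 1, 0, a, b => tot (faa n 0 a b)
  | n + 1, k + 1, a, b =>
      add (tot (faa n (k + 1) a b)) (sum2 fun c => mul (dU a c) (faa n k c b))

def eth (k : ℕ) (a : Fin 2) (P : Poly) : Poly := deriv (fun n b => faa n k a b) P

def dual (a : Fin 2) : Fin 2 := pick 1 0 a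

def cor0 (a b : Fin 2) : List (Fin 2) → Poly
  | [] => U a (dual b)
  | c :: l => eth 0 c (cor0 a b l)

def det : Poly := mon 1 [0, 0, 1, 1] []

def detInv : Poly := mon 1 [0, 0, -1, -1] []

/-- The rows of the adjugate of `∂𝒰` are interchanged by the raised first index. -/
def C (a b : Fin 2) : Poly :=
  mul detInv (pick (pick (mul (mon (-1) [2] []) (jet 1 1)) (jet 1 0) b)
    (pick (jet 1 0) (mul (mon (-1) [] []) (jet 1 1)) b) a)

/-- The symbol for `psiD φ (24 ψ)`. -/
def psiD (a : Fin 2) : List (Fin 2) → Poly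
  | [] => eth 0 a (mon 1 [] [0, 0, 0, 0, 1])
  | c :: l => eth 0 c (psiD a l)

def cor1 (a : Fin 2) : List (Fin 2) → Poly
  | [] => mul (rat 1 24) (add (mul (eth 0 a det) detInv) (psiD a []))
  | c :: l => eth 0 c (cor1 a l)

def R21 : ℕ → Fin 2 → Poly
  | 2, a => sum2 fun b => sum2 fun c =>
      add (sub (add (mul (cor0 a b [c])
          (add (mul (rat 7 10) (mul (cor1 (dual b) []) (cor1 (dual c) [])))
            (mul (rat 1 10) (cor1 (dual b) [dual c]))))
        (mul (rat 13 240) (mul (cor0 a b [c, dual c]) (cor1 (dual b) []))))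
        (mul (rat 1 240) (mul (cor1 a [dual b]) (cor0 b c [dual c]))))
        (mul (rat 1 960) (cor0 a b [dual b, c, dual c]))
  | 3, a => add
      (sum2 fun b => sum2 fun c => sum2 fun d => mul (cor0 a b [c])
        (add (mul (rat 1 20) (mul (cor1 (dual b) []) (cor0 (dual c) (dual d) [d])))
          (mul (rat 1 480) (cor0 (dual b) (dual c) [dual d, d]))))
      (sum2 fun b => sum2 fun c => sum2 fun d =>
        mul (rat 1 1152) (mul (cor0 a (dual b) [dual c, c]) (cor0 b (dual d) [d])))
  | 4, a => sum2 fun b => sum2 fun c => sum2 fun d => sum2 fun e =>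
      mul (rat 1 1152) (mul (cor0 a (dual b) [dual c])
        (mul (cor0 b c [dual d]) (cor0 d (dual e) [e])))
  | _, _ => zero

def R22 (a b : Fin 2) : Poly :=
  sum2 fun c => sum2 fun d =>
    add (mul (rat 13 10) (mul (cor0 a b [c, d]) (mul (cor1 (dual c) []) (cor1 (dual d) []))))
    (add (mul (rat 4 5) (mul (add (mul (cor1 a [c]) (cor1 d [])) (mul (rat 1 24) (cor1 a [c, d])))
          (cor0 b (dual c) [dual d])))
    (add (mul (rat 4 5) (mul (cor0 a (dual c) [dual d])
          (add (mul (cor1 b [c]) (cor1 d [])) (mul (rat 1 24) (cor1 b [c, d])))))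
    (add (mul (rat (-4) 5) (mul (cor0 a b [c])
          (add (mul (cor1 (dual c) [d]) (cor1 (dual d) []))
            (mul (rat 1 24) (cor1 (dual c) [d, dual d])))))
    (add (mul (rat 1 48) (mul (cor0 a c [d, dual d]) (cor1 (dual c) [b])))
    (add (mul (rat 1 48) (mul (cor1 a [c]) (cor0 b (dual c) [d, dual d])))
    (add (mul (rat 23 240) (mul (cor0 a b [c, d, dual d]) (cor1 (dual c) [])))
    (add (mul (rat (-1) 80) (mul (cor1 a [b, c]) (cor0 (dual c) (dual d) [d])))
    (add (mul (rat 7 30) (mul (cor0 a b [c, d]) (cor1 (dual c) [dual d])))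
      (mul (rat 1 576) (cor0 a b [c, dual c, d, dual d]))))))))))

/-- The sums are nested so that indices are contracted successively and common propagator factors
are pulled out, which keeps the expansion affordable. -/
def F20 : Poly :=
  let T2 := fun a b => tot (tot (cor0 a b []))
  let T3 := fun a b c => tot (cor0 a b [c])
  add (mul (rat 1 1152) (sum2 fun a => sum2 fun b => mul (C a b)
      (sum2 fun c => sum2 fun d => mul (C c d) (tot (tot (cor0 a b [c, d]))))))
  (add (mul (rat (-1) 1152) (sum2 fun a => sum2 fun b => mul (T2 a b)
      (sum2 fun c => mul (C a c) (sum2 fun d => mul (C b d)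
        (sum2 fun e => sum2 fun f => mul (C e f) (tot (cor0 c d [e, f])))))))
  (add (mul (rat (-1) 360) (sum2 fun a => sum2 fun b => sum2 fun c => mul (tot (T3 a b c))
      (sum2 fun d => mul (C a d) (sum2 fun e => mul (C b e) (sum2 fun f => mul (C c f) (T3 d e f))))))
    (mul (rat 1 360) (sum2 fun a => sum2 fun b => mul (T2 a b)
      (sum2 fun c => mul (C a c) (sum2 fun d => sum2 fun e => mul (T3 c d e)
        (sum2 fun f => mul (C b f) (sum2 fun g => mul (C d g) (sum2 fun h => mul (C e h)
          (T3 f g h))))))))))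

def F21 : Poly :=
  let T2 := fun a b => tot (tot (cor0 a b []))
  let T3 := fun a b c => tot (cor0 a b [c])
  mul (rat 1 576)
  (add (sum2 fun a => sum2 fun b => mul (C a b)
      (add (mul half (tot (psiD a [b]))) (mul (rat 4 5) (mul (tot (psiD a [])) (psiD b [])))))
  (add (sum2 fun a => sum2 fun b => mul (T2 a b) (sum2 fun c => mul (C a c) (sum2 fun d => mul (C b d)
      (sub (mul (rat 6 5) (psiD c [d])) (mul (rat 1 10) (mul (psiD c []) (psiD d [])))))))
  (add (sum2 fun a => sum2 fun b => mul (C a b) (sum2 fun c => sum2 fun d => mul (C c d)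
      (sub (mul (rat 7 10) (mul (tot (T3 a b c)) (psiD d [])))
        (mul (rat 3 10) (mul (T3 a b c) (tot (psiD d [])))))))
  (add (sum2 fun a => sum2 fun b => mul (T2 a b) (sum2 fun c => sum2 fun d => sum2 fun e =>
      mul (T3 c d e) (sum2 fun f => mul (psiD f [])
        (sub (mul (rat 3 10) (mul (C a f) (mul (C b c) (C d e))))
          (mul (rat 23 10) (mul (C a c) (mul (C b d) (C e f))))))))
    (mul (mul (rat 1 10) (mul (mul (jet 1 1) (jet 1 1)) (mul (jet 1 1) (jet 1 1))))
      -- Here `φ'' = 2 d s²/ℰ¹` and `Ψ'' = (3d² - d)(1 - d)/(ℰ¹)²`, and `(ℰ¹)⁻³ = s³ y⁻³`.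
      (mul (mul (mon 2 [5, -3] [1]) (mul psiCoeff (sub (mon 1 [] []) (mon 1 [] [1])))) detInv))))))

/-- The symbols for the components of the Euler vector field. -/
def euler (a : Fin 2) : Poly := pick (jet 0 0) (mon 1 [-1, 1] []) a

/-- The symbol `1 - d`. -/
def oneSubD : Poly := sub (mon 1 [] []) (mon 1 [] [1])

def ell0 : ℕ → Fin 2 → Poly
  | 0, a => sub zero (euler a)
  | n + 1, a => sub (tot (ell0 n a)) (mul (mul half oneSubD) (jet (n + 1) a))

/-- The coefficients of `c ∂/∂u^a_n`. -/
def coord (c : ℤ) (n : ℕ) (a : Fin 2) (m : ℕ) (b : Fin 2) : Poly :=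
  match Nat.beq m n, Nat.beq b.val a.val with
  | true, true => mon c [] []
  | _, _ => zero

def A (b c a : Fin 2) : Poly := deriv (coord 1 0 c) (U b a)

/-- The matrix coefficients in row 0 are `(1-d)/2 · (3-d)/2` for `ð_{1,0}`, `(1-d) v` for `ð_{0,0}`,
and `ℰ¹` for `ð_{0,1}`. In the last one the two factors `μ + 1/2` add up to 1. -/
def ell1 : ℕ → Fin 2 → Poly
  | 0, a => sub zero (sum2 fun b => sum2 fun c => mul (mul (euler b) (euler c)) (A b c a))
  | n + 1, a => sub (tot (ell1 n a))
      (add (mul (mul (mul half oneSubD) (mul half (sub (mon 3 [] []) (mon 1 [] [1]))))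
          (faa n 1 0 a))
        (add (mul (mul oneSubD (jet 0 0)) (faa n 0 0 a)) (mul (euler 1) (faa n 0 1 a))))

/-- The coefficients of the dilaton vector field. -/
def dil : ℕ → Fin 2 → Poly
  | 0, _ => zero
  | n + 1, a => mul (mon (Int.ofNat (n + 1)) [] []) (jet (n + 1) a)

/-- The genus 1 contribution to the Virasoro constraint `L₁ Z = 0`. -/
def virasoroSource : Poly :=
  mul (mul (rat 1 8) (sub (mon 1 [] []) (mon 1 [] [2])))
    (sum2 fun a => add (mul (cor1 a []) (cor1 (dual a) [])) (cor1 a [dual a]))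

/-- The symbol for the function `h₀`. -/
def h0 : Poly :=
  let lin := fun a b => add (mon a [] [1]) (mon b [] [])
  mul (mul (rat (-1) 5760) (mon 1 [1, -3] [1]))
    (mul (mul oneSubD oneSubD) (mul (lin 3 (-1)) (mul (lin 3 (-5)) (lin 1 (-2)))))

/-- The symbol for `h₀ (p₀² + q₀²) / 4`. -/
def correction : Poly := mul (mul (rat 1 4) h0) (add (mon 1 [0, 0, 2] []) (mon 1 [0, 0, 0, 2] []))

end TopGrav.Sym

end

/-! ### Kernel-checked identities for the particular solution. -/

noncomputable section

namespace TopGrav.Sym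

open LPoly

/-- The particular solution `F20 + F21`, multiplied by `184320`. -/
def potentialTerms : Terms :=
  [(-320, ⟨[1, 0, 0, -2], [0, 0, 0, 0, 0, 0, 0, 0, 0, 0, 1]⟩),
   (320, ⟨[1, 0, -2], [0, 0, 0, 0, 0, 0, 0, 0, 0, 1]⟩),
   (1344, ⟨[1, 0, 0, -3], [0, 0, 0, 0, 0, 0, 1, 0, 1]⟩),
   (-1024, ⟨[1, 0, 0, -4], [0, 0, 0, 0, 0, 0, 3]⟩),
   (-1344, ⟨[1, 0, -3], [0, 0, 0, 0, 0, 1, 0, 1]⟩), (1024, ⟨[1, 0, -4], [0, 0, 0, 0, 0, 3]⟩),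
   (40, ⟨[1, -3, -2, 4], [1]⟩), (-200, ⟨[1, -3, -1, 3], [1]⟩), (520, ⟨[1, -3, 0, 2], [1]⟩),
   (-720, ⟨[1, -3, 1, 1], [1]⟩), (520, ⟨[1, -3, 2], [1]⟩), (-200, ⟨[1, -3, 3, -1], [1]⟩),
   (40, ⟨[1, -3, 4, -2], [1]⟩), (320, ⟨[1, -1, -2, 1], [1, 0, 0, 0, 0, 0, 0, 0, 1]⟩),
   (-400, ⟨[1, -1, -1], [1, 0, 0, 0, 0, 0, 0, 0, 1]⟩),
   (592, ⟨[1, -1, 0, -1], [1, 0, 0, 0, 0, 0, 0, 0, 1]⟩),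
   (208, ⟨[1, -1, 1, -2], [1, 0, 0, 0, 0, 0, 0, 0, 1]⟩),
   (-336, ⟨[1, -1, 2, -3], [1, 0, 0, 0, 0, 0, 0, 0, 1]⟩),
   (-336, ⟨[1, -1, -3, 2], [1, 0, 0, 0, 0, 0, 0, 1]⟩),
   (208, ⟨[1, -1, -2, 1], [1, 0, 0, 0, 0, 0, 0, 1]⟩),
   (592, ⟨[1, -1, -1], [1, 0, 0, 0, 0, 0, 0, 1]⟩),
   (-400, ⟨[1, -1, 0, -1], [1, 0, 0, 0, 0, 0, 0, 1]⟩),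
   (320, ⟨[1, -1, 1, -2], [1, 0, 0, 0, 0, 0, 0, 1]⟩),
   (240, ⟨[1, -2, -2, 2], [1, 0, 0, 0, 0, 0, 1]⟩),
   (-600, ⟨[1, -2, -1, 1], [1, 0, 0, 0, 0, 0, 1]⟩), (928, ⟨[1, -2], [1, 0, 0, 0, 0, 0, 1]⟩),
   (-112, ⟨[1, -2, 1, -1], [1, 0, 0, 0, 0, 0, 1]⟩),
   (-272, ⟨[1, -2, 2, -2], [1, 0, 0, 0, 0, 0, 1]⟩),
   (168, ⟨[1, -2, 3, -3], [1, 0, 0, 0, 0, 0, 1]⟩), (240, ⟨[1, -1, -2], [1, 0, 0, 0, 0, 0, 2]⟩),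
   (-528, ⟨[1, -1, 0, -2], [1, 0, 0, 0, 0, 0, 2]⟩),
   (-288, ⟨[1, -1, 1, -3], [1, 0, 0, 0, 0, 0, 2]⟩),
   (768, ⟨[1, -1, 2, -4], [1, 0, 0, 0, 0, 0, 2]⟩), (-168, ⟨[1, -2, -3, 3], [1, 0, 0, 0, 0, 1]⟩),
   (272, ⟨[1, -2, -2, 2], [1, 0, 0, 0, 0, 1]⟩), (112, ⟨[1, -2, -1, 1], [1, 0, 0, 0, 0, 1]⟩),
   (-928, ⟨[1, -2], [1, 0, 0, 0, 0, 1]⟩), (600, ⟨[1, -2, 1, -1], [1, 0, 0, 0, 0, 1]⟩),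
   (-240, ⟨[1, -2, 2, -2], [1, 0, 0, 0, 0, 1]⟩), (-1008, ⟨[1, -1, -3, 1], [1, 0, 0, 0, 0, 1, 1]⟩),
   (544, ⟨[1, -1, -2], [1, 0, 0, 0, 0, 1, 1]⟩), (-160, ⟨[1, -1, -1, -1], [1, 0, 0, 0, 0, 1, 1]⟩),
   (544, ⟨[1, -1, 0, -2], [1, 0, 0, 0, 0, 1, 1]⟩),
   (-1008, ⟨[1, -1, 1, -3], [1, 0, 0, 0, 0, 1, 1]⟩), (768, ⟨[1, -1, -4, 2], [1, 0, 0, 0, 0, 2]⟩),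
   (-288, ⟨[1, -1, -3, 1], [1, 0, 0, 0, 0, 2]⟩), (-528, ⟨[1, -1, -2], [1, 0, 0, 0, 0, 2]⟩),
   (240, ⟨[1, -1, 0, -2], [1, 0, 0, 0, 0, 2]⟩), (-42, ⟨[1, -3, -3, 5], [2]⟩),
   (54, ⟨[1, -3, -2, 4], [2]⟩), (368, ⟨[1, -3, -1, 3], [2]⟩), (-1750, ⟨[1, -3, 0, 2], [2]⟩),
   (2740, ⟨[1, -3, 1, 1], [2]⟩), (-1750, ⟨[1, -3, 2], [2]⟩), (368, ⟨[1, -3, 3, -1], [2]⟩),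
   (54, ⟨[1, -3, 4, -2], [2]⟩), (-42, ⟨[1, -3, 5, -3], [2]⟩),
   (-1152, ⟨[1, -1, 0, -1], [2, 0, 0, 0, 0, 0, 0, 0, 1]⟩),
   (-1152, ⟨[1, -1, -1], [2, 0, 0, 0, 0, 0, 0, 1]⟩),
   (-252, ⟨[1, -2, -3, 3], [2, 0, 0, 0, 0, 0, 1]⟩),
   (172, ⟨[1, -2, -2, 2], [2, 0, 0, 0, 0, 0, 1]⟩), (836, ⟨[1, -2, -1, 1], [2, 0, 0, 0, 0, 0, 1]⟩),
   (-2744, ⟨[1, -2], [2, 0, 0, 0, 0, 0, 1]⟩), (60, ⟨[1, -2, 1, -1], [2, 0, 0, 0, 0, 0, 1]⟩),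
   (540, ⟨[1, -2, 2, -2], [2, 0, 0, 0, 0, 0, 1]⟩), (60, ⟨[1, -2, 3, -3], [2, 0, 0, 0, 0, 0, 1]⟩),
   (-192, ⟨[1, -2, 4, -4], [2, 0, 0, 0, 0, 0, 1]⟩),
   (1056, ⟨[1, -1, 0, -2], [2, 0, 0, 0, 0, 0, 2]⟩), (192, ⟨[1, -2, -4, 4], [2, 0, 0, 0, 0, 1]⟩),
   (-60, ⟨[1, -2, -3, 3], [2, 0, 0, 0, 0, 1]⟩), (-540, ⟨[1, -2, -2, 2], [2, 0, 0, 0, 0, 1]⟩),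
   (-60, ⟨[1, -2, -1, 1], [2, 0, 0, 0, 0, 1]⟩), (2744, ⟨[1, -2], [2, 0, 0, 0, 0, 1]⟩),
   (-836, ⟨[1, -2, 1, -1], [2, 0, 0, 0, 0, 1]⟩), (-172, ⟨[1, -2, 2, -2], [2, 0, 0, 0, 0, 1]⟩),
   (252, ⟨[1, -2, 3, -3], [2, 0, 0, 0, 0, 1]⟩), (1056, ⟨[1, -1, -2], [2, 0, 0, 0, 0, 2]⟩),
   (16, ⟨[1, -3, -4, 6], [3]⟩), (3, ⟨[1, -3, -3, 5], [3]⟩), (-120, ⟨[1, -3, -2, 4], [3]⟩),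
   (-204, ⟨[1, -3, -1, 3], [3]⟩), (2456, ⟨[1, -3, 0, 2], [3]⟩), (-4302, ⟨[1, -3, 1, 1], [3]⟩),
   (2456, ⟨[1, -3, 2], [3]⟩), (-204, ⟨[1, -3, 3, -1], [3]⟩), (-120, ⟨[1, -3, 4, -2], [3]⟩),
   (3, ⟨[1, -3, 5, -3], [3]⟩), (16, ⟨[1, -3, 6, -4], [3]⟩),
   (-864, ⟨[1, -2, -1, 1], [3, 0, 0, 0, 0, 0, 1]⟩), (3024, ⟨[1, -2], [3, 0, 0, 0, 0, 0, 1]⟩),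
   (96, ⟨[1, -2, 1, -1], [3, 0, 0, 0, 0, 0, 1]⟩), (-528, ⟨[1, -2, 2, -2], [3, 0, 0, 0, 0, 0, 1]⟩),
   (528, ⟨[1, -2, -2, 2], [3, 0, 0, 0, 0, 1]⟩), (-96, ⟨[1, -2, -1, 1], [3, 0, 0, 0, 0, 1]⟩),
   (-3024, ⟨[1, -2], [3, 0, 0, 0, 0, 1]⟩), (864, ⟨[1, -2, 1, -1], [3, 0, 0, 0, 0, 1]⟩),
   (66, ⟨[1, -3, -2, 4], [4]⟩), (48, ⟨[1, -3, -1, 3], [4]⟩), (-1986, ⟨[1, -3, 0, 2], [4]⟩),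
   (3744, ⟨[1, -3, 1, 1], [4]⟩), (-1986, ⟨[1, -3, 2], [4]⟩), (48, ⟨[1, -3, 3, -1], [4]⟩),
   (66, ⟨[1, -3, 4, -2], [4]⟩), (-1008, ⟨[1, -2], [4, 0, 0, 0, 0, 0, 1]⟩),
   (1008, ⟨[1, -2], [4, 0, 0, 0, 0, 1]⟩), (576, ⟨[1, -3, 0, 2], [5]⟩),
   (-1152, ⟨[1, -3, 1, 1], [5]⟩), (576, ⟨[1, -3, 2], [5]⟩)]

/-- The particular solution `F20 + F21`. -/
def potential : Poly := mul (mul (rat 1 32) (rat 1 5760)) ⟨0, potentialTerms⟩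

/-- The contractions are expanded once; all later checks differentiate the resulting short list. -/
theorem potential_eq : isZero (sub (add F20 F21) potential) = true := by decide +kernel

theorem eth_two_potential (a : Fin 2) :
    isZero (sub (eth 2 a potential) (R21 2 a)) = true := by
  revert a; decide +kernel

theorem eth_three_potential (a : Fin 2) :
    isZero (sub (eth 3 a potential) (R21 3 a)) = true := by
  revert a; decide +kernel

theorem eth_four_potential (a : Fin 2) :
    isZero (sub (eth 4 a potential) (R21 4 a)) = true := by
  revert a; decide +kernel

/-- The `(0,0)` component is enough to force the quadratic form of the remainder. -/
theorem eth_one_eth_one_potential :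
    isZero (sub (sub (eth 1 0 (eth 1 0 potential))
      (mul (mon 3 [] []) (sum2 fun c => mul (cor0 0 0 [dual c]) (eth 1 c potential))))
      (R22 0 0)) = true := by
  decide +kernel

theorem deriv_coord_potential : isZero (deriv (coord (-1) 0 0) potential) = true := by
  decide +kernel

theorem deriv_dil_potential :
    isZero (sub (deriv dil potential) (mul (mon 2 [] []) potential)) = true := by
  decide +kernel

theorem deriv_ell0_potential : isZero (deriv ell0 potential) = true := by decide +kernel

/-- The asserted `h_0` enters here as a candidate and is verified. The correction equals `h₀ ((∂v)²
+ φ' (∂u)²) / 2`, because `p² + q² = 2 ((∂v)² + s² (∂u)²)`. -/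
theorem deriv_ell1_potential :
    isZero (add (deriv ell1 (add potential correction)) virasoroSource) = true := by
  decide +kernel

/-- The last variable, number 10, is `q₃`, built from fourth jets. So jets of order 5 and higher do
not occur, which settles the recursions with `k ≥ 5`. -/
theorem width_potential : width potential.t = 11 := by decide +kernel

end TopGrav.Sym

end

/-! ### Backgrounds, and the evaluation of symbols on the jet space. -/

noncomputable section

namespace TopGrav

open LPoly

/-- The properties of a background that the calculations use: `s² = φ'`, and `φ`, `ψ` are
homogeneous with respect to the Euler vector field, whose component `ℰ¹` is `(1 - d) u + r`. -/
structure Background (φ ψ : ℂ → ℂ) (d r : ℂ) (s : ℂ → ℂ) : Prop where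
  s_ne : ∀ u ∈ Complex.slitPlane, s u ≠ 0
  euler_ne : ∀ u ∈ Complex.slitPlane, (1 - d) * u + r ≠ 0
  hasDerivAt_φ : ∀ u ∈ Complex.slitPlane, HasDerivAt φ (s u ^ 2) u
  hasDerivAt_s : ∀ u ∈ Complex.slitPlane, HasDerivAt s (d * s u / ((1 - d) * u + r)) u
  hasDerivAt_ψ : ∀ u ∈ Complex.slitPlane,
    HasDerivAt ψ (-(3 * d ^ 2 - d) / 24 / ((1 - d) * u + r)) u

/-- The values of `pₙ` and `qₙ` for `n > 0`. -/
def jetVar (c : ℂ) (x : Jet) (n : ℕ) : ℕ → ℂ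
  | 0 => x (n + 2) 0 + c * x (n + 2) 1
  | 1 => x (n + 2) 0 - c * x (n + 2) 1
  | i + 2 => jetVar c x (n + 1) i

/-- The values of the variables of `TopGrav.Sym` at a point of the jet space. -/
def env (φ ψ : ℂ → ℂ) (d r : ℂ) (s : ℂ → ℂ) (x : Jet) : Env where
  ρ
    | 0 => s (x 0 1)
    | 1 => s (x 0 1) * ((1 - d) * x 0 1 + r)
    | 2 => x 1 0 + s (x 0 1) * x 1 1
    | 3 => x 1 0 - s (x 0 1) * x 1 1
    -- The value 1 at the indices not in use keeps all invertible variables nonzero, as `Env.Good`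
    -- demands.
    | _ => 1
  τ
    | 0 => d
    | 1 => x 0 0
    | 2 => x 0 1
    | 3 => φ (x 0 1)
    | 4 => 24 * ψ (x 0 1)
    | i + 5 => jetVar (s (x 0 1)) x 0 i

section

@[simp] theorem env_ρ_zero (φ ψ d r s x) : (env φ ψ d r s x).ρ 0 = s (x 0 1) := rfl

@[simp] theorem env_ρ_one (φ ψ d r s x) :
    (env φ ψ d r s x).ρ 1 = s (x 0 1) * ((1 - d) * x 0 1 + r) := rfl

@[simp] theorem env_ρ_two (φ ψ d r s x) :
    (env φ ψ d r s x).ρ 2 = x 1 0 + s (x 0 1) * x 1 1 := rfl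

@[simp] theorem env_ρ_three (φ ψ d r s x) :
    (env φ ψ d r s x).ρ 3 = x 1 0 - s (x 0 1) * x 1 1 := rfl

@[simp] theorem env_τ_zero (φ ψ d r s x) : (env φ ψ d r s x).τ 0 = d := rfl

@[simp] theorem env_τ_one (φ ψ d r s x) : (env φ ψ d r s x).τ 1 = x 0 0 := rfl

@[simp] theorem env_τ_two (φ ψ d r s x) : (env φ ψ d r s x).τ 2 = x 0 1 := rfl

@[simp] theorem env_τ_three (φ ψ d r s x) : (env φ ψ d r s x).τ 3 = φ (x 0 1) := rfl

@[simp] theorem env_τ_four (φ ψ d r s x) : (env φ ψ d r s x).τ 4 = 24 * ψ (x 0 1) := rfl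

variable {φ ψ : ℂ → ℂ} {d r : ℂ} {s : ℂ → ℂ}

theorem jetVar_two_mul (c : ℂ) (x : Jet) (m n : ℕ) :
    jetVar c x m (2 * n) = x (m + n + 2) 0 + c * x (m + n + 2) 1 := by
  induction n generalizing m with
  | zero => simp [jetVar]
  | succ n ih => rw [show 2 * (n + 1) = 2 * n + 2 by ring, jetVar, ih]; congr! 3 <;> ring

theorem jetVar_two_mul_add_one (c : ℂ) (x : Jet) (m n : ℕ) :
    jetVar c x m (2 * n + 1) = x (m + n + 2) 0 - c * x (m + n + 2) 1 := by
  induction n generalizing m with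
  | zero => simp [jetVar]
  | succ n ih => rw [show 2 * (n + 1) + 1 = 2 * n + 1 + 2 by ring, jetVar, ih]; congr! 3 <;> ring

theorem evalN_unitList (τ : ℕ → ℂ) (n : ℕ) : evalN τ (Sym.unitList n) = τ n := by
  induction n generalizing τ with
  | zero => simp [Sym.unitList, evalN]
  | succ n ih => simp [Sym.unitList, evalN, ih]

theorem hasDerivAt_line (x v : Jet) (n : ℕ) (a : Fin 2) :
    HasDerivAt (fun z : ℂ => (x + z • v) n a) (v n a) 0 := by
  simpa using ((hasDerivAt_id (0 : ℂ)).mul_const (v n a)).const_add (x n a)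

theorem hasDerivAt_comp_line {f : ℂ → ℂ} {f' : ℂ} {x : Jet} (v : Jet)
    (h : HasDerivAt f f' (x 0 1)) :
    HasDerivAt (fun z : ℂ => f ((x + z • v) 0 1)) (f' * v 0 1) 0 := by
  refine HasDerivAt.comp (h₂ := f) 0 ?_ (hasDerivAt_line x v 0 1)
  simpa using h

theorem continuous_line (x v : Jet) (n : ℕ) (a : Fin 2) :
    Continuous fun z : ℂ => (x + z • v) n a := by
  simp only [Pi.add_apply, Pi.smul_apply, smul_eq_mul]
  fun_prop

theorem along_coord (X : Jet → Jet) (n : ℕ) (a : Fin 2) (x : Jet) :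
    along X (fun y => y n a) x = X x n a :=
  HasDerivAt.deriv (hasDerivAt_line x (X x) n a)

theorem tot_coord (n : ℕ) (a : Fin 2) (x : Jet) : tot (fun y => y n a) x = x (n + 1) a :=
  along_coord shift n a x

theorem along_comp {f : ℂ → ℂ} {f' : ℂ} {x : Jet} (X : Jet → Jet)
    (h : HasDerivAt f f' (x 0 1)) : along X (fun y => f (y 0 1)) x = f' * X x 0 1 :=
  HasDerivAt.deriv (hasDerivAt_comp_line (X x) h)

namespace Background

variable (B : Background φ ψ d r s)
include B

theorem dU_eq {x : Jet} (hx : x 0 1 ∈ Complex.slitPlane) :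
    dU φ x = !![x 1 0, x 1 1; s (x 0 1) ^ 2 * x 1 1, x 1 0] := by
  ext a b
  fin_cases a <;> fin_cases b
  · exact tot_coord 0 0 x
  · exact tot_coord 0 1 x
  · exact along_comp shift (B.hasDerivAt_φ _ hx)
  · exact tot_coord 0 0 x

theorem Δ_eq {x : Jet} (hx : x 0 1 ∈ Complex.slitPlane) :
    Δ φ x = (x 1 0 + s (x 0 1) * x 1 1) * (x 1 0 - s (x 0 1) * x 1 1) := by
  rw [Δ, B.dU_eq hx, Matrix.det_fin_two_of]; ring

theorem mem_domain {x : Jet} : x ∈ domain φ ↔ x 0 1 ∈ Complex.slitPlane ∧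
    x 1 0 + s (x 0 1) * x 1 1 ≠ 0 ∧ x 1 0 - s (x 0 1) * x 1 1 ≠ 0 := by
  refine and_congr_right fun hx => ?_
  rw [B.Δ_eq hx, mul_ne_zero_iff]

theorem good {x : Jet} (hx : x ∈ domain φ) : (env φ ψ d r s x).Good := by
  obtain ⟨hu, hp, hq⟩ := B.mem_domain.1 hx
  intro i
  match i with
  | 0 => exact B.s_ne _ hu
  | 1 => exact mul_ne_zero (B.s_ne _ hu) (B.euler_ne _ hu)
  | 2 => exact hp
  | 3 => exact hq
  | i + 4 => exact one_ne_zero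

/-- Line derivatives see only a neighbourhood of `x` on a line. Openness along lines therefore
suffices to replace a function by its symbol, and no topology on the infinite jet space is involved.
-/
theorem eventually_mem_domain {x : Jet} (hx : x ∈ domain φ) (v : Jet) :
    ∀ᶠ z : ℂ in nhds 0, x + z • v ∈ domain φ := by
  obtain ⟨hu, hp, hq⟩ := B.mem_domain.1 hx
  have hs := (hasDerivAt_comp_line v (B.hasDerivAt_s _ hu)).continuousAt
  have h0 := (continuous_line x v 1 0).continuousAt (x := 0)
  have h1 := hs.mul ((continuous_line x v 1 1).continuousAt (x := 0))
  have hu' : ∀ᶠ z : ℂ in nhds 0, (x + z • v) 0 1 ∈ Complex.slitPlane :=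
    (continuous_line x v 0 1).continuousAt.eventually
      (by simpa using Complex.isOpen_slitPlane.mem_nhds hu)
  filter_upwards [hu', (h0.add h1).eventually_ne (by simpa using hp),
    (h0.sub h1).eventually_ne (by simpa using hq)] with z h1 h2 h3
  exact B.mem_domain.2 ⟨h1, h2, h3⟩

/-! #### Values of the symbols -/

omit B in
theorem eval_sum2 (v : Env) (f : Fin 2 → Poly) :
    (Sym.sum2 f).eval v = ∑ a, (f a).eval v := by
  rw [Sym.sum2, eval_add, Fin.sum_univ_two]

omit B in
theorem dual_eq (a : Fin 2) : Sym.dual a = dual a := by fin_cases a <;> rfl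

omit B in
theorem eval_half (v : Env) : Sym.half.eval v = 1 / 2 := by
  rw [Sym.half, eval_rat _ _ _ (by norm_num)]; norm_num

theorem eval_jet {x : Jet} (hx : x ∈ domain φ) (n : ℕ) (a : Fin 2) :
    (Sym.jet n a).eval (env φ ψ d r s x) = x n a := by
  have hg := B.good hx
  have hs : s (x 0 1) ≠ 0 := hg 0
  match n with
  | 0 => fin_cases a <;> simp [Sym.jet, Sym.pick, eval_mon, evalZ, evalN]
  | 1 =>
    fin_cases a
    · simp [Sym.jet, Sym.pick, eval_mul hg, eval_add, eval_mon, evalZ, evalN, eval_half]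
      ring
    · simp [Sym.jet, Sym.pick, eval_mul hg, eval_sub, eval_mon, evalZ, evalN, eval_half]
      field_simp
      ring
  | n + 2 =>
    have h1 := jetVar_two_mul (s (x 0 1)) x 0 n
    have h2 := jetVar_two_mul_add_one (s (x 0 1)) x 0 n
    rw [zero_add] at h1 h2
    have e1 : (env φ ψ d r s x).τ (5 + 2 * n) = x (n + 2) 0 + s (x 0 1) * x (n + 2) 1 := by
      rw [← h1, add_comm]; rfl
    have e2 : (env φ ψ d r s x).τ (6 + 2 * n) = x (n + 2) 0 - s (x 0 1) * x (n + 2) 1 := by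
      rw [← h2, show 6 + 2 * n = (2 * n + 1) + 5 by ring]; rfl
    fin_cases a
    · simp [Sym.jet, Sym.pick, eval_mul hg, eval_add, eval_mon, evalZ, evalN_unitList, eval_half,
        e1, e2]
      ring
    · simp [Sym.jet, Sym.pick, eval_mul hg, eval_sub, eval_mon, evalZ, evalN_unitList, eval_half,
        e1, e2]
      field_simp
      ring

theorem eval_derS {x : Jet} (hx : x ∈ domain φ) (c : Poly) :
    (Sym.derS c).eval (env φ ψ d r s x)
      = d * s (x 0 1) / ((1 - d) * x 0 1 + r) * c.eval (env φ ψ d r s x) := by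
  have hg := B.good hx
  have hs : s (x 0 1) ≠ 0 := hg 0
  have he := B.euler_ne _ hx.1
  rw [Sym.derS, eval_mul hg, eval_mon]
  congr 1
  simp [evalZ, evalN]
  field_simp

theorem hasDerivAt_ρ {x : Jet} (hx : x ∈ domain φ) {v : Jet} {c : ℕ → Fin 2 → Poly}
    (hc : ∀ n a, v n a = (c n a).eval (env φ ψ d r s x)) (i : ℕ) :
    HasDerivAt (fun z : ℂ => (env φ ψ d r s (x + z • v)).ρ i)
      ((Sym.derU c i).eval (env φ ψ d r s x)) 0 := by
  have hg := B.good hx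
  have he := B.euler_ne _ hx.1
  have hs := hasDerivAt_comp_line v (B.hasDerivAt_s _ hx.1)
  match i with
  | 0 =>
    refine HasDerivAt.congr_deriv hs ?_
    rw [Sym.derU, B.eval_derS hx, hc]
  | 1 =>
    refine HasDerivAt.congr_deriv
      (hs.mul (((hasDerivAt_line x v 0 1).const_mul (1 - d)).add_const r)) ?_
    rw [Sym.derU, eval_mul hg, eval_mon, ← hc]
    simp [evalZ, evalN]
    field_simp
    ring
  | 2 =>
    refine HasDerivAt.congr_deriv
      ((hasDerivAt_line x v 1 0).add (hs.mul (hasDerivAt_line x v 1 1))) ?_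
    rw [Sym.derU, eval_add, eval_add, eval_mul hg, eval_mul hg, eval_mon, B.eval_derS hx,
      B.eval_jet hx, ← hc, ← hc, ← hc]
    simp [evalZ, evalN]
    ring
  | 3 =>
    refine HasDerivAt.congr_deriv
      ((hasDerivAt_line x v 1 0).sub (hs.mul (hasDerivAt_line x v 1 1))) ?_
    rw [Sym.derU, eval_sub, eval_add, eval_mul hg, eval_mul hg, eval_mon, B.eval_derS hx,
      B.eval_jet hx, ← hc, ← hc, ← hc]
    simp [evalZ, evalN]
    ring
  | i + 4 =>
    refine HasDerivAt.congr_deriv (hasDerivAt_const (0 : ℂ) (1 : ℂ)) ?_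
    simp [Sym.derU]

theorem hasDerivAt_jetVar {x : Jet} (hx : x ∈ domain φ) {v : Jet} {c : ℕ → Fin 2 → Poly}
    (hc : ∀ n a, v n a = (c n a).eval (env φ ψ d r s x)) (n i : ℕ) :
    HasDerivAt (fun z : ℂ => jetVar (s ((x + z • v) 0 1)) (x + z • v) n i)
      ((Sym.derJ c n i).eval (env φ ψ d r s x)) 0 := by
  have hg := B.good hx
  have hs := hasDerivAt_comp_line v (B.hasDerivAt_s _ hx.1)
  induction i using Nat.twoStepInduction generalizing n with
  | zero =>
    refine HasDerivAt.congr_deriv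
      ((hasDerivAt_line x v (n + 2) 0).add (hs.mul (hasDerivAt_line x v (n + 2) 1))) ?_
    rw [Sym.derJ, eval_add, eval_add, eval_mul hg, eval_mul hg, eval_mon, B.eval_derS hx,
      B.eval_jet hx, ← hc, ← hc, ← hc]
    simp [evalZ, evalN]
    ring
  | one =>
    refine HasDerivAt.congr_deriv
      ((hasDerivAt_line x v (n + 2) 0).sub (hs.mul (hasDerivAt_line x v (n + 2) 1))) ?_
    rw [Sym.derJ, eval_sub, eval_add, eval_mul hg, eval_mul hg, eval_mon, B.eval_derS hx,
      B.eval_jet hx, ← hc, ← hc, ← hc]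
    simp [evalZ, evalN]
    ring
  | more i ih _ => exact ih (n + 1)

theorem hasDerivAt_τ {x : Jet} (hx : x ∈ domain φ) {v : Jet} {c : ℕ → Fin 2 → Poly}
    (hc : ∀ n a, v n a = (c n a).eval (env φ ψ d r s x)) (i : ℕ) :
    HasDerivAt (fun z : ℂ => (env φ ψ d r s (x + z • v)).τ i)
      ((Sym.derE c i).eval (env φ ψ d r s x)) 0 := by
  have hg := B.good hx
  have he := B.euler_ne _ hx.1
  have hs0 := B.s_ne _ hx.1
  match i with
  | 0 =>
    refine HasDerivAt.congr_deriv (hasDerivAt_const (0 : ℂ) d) ?_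
    simp [Sym.derE]
  | 1 => exact (hasDerivAt_line x v 0 0).congr_deriv (hc 0 0)
  | 2 => exact (hasDerivAt_line x v 0 1).congr_deriv (hc 0 1)
  | 3 =>
    refine HasDerivAt.congr_deriv (hasDerivAt_comp_line v (B.hasDerivAt_φ _ hx.1)) ?_
    rw [Sym.derE, eval_mul hg, eval_mon, ← hc]
    simp [evalZ, evalN]
  | 4 =>
    refine HasDerivAt.congr_deriv
      ((hasDerivAt_comp_line v (B.hasDerivAt_ψ _ hx.1)).const_mul 24) ?_
    rw [Sym.derE, Sym.psiCoeff, eval_mul hg, eval_mul hg, eval_add, eval_mon, eval_mon, eval_mon,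
      ← hc]
    simp [evalZ, evalN]
    field_simp
    ring
  | i + 5 => exact B.hasDerivAt_jetVar hx hc 0 i

/-- The bridge between calculus and computation. The symbols `c` have to match the direction at the
point `x` only. -/
theorem hasLineDerivAt_eval (P : Poly) {x : Jet} (hx : x ∈ domain φ) {v : Jet}
    {c : ℕ → Fin 2 → Poly} (hc : ∀ n a, v n a = (c n a).eval (env φ ψ d r s x)) :
    HasLineDerivAt ℂ (fun y => P.eval (env φ ψ d r s y))
      ((Sym.deriv c P).eval (env φ ψ d r s x)) x v := by
  have h0 : env φ ψ d r s (x + (0 : ℂ) • v) = env φ ψ d r s x := by simp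
  have := hasDerivAt_eval (v := fun z : ℂ => env φ ψ d r s (x + z • v)) (t := 0)
    (δρ := Sym.derU c) (δτ := Sym.derE c) P (by simpa using B.good hx)
    (fun i _ => by simpa only [h0] using B.hasDerivAt_ρ hx hc i)
    (fun i _ => by simpa only [h0] using B.hasDerivAt_τ hx hc i)
  rw [h0] at this
  exact this

end Background

/-- The function `F` is given on the domain by the symbol `P`. -/
def Represents (φ ψ : ℂ → ℂ) (d r : ℂ) (s : ℂ → ℂ) (F : Jet → ℂ) (P : Poly) : Prop :=
  ∀ x ∈ domain φ, F x = P.eval (env φ ψ d r s x)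

namespace Background

variable (B : Background φ ψ d r s)
include B

theorem hasLineDerivAt {F : Jet → ℂ} {P : Poly} (hF : Represents φ ψ d r s F P) {x : Jet}
    (hx : x ∈ domain φ) {v : Jet} {c : ℕ → Fin 2 → Poly}
    (hc : ∀ n a, v n a = (c n a).eval (env φ ψ d r s x)) :
    HasLineDerivAt ℂ F ((Sym.deriv c P).eval (env φ ψ d r s x)) x v := by
  refine HasDerivAt.congr_of_eventuallyEq (B.hasLineDerivAt_eval P hx hc) ?_
  filter_upwards [B.eventually_mem_domain hx v] with z hz
  exact hF _ hz

/-- The inductive step by which iterated derivatives, and so all correlators, acquire symbols. -/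
theorem represents_along {F : Jet → ℂ} {P : Poly} (hF : Represents φ ψ d r s F P) {X : Jet → Jet}
    {c : ℕ → Fin 2 → Poly} (hc : ∀ n a, Represents φ ψ d r s (fun x => X x n a) (c n a)) :
    Represents φ ψ d r s (along X F) (Sym.deriv c P) :=
  fun _ hx => (B.hasLineDerivAt hF hx fun n a => hc n a _ hx).lineDeriv

theorem represents_tot {F : Jet → ℂ} {P : Poly} (hF : Represents φ ψ d r s F P) :
    Represents φ ψ d r s (tot F) (Sym.tot P) :=
  B.represents_along hF fun n a _ hx => (B.eval_jet hx (n + 1) a).symm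

theorem represents_dU (a b : Fin 2) :
    Represents φ ψ d r s (fun x => dU φ x a b) (Sym.dU a b) := by
  intro x hx
  have hg := B.good hx
  simp only [B.dU_eq hx.1]
  fin_cases a <;> fin_cases b <;>
    simp [Sym.dU, Sym.pick, B.eval_jet hx, eval_mul hg, eval_mon, evalZ, evalN]

theorem represents_faa (n k : ℕ) (a b : Fin 2) :
    Represents φ ψ d r s (fun x => faa φ n k x a b) (Sym.faa n k a b) := by
  induction n generalizing k a b with
  | zero =>
    match k with
    | 0 => exact B.represents_dU a b
    | k + 1 => intro x hx; simp [faa, Sym.faa]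
  | succ n ih =>
    match k with
    | 0 => exact B.represents_tot (ih 0 a b)
    | k + 1 =>
      intro x hx
      have h1 := B.represents_tot (ih (k + 1) a b) x hx
      have h2 := fun c => ih k c b x hx
      have h3 := fun c => B.represents_dU a c x hx
      simp only [faa, Sym.faa, eval_add, eval_sum2, eval_mul (B.good hx), ← h1, ← h2, ← h3,
        Matrix.add_apply, Matrix.mul_apply, totMat, Matrix.of_apply]

theorem represents_eth {F : Jet → ℂ} {P : Poly} (hF : Represents φ ψ d r s F P) (k : ℕ)
    (a : Fin 2) : Represents φ ψ d r s (eth φ k a F) (Sym.eth k a P) :=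
  B.represents_along hF fun n b => B.represents_faa n k a b

theorem represents_U (a b : Fin 2) : Represents φ ψ d r s (fun x => U φ x a b) (Sym.U a b) := by
  intro x hx
  fin_cases a <;> fin_cases b <;>
    simp [U, Sym.U, Sym.pick, B.eval_jet hx, eval_mon, evalZ, evalN]

theorem represents_cor0 (a b : Fin 2) (l : List (Fin 2)) :
    Represents φ ψ d r s (cor0 φ a b l) (Sym.cor0 a b l) := by
  induction l with
  | nil => simpa only [cor0, Sym.cor0, dual_eq] using B.represents_U a (dual b)
  | cons c l ih => exact B.represents_eth ih 0 c

theorem represents_psiD (a : Fin 2) (l : List (Fin 2)) :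
    Represents φ ψ d r s (psiD φ (fun u => 24 * ψ u) a l) (Sym.psiD a l) := by
  induction l with
  | nil =>
    refine B.represents_eth (F := fun x => 24 * ψ (x 0 1)) (fun x hx => ?_) 0 a
    simp [eval_mon, evalZ, evalN]
  | cons c l ih => exact B.represents_eth ih 0 c

theorem represents_Δ : Represents φ ψ d r s (Δ φ) Sym.det := by
  intro x hx
  rw [B.Δ_eq hx.1]
  simp [Sym.det, eval_mon, evalZ, evalN]

theorem eval_detInv {x : Jet} (hx : x ∈ domain φ) :
    Sym.detInv.eval (env φ ψ d r s x) = (Δ φ x)⁻¹ := by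
  rw [B.Δ_eq hx.1]
  simp [Sym.detInv, eval_mon, evalZ, evalN, mul_comm]

theorem represents_cor1 (a : Fin 2) (l : List (Fin 2)) :
    Represents φ ψ d r s (cor1 φ ψ a l) (Sym.cor1 a l) := by
  induction l with
  | nil =>
    intro x hx
    have h1 := B.represents_eth B.represents_Δ 0 a x hx
    have h2 := B.represents_psiD a [] x hx
    -- The symbols carry `24 ψ`, so that `F₁` has the common factor `1/24`.
    have h3 : psiD φ (fun u => 24 * ψ u) a [] x = 24 * psiD φ ψ a [] x := by
      have := B.hasDerivAt_ψ _ hx.1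
      simp only [psiD, eth]
      rw [along_comp _ this, along_comp (f := fun u => 24 * ψ u) _ (this.const_mul 24)]
      ring
    rw [Sym.cor1, eval_mul (B.good hx), eval_add, eval_mul (B.good hx), B.eval_detInv hx, ← h1,
      ← h2, h3, eval_rat _ _ _ (by norm_num), cor1]
    push_cast
    ring
  | cons c l ih => exact B.represents_eth ih 0 c

theorem represents_C (a b : Fin 2) : Represents φ ψ d r s (C φ a b) (Sym.C a b) := by
  intro x hx
  have hg := B.good hx
  have h : (dU φ x)⁻¹ = (Δ φ x)⁻¹ • (dU φ x).adjugate := by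
    rw [Matrix.inv_def, Ring.inverse_eq_inv', Δ]
  simp only [C, h, Sym.C, eval_mul hg, B.eval_detInv hx, Matrix.smul_apply, smul_eq_mul]
  congr 1
  rw [B.dU_eq hx.1, Matrix.adjugate_fin_two_of]
  fin_cases a <;> fin_cases b <;>
    simp [dual, Sym.pick, eval_mul hg, B.eval_jet hx, eval_mon, evalZ, evalN]

end Background

end

end TopGrav

end

/-! ### Symbols of the recursions, the particular solution and the Virasoro fields. -/

noncomputable section

namespace TopGrav

open LPoly

variable {φ ψ : ℂ → ℂ} {d r : ℂ} {s : ℂ → ℂ}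

namespace Background

variable (B : Background φ ψ d r s)
include B

theorem represents_R21 (k : ℕ) (a : Fin 2) :
    Represents φ ψ d r s (R21 φ ψ k a) (Sym.R21 k a) := by
  intro x hx
  have hg := B.good hx
  have h0 := fun a b l => (B.represents_cor0 a b l x hx).symm
  have h1 := fun a l => (B.represents_cor1 a l x hx).symm
  have h2 := fun n : ℤ => eval_rat (env φ ψ d r s x) n
  match k with
  | 2 =>
    simp only [R21, Sym.R21, eval_sum2, eval_add, eval_sub, eval_mul hg, h0, h1, dual_eq]
    refine Finset.sum_congr rfl fun b _ => Finset.sum_congr rfl fun c _ => ?_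
    rw [h2 7 10 (by norm_num), h2 1 10 (by norm_num), h2 13 240 (by norm_num),
      h2 1 240 (by norm_num), h2 1 960 (by norm_num)]
    push_cast
    ring
  | 3 =>
    simp only [R21, Sym.R21, eval_sum2, eval_add, eval_mul hg, h0, h1, dual_eq]
    rw [h2 1 20 (by norm_num), h2 1 480 (by norm_num), h2 1 1152 (by norm_num)]
    congr 1
    · refine Finset.sum_congr rfl fun b _ => Finset.sum_congr rfl fun c _ =>
        Finset.sum_congr rfl fun e _ => ?_
      push_cast
      ring
    · refine Finset.sum_congr rfl fun b _ => Finset.sum_congr rfl fun c _ =>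
        Finset.sum_congr rfl fun e _ => ?_
      push_cast
      ring
  | 4 =>
    simp only [R21, Sym.R21, eval_sum2, eval_mul hg, h0, dual_eq]
    rw [h2 1 1152 (by norm_num)]
    refine Finset.sum_congr rfl fun b _ => Finset.sum_congr rfl fun c _ =>
        Finset.sum_congr rfl fun e _ => Finset.sum_congr rfl fun f _ => ?_
    push_cast
    ring
  | 0 => simp [R21, Sym.R21]
  | 1 => simp [R21, Sym.R21]
  | k + 5 => simp [R21, Sym.R21]

theorem represents_R22 (a b : Fin 2) : Represents φ ψ d r s (R22 φ ψ a b) (Sym.R22 a b) := by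
  intro x hx
  have hg := B.good hx
  have h0 := fun a b l => (B.represents_cor0 a b l x hx).symm
  have h1 := fun a l => (B.represents_cor1 a l x hx).symm
  have h2 := fun n : ℤ => eval_rat (env φ ψ d r s x) n
  simp only [R22, Sym.R22, eval_sum2, eval_add, eval_mul hg, h0, h1, dual_eq]
  refine Finset.sum_congr rfl fun c _ => Finset.sum_congr rfl fun e _ => ?_
  rw [h2 13 10 (by norm_num), h2 4 5 (by norm_num), h2 1 24 (by norm_num),
    h2 (-4) 5 (by norm_num), h2 1 48 (by norm_num), h2 23 240 (by norm_num),
    h2 (-1) 80 (by norm_num), h2 7 30 (by norm_num), h2 1 576 (by norm_num)]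
  push_cast
  ring

theorem represents_F20 : Represents φ ψ d r s (F20 φ) Sym.F20 := by
  intro x hx
  have hg := B.good hx
  have h0 := fun a b l => (B.represents_tot (B.represents_cor0 a b l) x hx).symm
  have h1 := fun a b l => (B.represents_tot (B.represents_tot (B.represents_cor0 a b l)) x hx).symm
  have h2 := fun a b => (B.represents_C a b x hx).symm
  have h3 := fun n : ℤ => eval_rat (env φ ψ d r s x) n
  simp only [F20, Sym.F20, eval_sum2, eval_add, eval_mul hg, h0, h1, h2]
  rw [h3 1 1152 (by norm_num), h3 (-1) 1152 (by norm_num), h3 1 360 (by norm_num),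
    h3 (-1) 360 (by norm_num), sub_eq_add_neg, sub_eq_add_neg, add_assoc, add_assoc]
  simp only [← neg_mul]
  simp only [Finset.mul_sum]
  refine congrArg₂ _ ?_ (congrArg₂ _ ?_ (congrArg₂ _ ?_ ?_))
  · refine Finset.sum_congr rfl fun a _ => Finset.sum_congr rfl fun b _ =>
      Finset.sum_congr rfl fun c _ => Finset.sum_congr rfl fun e _ => ?_
    push_cast
    ring
  · refine Finset.sum_congr rfl fun a _ => Finset.sum_congr rfl fun b _ =>
      Finset.sum_congr rfl fun c _ => Finset.sum_congr rfl fun e _ =>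
      Finset.sum_congr rfl fun f _ => Finset.sum_congr rfl fun g _ => ?_
    push_cast
    ring
  · refine Finset.sum_congr rfl fun a _ => Finset.sum_congr rfl fun b _ =>
      Finset.sum_congr rfl fun c _ => Finset.sum_congr rfl fun e _ =>
      Finset.sum_congr rfl fun f _ => Finset.sum_congr rfl fun g _ => ?_
    push_cast
    ring
  · refine Finset.sum_congr rfl fun a _ => Finset.sum_congr rfl fun b _ =>
      Finset.sum_congr rfl fun c _ => Finset.sum_congr rfl fun e _ =>
      Finset.sum_congr rfl fun f _ => Finset.sum_congr rfl fun g _ =>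
      Finset.sum_congr rfl fun i _ => Finset.sum_congr rfl fun j _ => ?_
    push_cast
    ring

theorem iteratedDeriv_two_φ {u : ℂ} (hu : u ∈ Complex.slitPlane) :
    iteratedDeriv 2 φ u = 2 * s u ^ 2 * d / ((1 - d) * u + r) := by
  have h : deriv φ =ᶠ[nhds u] fun w => s w ^ 2 := by
    filter_upwards [Complex.isOpen_slitPlane.mem_nhds hu] with w hw
    exact (B.hasDerivAt_φ w hw).deriv
  rw [iteratedDeriv_succ, iteratedDeriv_one, h.deriv_eq,
    ((B.hasDerivAt_s u hu).fun_pow 2).deriv]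
  have := B.euler_ne u hu
  push_cast
  field_simp

theorem iteratedDeriv_two_ψ {u : ℂ} (hu : u ∈ Complex.slitPlane) :
    iteratedDeriv 2 (fun w => 24 * ψ w) u
      = (3 * d ^ 2 - d) * (1 - d) / ((1 - d) * u + r) ^ 2 := by
  have h : deriv (fun w => 24 * ψ w) =ᶠ[nhds u]
      fun w => -(3 * d ^ 2 - d) * ((1 - d) * w + r)⁻¹ := by
    filter_upwards [Complex.isOpen_slitPlane.mem_nhds hu] with w hw
    rw [((B.hasDerivAt_ψ w hw).const_mul 24).deriv]
    have := B.euler_ne w hw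
    field_simp
  have he := B.euler_ne u hu
  rw [iteratedDeriv_succ, iteratedDeriv_one, h.deriv_eq,
    (((((hasDerivAt_id' u).const_mul (1 - d)).add_const r).fun_inv he).const_mul _).deriv]
  field_simp

theorem represents_F21 : Represents φ ψ d r s (F21 φ ψ) Sym.F21 := by
  intro x hx
  have hg := B.good hx
  have h0 := fun a b l => (B.represents_tot (B.represents_cor0 a b l) x hx).symm
  have h1 := fun a b l => (B.represents_tot (B.represents_tot (B.represents_cor0 a b l)) x hx).symm
  have h2 := fun a b => (B.represents_C a b x hx).symm
  have h3 := fun n : ℤ => eval_rat (env φ ψ d r s x) n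
  have h4 := fun a l => (B.represents_psiD a l x hx).symm
  have h5 := fun a l => (B.represents_tot (B.represents_psiD a l) x hx).symm
  simp only [F21, F21aux, Sym.F21, eval_sum2, eval_add, eval_sub, eval_mul hg, h0, h1, h2, h4, h5,
    eval_half, B.eval_jet hx, B.eval_detInv hx]
  rw [h3 1 576 (by norm_num), h3 4 5 (by norm_num), h3 6 5 (by norm_num), h3 1 10 (by norm_num),
    h3 7 10 (by norm_num), h3 3 10 (by norm_num), h3 23 10 (by norm_num), add_assoc, add_assoc,
    add_assoc]
  simp only [Finset.mul_sum]
  refine congrArg₂ _ (by norm_num) (congrArg₂ _ ?_ (congrArg₂ _ ?_ (congrArg₂ _ ?_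
    (congrArg₂ _ ?_ ?_))))
  · refine Finset.sum_congr rfl fun a _ => Finset.sum_congr rfl fun b _ => ?_
    push_cast
    ring
  · refine Finset.sum_congr rfl fun a _ => Finset.sum_congr rfl fun b _ =>
      Finset.sum_congr rfl fun c _ => Finset.sum_congr rfl fun e _ => ?_
    push_cast
    ring
  · refine Finset.sum_congr rfl fun a _ => Finset.sum_congr rfl fun b _ =>
      Finset.sum_congr rfl fun c _ => Finset.sum_congr rfl fun e _ => ?_
    push_cast
    ring
  · refine Finset.sum_congr rfl fun a _ => Finset.sum_congr rfl fun b _ =>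
      Finset.sum_congr rfl fun c _ => Finset.sum_congr rfl fun e _ =>
      Finset.sum_congr rfl fun f _ => Finset.sum_congr rfl fun g _ => ?_
    push_cast
    ring
  -- The one term with honest second derivatives of `φ` and `Ψ`, which the background turns into
  -- rational expressions in `s` and `ℰ¹`.
  · have he := B.euler_ne _ hx.1
    have hs := B.s_ne _ hx.1
    rw [B.iteratedDeriv_two_φ hx.1, B.iteratedDeriv_two_ψ hx.1]
    simp only [Sym.psiCoeff, eval_mon, eval_add, evalZ, evalN]
    simp
    field_simp
    ring

theorem represents_potential :
    Represents φ ψ d r s (fun x => F20 φ x + F21 φ ψ x) Sym.potential := by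
  intro x hx
  rw [← eval_eq_of_isZero_sub Sym.potential_eq, eval_add, ← B.represents_F20 x hx,
    ← B.represents_F21 x hx]

theorem represents_euler (a : Fin 2) : Represents φ ψ d r s (euler d r a) (Sym.euler a) := by
  intro x hx
  have hs := B.s_ne _ hx.1
  fin_cases a
  · simp [euler, Sym.euler, Sym.pick, B.eval_jet hx, R1]
  · simp [euler, Sym.euler, Sym.pick, R1, μ, eval_mon, evalZ, evalN]
    field_simp
    ring

omit B in
theorem eval_oneSubD (x : Jet) : Sym.oneSubD.eval (env φ ψ d r s x) = 1 - d := by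
  simp [Sym.oneSubD, eval_sub, eval_mon, evalZ, evalN]

theorem represents_ell0 (n : ℕ) (a : Fin 2) :
    Represents φ ψ d r s (ell0 d r n a) (Sym.ell0 n a) := by
  induction n with
  | zero =>
    intro x hx
    simp only [ell0, Sym.ell0, eval_sub, eval_zero, ← B.represents_euler a x hx, zero_sub]
  | succ n ih =>
    intro x hx
    simp only [ell0, Sym.ell0, eval_sub, eval_mul (B.good hx), B.eval_jet hx, eval_half,
      eval_oneSubD, B.represents_tot ih x hx]
    ring

omit B in
theorem eval_coord (c : ℤ) (n : ℕ) (a : Fin 2) (m : ℕ) (b : Fin 2) (x : Jet) :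
    ((c : ℂ) • (Pi.single n (Pi.single a 1) : Jet)) m b
      = (Sym.coord c n a m b).eval (env φ ψ d r s x) := by
  unfold Sym.coord
  by_cases hm : m = n
  · subst hm
    by_cases hb : b = a
    · subst hb
      simp [eval_mon, evalZ, evalN]
    · have h : Nat.beq b.val a.val = false := by
        rw [← Bool.not_eq_true, Nat.beq_eq]
        exact fun h => hb (Fin.ext h)
      simp [h, hb]
  · have h : Nat.beq m n = false := by
      rw [← Bool.not_eq_true, Nat.beq_eq]
      exact hm
    simp [h, hm]

theorem represents_A (b c a : Fin 2) : Represents φ ψ d r s (A φ b c a) (Sym.A b c a) := by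
  refine B.represents_along (B.represents_U b a) fun n e x hx => ?_
  simpa [coordField] using eval_coord (φ := φ) (ψ := ψ) (d := d) (r := r) (s := s) 1 0 c n e x

theorem represents_ell1 (n : ℕ) (a : Fin 2) :
    Represents φ ψ d r s (ell1 φ d r n a) (Sym.ell1 n a) := by
  induction n with
  | zero =>
    intro x hx
    have h0 := fun a => (B.represents_euler a x hx).symm
    have h1 := fun a b c => (B.represents_A a b c x hx).symm
    simp only [ell1, Sym.ell1, eval_sub, eval_zero, eval_sum2, eval_mul (B.good hx), h0, h1,
      zero_sub]
  | succ n ih =>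
    intro x hx
    have h0 := (B.represents_euler 1 x hx).symm
    have h1 := fun k b => (B.represents_faa n k b a x hx).symm
    have h2 : euler d r 1 x = (1 - d) * x 0 1 + r := by
      have : 1 - (d / 2 - -d / 2) = 1 - d := by ring
      simp [euler, μ, R1, this]
    simp only [ell1, Sym.ell1, eval_sub, eval_add, eval_mul (B.good hx), h0, h1, eval_oneSubD,
      eval_half, B.eval_jet hx, B.represents_tot ih x hx, eth, along_coord, ethField]
    simp only [Matrix.add_apply, Matrix.sub_apply, Matrix.diagonal_mul, Matrix.mul_diagonal, V,
      Fin.sum_univ_two]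
    simp [h2, eval_mon, evalZ, evalN, U, R1, μ]
    ring

theorem represents_virasoroSource : Represents φ ψ d r s
    (fun x => 1 / 2 * ∑ a, ∑ b, Matrix.diagonal (fun i => 1 / 4 - μ d i ^ 2) (dual a) b
      * (cor1 φ ψ a [] x * cor1 φ ψ b [] x + cor1 φ ψ a [b] x)) Sym.virasoroSource := by
  intro x hx
  have h1 := fun a l => (B.represents_cor1 a l x hx).symm
  simp only [Sym.virasoroSource, eval_sum2, eval_add, eval_sub, eval_mul (B.good hx), h1, dual_eq,
    eval_mon, eval_rat _ 1 8 (by norm_num)]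
  simp [Fin.sum_univ_two, dual, evalZ, evalN, μ]
  ring

end Background

end TopGrav

end

/-! ### Line derivatives of correlation functions, and the triangularity of the fields `ð_{k,a}`. -/

noncomputable section

namespace TopGrav

open LPoly

/-! ### Differentiable functions of finitely many jet coordinates -/

/-- The function `F` has line derivatives at `x` in all directions, they depend linearly on the
direction, and only on finitely many of its components. -/
def JetDifferentiableAt (F : Jet → ℂ) (x : Jet) : Prop :=
  ∃ L : Jet →ₗ[ℂ] ℂ, (∀ v, HasLineDerivAt ℂ F (L v) x v) ∧
    ∃ N : ℕ, ∀ v : Jet, (∀ n < N, v n = 0) → L v = 0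

namespace JetDifferentiableAt

variable {F G : Jet → ℂ} {x : Jet}

theorem const (c : ℂ) (x : Jet) : JetDifferentiableAt (fun _ => c) x :=
  ⟨0, fun _ => hasDerivAt_const _ _, 0, fun _ _ => rfl⟩

theorem coord (n : ℕ) (a : Fin 2) (x : Jet) : JetDifferentiableAt (fun y => y n a) x :=
  ⟨(LinearMap.proj a : (Fin 2 → ℂ) →ₗ[ℂ] ℂ) ∘ₗ LinearMap.proj n, fun v => hasDerivAt_line x v n a, n + 1,
    fun v hv => by simp [hv n (Nat.lt_succ_self n)]⟩

theorem add (hF : JetDifferentiableAt F x) (hG : JetDifferentiableAt G x) :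
    JetDifferentiableAt (fun y => F y + G y) x := by
  obtain ⟨L, hL, N, hN⟩ := hF
  obtain ⟨M, hM, K, hK⟩ := hG
  exact ⟨L + M, fun v => HasDerivAt.add (hL v) (hM v), max N K, fun v hv => by
    simp [hN v fun n hn => hv n (lt_max_of_lt_left hn),
      hK v fun n hn => hv n (lt_max_of_lt_right hn)]⟩

theorem mul (hF : JetDifferentiableAt F x) (hG : JetDifferentiableAt G x) :
    JetDifferentiableAt (fun y => F y * G y) x := by
  obtain ⟨L, hL, N, hN⟩ := hF
  obtain ⟨M, hM, K, hK⟩ := hG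
  refine ⟨G x • L + F x • M, fun v => ?_, max N K, fun v hv => ?_⟩
  · refine HasDerivAt.congr_deriv (HasDerivAt.mul (hL v) (hM v)) ?_
    simp; ring
  · simp [hN v fun n hn => hv n (lt_max_of_lt_left hn),
      hK v fun n hn => hv n (lt_max_of_lt_right hn)]

theorem comp {f : ℂ → ℂ} (hf : DifferentiableAt ℂ f (F x)) (hF : JetDifferentiableAt F x) :
    JetDifferentiableAt (fun y => f (F y)) x := by
  obtain ⟨L, hL, N, hN⟩ := hF
  refine ⟨deriv f (F x) • L, fun v => ?_, N, fun v hv => by simp [hN v hv]⟩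
  refine HasDerivAt.comp (h₂ := f) 0 ?_ (hL v)
  simpa using hf.hasDerivAt

theorem comp₂ {f : ℂ × ℂ → ℂ} (hf : DifferentiableAt ℂ f (F x, G x))
    (hF : JetDifferentiableAt F x) (hG : JetDifferentiableAt G x) :
    JetDifferentiableAt (fun y => f (F y, G y)) x := by
  obtain ⟨L, hL, N, hN⟩ := hF
  obtain ⟨M, hM, K, hK⟩ := hG
  refine ⟨(fderiv ℂ f (F x, G x)).toLinearMap ∘ₗ L.prod M, fun v => ?_, max N K, fun v hv => ?_⟩
  · refine HasFDerivAt.comp_hasDerivAt_of_eq (0 : ℂ) hf.hasFDerivAt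
      (HasDerivAt.prodMk (hL v) (hM v)) ?_
    simp
  · have h1 := hN v fun n hn => hv n (lt_max_of_lt_left hn)
    have h2 := hK v fun n hn => hv n (lt_max_of_lt_right hn)
    have h3 : L.prod M v = 0 := Prod.ext h1 h2
    rw [LinearMap.comp_apply, h3, map_zero]

theorem neg (hF : JetDifferentiableAt F x) : JetDifferentiableAt (fun y => -F y) x :=
  comp (f := fun z => -z) (by fun_prop) hF

theorem sub (hF : JetDifferentiableAt F x) (hG : JetDifferentiableAt G x) :
    JetDifferentiableAt (fun y => F y - G y) x := by
  simpa only [sub_eq_add_neg] using hF.add hG.neg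

theorem pow (hF : JetDifferentiableAt F x) (n : ℕ) : JetDifferentiableAt (fun y => F y ^ n) x :=
  comp (f := fun z => z ^ n) (by fun_prop) hF

theorem zpow (hF : JetDifferentiableAt F x) (h : F x ≠ 0) (n : ℤ) :
    JetDifferentiableAt (fun y => F y ^ n) x :=
  comp (f := fun z => z ^ n) (differentiableAt_zpow.2 (Or.inl h)) hF

theorem inv (hF : JetDifferentiableAt F x) (h : F x ≠ 0) :
    JetDifferentiableAt (fun y => (F y)⁻¹) x :=
  comp (f := fun z => z⁻¹) (differentiableAt_inv h) hF

theorem sum {ι : Type*} {f : ι → Jet → ℂ} (t : Finset ι)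
    (h : ∀ i ∈ t, JetDifferentiableAt (f i) x) :
    JetDifferentiableAt (fun y => ∑ i ∈ t, f i y) x := by
  classical
  induction t using Finset.induction_on with
  | empty => simpa using const 0 x
  | insert i t hi ih =>
    simp only [Finset.sum_insert hi]
    exact (h i (by simp)).add (ih fun j hj => h j (by simp [hj]))

theorem prod {ι : Type*} {f : ι → Jet → ℂ} (t : Finset ι)
    (h : ∀ i ∈ t, JetDifferentiableAt (f i) x) :
    JetDifferentiableAt (fun y => ∏ i ∈ t, f i y) x := by
  classical
  induction t using Finset.induction_on with
  | empty => simpa using const 1 x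
  | insert i t hi ih =>
    simp only [Finset.prod_insert hi]
    exact (h i (by simp)).mul (ih fun j hj => h j (by simp [hj]))

theorem congr (hF : JetDifferentiableAt F x) (h : ∀ v : Jet, ∀ᶠ z : ℂ in nhds 0,
    G (x + z • v) = F (x + z • v)) : JetDifferentiableAt G x := by
  obtain ⟨L, hL, N, hN⟩ := hF
  exact ⟨L, fun v => HasDerivAt.congr_of_eventuallyEq (hL v) (h v), N, hN⟩

theorem hasLineDerivAt (hF : JetDifferentiableAt F x) (v : Jet) :
    HasLineDerivAt ℂ F (lineDeriv ℂ F x v) x v := by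
  obtain ⟨L, hL, _⟩ := hF
  rw [(hL v).lineDeriv]
  exact hL v

theorem lineDeriv_add (hF : JetDifferentiableAt F x) (v w : Jet) :
    lineDeriv ℂ F x (v + w) = lineDeriv ℂ F x v + lineDeriv ℂ F x w := by
  obtain ⟨L, hL, _⟩ := hF
  rw [(hL _).lineDeriv, (hL _).lineDeriv, (hL _).lineDeriv, map_add]

theorem lineDeriv_smul (hF : JetDifferentiableAt F x) (c : ℂ) (v : Jet) :
    lineDeriv ℂ F x (c • v) = c * lineDeriv ℂ F x v := by
  obtain ⟨L, hL, _⟩ := hF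
  rw [(hL _).lineDeriv, (hL _).lineDeriv, map_smul, smul_eq_mul]

theorem evalZ {ρ : Jet → ℕ → ℂ} (l : List ℤ) (h : ∀ i, JetDifferentiableAt (fun y => ρ y i) x)
    (h0 : ∀ i, ρ x i ≠ 0) : JetDifferentiableAt (fun y => evalZ (ρ y) l) x := by
  induction l generalizing ρ with
  | nil => exact const 1 x
  | cons a l ih =>
    exact ((h 0).zpow (h0 0) a).mul
      (ih (ρ := fun y i => ρ y (i + 1)) (fun i => h (i + 1)) fun i => h0 (i + 1))

theorem evalN {τ : Jet → ℕ → ℂ} (l : List ℕ) (h : ∀ i, JetDifferentiableAt (fun y => τ y i) x) :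
    JetDifferentiableAt (fun y => evalN (τ y) l) x := by
  induction l generalizing τ with
  | nil => exact const 1 x
  | cons a l ih =>
    exact ((h 0).pow a).mul (ih (τ := fun y i => τ y (i + 1)) (fun i => h (i + 1)))

theorem eval {v : Jet → Env} (P : Poly) (hg : (v x).Good)
    (hρ : ∀ i, JetDifferentiableAt (fun y => (v y).ρ i) x)
    (hτ : ∀ i, JetDifferentiableAt (fun y => (v y).τ i) x) :
    JetDifferentiableAt (fun y => P.eval (v y)) x := by
  refine (const _ x).mul ?_
  induction P.t with
  | nil => exact const 0 x
  | cons t P ih => exact ((const _ x).mul ((evalZ _ hρ hg).mul (evalN _ hτ))).add ih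

end JetDifferentiableAt

/-- The derivative of a function along a line, at any point of the line. -/
theorem hasDerivAt_of_hasLineDerivAt {F : Jet → ℂ} {F' : ℂ} {x v : Jet} {t : ℂ}
    (h : HasLineDerivAt ℂ F F' (x + t • v) v) : HasDerivAt (fun z : ℂ => F (x + z • v)) F' t := by
  have h1 : HasDerivAt (fun z : ℂ => z - t) 1 t := (hasDerivAt_id' t).sub_const t
  have h2 := HasDerivAt.comp_of_eq (h₂ := fun z : ℂ => F (x + t • v + z • v)) t h h1 (sub_self t).symm
  rw [mul_one] at h2
  refine h2.congr_of_eventuallyEq (Filter.Eventually.of_forall fun z => ?_)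
  simp only [Function.comp]
  congr 1
  module

variable {φ ψ : ℂ → ℂ} {d r : ℂ} {s : ℂ → ℂ}

namespace Background

variable (B : Background φ ψ d r s)
include B

theorem jetDifferentiableAt_eval (P : Poly) {x : Jet} (hx : x ∈ domain φ) :
    JetDifferentiableAt (fun y => P.eval (env φ ψ d r s y)) x := by
  have hc := fun n a => JetDifferentiableAt.coord n a x
  have hs : JetDifferentiableAt (fun y => s (y 0 1)) x :=
    (hc 0 1).comp (B.hasDerivAt_s _ hx.1).differentiableAt
  refine JetDifferentiableAt.eval P (B.good hx) (fun i => ?_) fun i => ?_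
  · match i with
    | 0 => exact hs
    | 1 => exact hs.mul (((JetDifferentiableAt.const _ x).mul (hc 0 1)).add (.const _ x))
    | 2 => exact (hc 1 0).add (hs.mul (hc 1 1))
    | 3 => exact (hc 1 0).sub (hs.mul (hc 1 1))
    | i + 4 => exact .const 1 x
  · match i with
    | 0 => exact .const d x
    | 1 => exact hc 0 0
    | 2 => exact hc 0 1
    | 3 => exact (hc 0 1).comp (B.hasDerivAt_φ _ hx.1).differentiableAt
    | 4 =>
      exact (JetDifferentiableAt.const 24 x).mul
        ((hc 0 1).comp (B.hasDerivAt_ψ _ hx.1).differentiableAt)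
    | i + 5 =>
      have h : ∀ n, JetDifferentiableAt (fun y => jetVar (s (y 0 1)) y n i) x := by
        induction i using Nat.twoStepInduction with
        | zero => exact fun n => (hc _ 0).add (hs.mul (hc _ 1))
        | one => exact fun n => (hc _ 0).sub (hs.mul (hc _ 1))
        | more i ih _ => exact fun n => ih (n + 1)
      exact h 0

theorem jetDifferentiableAt_congr {F G : Jet → ℂ} {x : Jet} (hx : x ∈ domain φ)
    (hF : JetDifferentiableAt F x) (h : ∀ y ∈ domain φ, G y = F y) : JetDifferentiableAt G x :=
  hF.congr fun v => (B.eventually_mem_domain hx v).mono fun _ hz => h _ hz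

theorem jetDifferentiableAt_of_represents {F : Jet → ℂ} {P : Poly}
    (hF : Represents φ ψ d r s F P) {x : Jet} (hx : x ∈ domain φ) : JetDifferentiableAt F x :=
  B.jetDifferentiableAt_congr hx (B.jetDifferentiableAt_eval P hx) hF

/-- A polynomial involves finitely many jets and its coefficients are holomorphic in `(v, u)`. This
supplies the linearity in the direction that line derivatives lack in general. -/
theorem jetDifferentiableAt_of_form {F : Jet → ℂ} (hF : HasCorrelatorForm φ F) {x : Jet}
    (hx : x ∈ domain φ) : JetDifferentiableAt F x := by
  obtain ⟨m, p, hp, hF⟩ := hF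
  refine B.jetDifferentiableAt_congr hx ?_ hF
  have hopen : IsOpen {q : ℂ × ℂ | q.2 ∈ Complex.slitPlane} :=
    Complex.isOpen_slitPlane.preimage continuous_snd
  refine JetDifferentiableAt.mul
    (((B.jetDifferentiableAt_of_represents B.represents_Δ hx).inv hx.2).pow m) ?_
  simp only [MvPolynomial.eval_map, MvPolynomial.eval₂_eq]
  refine JetDifferentiableAt.sum _ fun t _ => JetDifferentiableAt.mul ?_ ?_
  · exact JetDifferentiableAt.comp₂ (f := p.coeff t) ((hp t).differentiableAt (hopen.mem_nhds hx.1))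
      (.coord 0 0 x) (.coord 0 1 x)
  · exact JetDifferentiableAt.prod _ fun i _ => (JetDifferentiableAt.coord _ _ x).pow _

end Background

/-! ### Functions annihilated by the fields `ð_{k,a}` with `k ≥ 2` -/

/-- Each of the `n` factors `∂ + z ∂𝒰` raises the degree in `z` by at most one. -/
theorem faa_of_lt {n k : ℕ} (h : n < k) (x : Jet) : faa φ n k x = 0 := by
  induction n generalizing k x with
  | zero =>
    obtain ⟨k, rfl⟩ := Nat.exists_eq_succ_of_ne_zero (by omega : k ≠ 0)
    rfl
  | succ n ih =>
    obtain ⟨k, rfl⟩ := Nat.exists_eq_succ_of_ne_zero (by omega : k ≠ 0)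
    have h1 : faa φ n (k + 1) = fun _ => 0 := funext fun y => ih (by omega) y
    simp only [faa, h1, ih (show n < k by omega) x]
    ext a b
    simp [totMat, tot, along, lineDeriv]

/-- The top power of `z` arises only by taking `z ∂𝒰` from every factor. -/
theorem faa_self (n : ℕ) (x : Jet) : faa φ n n x = dU φ x ^ (n + 1) := by
  induction n with
  | zero => simp [faa]
  | succ n ih =>
    have h1 : faa φ n (n + 1) = fun _ => 0 := funext fun y => faa_of_lt (by omega) y
    simp only [faa, h1, ih, pow_succ' _ (n + 1)]
    ext a b
    simp [totMat, tot, along, lineDeriv]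

/-- The fields `ð_{k,0}`, `ð_{k,1}` vanish below order `k` and have the invertible block
`(∂𝒰)^(k+1)` in order `k`. They therefore eliminate the components of `v` one order at a time, until
only orders invisible to `F` remain. -/
theorem lineDeriv_eq_zero_of_eth {F : Jet → ℂ} {x : Jet} (hx : Δ φ x ≠ 0)
    (hF : JetDifferentiableAt F x) {m : ℕ} (h : ∀ k ≥ m, ∀ a, eth φ k a F x = 0) {v : Jet}
    (hv : ∀ n < m, v n = 0) : lineDeriv ℂ F x v = 0 := by
  obtain ⟨L, hL, N, hN⟩ := id hF
  -- Downward induction on the first possibly nonzero order `k`, with `j` counting the orders left.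
  have key : ∀ j k, k ≥ m → k + j = max m N → ∀ v : Jet, (∀ n < k, v n = 0) → L v = 0 := by
    intro j
    induction j with
    | zero =>
      intro k _ hk v hv
      exact hN v fun n hn => hv n (by omega)
    | succ j ih =>
      intro k hkm hk v hv
      have hunit : IsUnit (dU φ x ^ (k + 1)).det := by
        rw [Matrix.det_pow]
        exact (isUnit_iff_ne_zero.2 hx).pow _
      -- The coefficients for which the combination of the `ð_{k,a}` agrees with `v` in order `k`.
      set c := Matrix.vecMul (v k) (dU φ x ^ (k + 1))⁻¹ with hc
      have hcv : Matrix.vecMul c (dU φ x ^ (k + 1)) = v k := by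
        rw [hc, Matrix.vecMul_vecMul, Matrix.nonsing_inv_mul _ hunit, Matrix.vecMul_one]
      have h0 : ∀ a, L (ethField φ k a x) = 0 := fun a => by
        rw [← (hL _).lineDeriv]; exact h k hkm a
      have h1 := ih (k + 1) (by omega) (by omega) (v - ∑ a, c a • ethField φ k a x) fun n hn => by
        ext b
        rcases Nat.lt_succ_iff_lt_or_eq.1 hn with hn | rfl
        · simp [hv n hn, ethField, faa_of_lt hn]
        · simp [ethField, faa_self, ← hcv, Matrix.vecMul, dotProduct]
      simpa [h0] using h1
  rw [(hL v).lineDeriv]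
  exact key (max m N - m) m le_rfl (by omega) v hv

end TopGrav

end

/-! ### The remainder depends on no jets beyond the first. -/

noncomputable section

namespace TopGrav

open LPoly

/-- If `f` and `e` have the same logarithmic derivative then `f` is a multiple of `e`. -/
theorem exists_eq_const_mul_of_deriv {U : Set ℂ} (hU : IsOpen U) (hc : IsPreconnected U)
    {f f' e e' : ℂ → ℂ} (hf : ∀ z ∈ U, HasDerivAt f (f' z) z)
    (he : ∀ z ∈ U, HasDerivAt e (e' z) z) (h0 : ∀ z ∈ U, e z ≠ 0)
    (h : ∀ z ∈ U, f' z * e z = f z * e' z) : ∃ K, ∀ z ∈ U, f z = K * e z := by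
  have hd : ∀ z ∈ U, HasDerivAt (fun w => f w / e w) 0 z := fun z hz => by
    refine ((hf z hz).fun_div (he z hz) (h0 z hz)).congr_deriv ?_
    rw [h z hz, sub_self, zero_div]
  obtain ⟨K, hK⟩ := hU.exists_is_const_of_deriv_eq_zero hc
    (fun z hz => (hd z hz).differentiableAt.differentiableWithinAt) fun z hz => (hd z hz).deriv
  exact ⟨K, fun z hz => by rw [← hK z hz, div_mul_cancel₀ _ (h0 z hz)]⟩

variable {φ ψ : ℂ → ℂ} {d r : ℂ} {s : ℂ → ℂ} {F : Jet → ℂ}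

/-- The function `f₂ = F - F20 - F21`. -/
def remainder (φ ψ : ℂ → ℂ) (F : Jet → ℂ) (x : Jet) : ℂ := F x - (F20 φ x + F21 φ ψ x)

namespace Background

variable (B : Background φ ψ d r s)
include B

theorem jetDifferentiableAt_potential {x : Jet} (hx : x ∈ domain φ) :
    JetDifferentiableAt (fun y => F20 φ y + F21 φ ψ y) x :=
  B.jetDifferentiableAt_of_represents B.represents_potential hx

theorem jetDifferentiableAt_remainder (hF : IsGenusTwoPotential φ ψ F) {x : Jet}
    (hx : x ∈ domain φ) : JetDifferentiableAt (remainder φ ψ F) x :=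
  (B.jetDifferentiableAt_of_form hF.form hx).sub (B.jetDifferentiableAt_potential hx)

theorem lineDeriv_remainder (hF : IsGenusTwoPotential φ ψ F) {x : Jet} (hx : x ∈ domain φ)
    (v : Jet) : lineDeriv ℂ (remainder φ ψ F) x v
      = lineDeriv ℂ F x v - lineDeriv ℂ (fun y => F20 φ y + F21 φ ψ y) x v :=
  (HasDerivAt.sub ((B.jetDifferentiableAt_of_form hF.form hx).hasLineDerivAt v)
    ((B.jetDifferentiableAt_potential hx).hasLineDerivAt v)).deriv

theorem lineDeriv_potential_eq_zero {x : Jet} (hx : x ∈ domain φ) {v : Jet}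
    (hv : ∀ n < 5, v n = 0) : lineDeriv ℂ (fun y => F20 φ y + F21 φ ψ y) x v = 0 := by
  have hx0 : env φ ψ d r s (x + (0 : ℂ) • v) = env φ ψ d r s x := by simp
  have hcoord : ∀ n < 5, ∀ (a : Fin 2) (z : ℂ), (x + z • v) n a = x n a := fun n hn a z => by
    simp [hv n hn]
  -- All variables occurring in the symbol are constant along `v`. The derivative is thus the same
  -- as in the direction `0`, where it vanishes.
  have hz := B.hasLineDerivAt_eval Sym.potential hx (v := 0) (c := fun _ _ => zero)
    (fun n a => by simp)
  have hz' := hz.lineDeriv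
  rw [lineDeriv_zero] at hz'
  have h1 := hasDerivAt_eval (v := fun z : ℂ => env φ ψ d r s (x + z • v)) (t := 0)
    (δρ := Sym.derU fun _ _ => zero) (δτ := Sym.derE fun _ _ => zero) Sym.potential
    (by simpa using B.good hx)
    (fun i _ => ?_) (fun i hi => ?_)
  · rw [hx0] at h1
    change HasDerivAt _ ((Sym.deriv (fun _ _ => zero) Sym.potential).eval (env φ ψ d r s x)) 0 at h1
    rw [← hz'] at h1
    exact (HasDerivAt.congr_of_eventuallyEq h1 (by
      filter_upwards [B.eventually_mem_domain hx v] with z hz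
      exact B.represents_potential _ hz)).deriv
  · have h2 := B.hasDerivAt_ρ hx (v := 0) (c := fun _ _ => zero) (fun n a => by simp) i
    rw [hx0]
    refine h2.congr_of_eventuallyEq (Filter.Eventually.of_forall fun z => ?_)
    match i with
    | 0 => simp [hcoord]
    | 1 => simp [hcoord]
    | 2 => simp [hcoord]
    | 3 => simp [hcoord]
    | i + 4 => rfl
  · have h2 := B.hasDerivAt_τ hx (v := 0) (c := fun _ _ => zero) (fun n a => by simp) i
    rw [hx0]
    refine h2.congr_of_eventuallyEq (Filter.Eventually.of_forall fun z => ?_)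
    rw [Sym.width_potential] at hi
    match i with
    | 0 => rfl
    | 1 => simp [hcoord]
    | 2 => simp [hcoord]
    | 3 => simp [hcoord]
    | 4 => simp [hcoord]
    | 5 | 6 | 7 | 8 | 9 | 10 => simp [env, jetVar, hcoord]
    | i + 11 => omega

theorem eth_remainder (hF : IsGenusTwoPotential φ ψ F) {k : ℕ} (hk : 2 ≤ k) (a : Fin 2) {x : Jet}
    (hx : x ∈ domain φ) : eth φ k a (remainder φ ψ F) x = 0 := by
  have h1 := hF.trr21 k hk a x hx
  rw [eth, along, B.lineDeriv_remainder hF hx]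
  change eth φ k a F x - eth φ k a (fun y => F20 φ y + F21 φ ψ y) x = 0
  have h2 := B.represents_eth B.represents_potential k a x hx
  have h3 := B.represents_R21 k a x hx
  rcases lt_or_ge k 5 with hk5 | hk5
  · have h4 : isZero (sub (Sym.eth k a Sym.potential) (Sym.R21 k a)) = true := by
      interval_cases k
      · exact Sym.eth_two_potential a
      · exact Sym.eth_three_potential a
      · exact Sym.eth_four_potential a
    rw [h1, h2, h3, eval_eq_of_isZero_sub h4, sub_self]
  · have h4 : R21 φ ψ k a x = 0 := by
      obtain ⟨k, rfl⟩ := Nat.exists_eq_add_of_le' hk5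
      rfl
    have h5 := B.lineDeriv_potential_eq_zero hx (v := ethField φ k a x) fun n hn => by
      ext b
      simp [ethField, faa_of_lt (show n < k by omega)]
    rw [h1, h4, zero_sub, neg_eq_zero]
    exact h5

theorem lineDeriv_remainder_eq_zero (hF : IsGenusTwoPotential φ ψ F) {x : Jet}
    (hx : x ∈ domain φ) {v : Jet} (h0 : v 0 1 = 0) (h1 : v 1 = 0) :
    lineDeriv ℂ (remainder φ ψ F) x v = 0 := by
  have hJ := B.jetDifferentiableAt_remainder hF hx
  set w : Jet := -coordField 0 0 x with hw
  have h2 : lineDeriv ℂ (remainder φ ψ F) x w = 0 := by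
    have h3 := B.represents_along B.represents_potential (X := fun y => -coordField 0 0 y)
      (c := Sym.coord (-1) 0 0) (fun n a y _ => by
        rw [← eval_coord]; simp [coordField]) x hx
    rw [eval_eq_zero_of_isZero Sym.deriv_coord_potential] at h3
    rw [B.lineDeriv_remainder hF hx]
    exact (congrArg₂ _ (hF.string x hx) h3).trans (sub_zero 0)
  -- As `w = -∂/∂v`, the second summand has no component in orders 0 and 1, so the fields `ð_{k,a}`
  -- with `k ≥ 2` reach it. The first is killed by the string equation.
  have h3 : v = (-(v 0 0)) • w + (v + v 0 0 • w) := by module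
  rw [h3, hJ.lineDeriv_add, hJ.lineDeriv_smul, h2, mul_zero, zero_add]
  refine lineDeriv_eq_zero_of_eth (m := 2) hx.2 hJ (fun k hk a => B.eth_remainder hF hk a hx) ?_
  intro n hn
  interval_cases n
  · ext a
    fin_cases a <;> simp [hw, coordField, h0]
  · simp [h1, hw, coordField]

/-- The remainder depends on `u`, `∂v` and `∂u` only. -/
theorem remainder_eq (hF : IsGenusTwoPotential φ ψ F) {x y : Jet} (hx : x ∈ domain φ)
    (h0 : y 0 1 = x 0 1) (h1 : y 1 = x 1) : remainder φ ψ F y = remainder φ ψ F x := by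
  -- The quantities `u`, `p` and `q` are constant on this line, so all of it lies in the domain.
  have hz : ∀ z : ℂ, x + z • (y - x) ∈ domain φ := fun z => by
    refine B.mem_domain.2 ?_
    have := B.mem_domain.1 hx
    simpa [h0, h1] using this
  have hd : ∀ z : ℂ, HasDerivAt (fun z : ℂ => remainder φ ψ F (x + z • (y - x))) 0 z := fun z => by
    refine hasDerivAt_of_hasLineDerivAt ?_
    have h2 := (B.jetDifferentiableAt_remainder hF (hz z)).hasLineDerivAt (y - x)
    rwa [B.lineDeriv_remainder_eq_zero hF (hz z) (by simp [h0]) (by simp [h1])] at h2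
  have := is_const_of_deriv_eq_zero (fun z => (hd z).differentiableAt) (fun z => (hd z).deriv) 1 0
  simpa using this

end Background

end TopGrav

end

/-! ### The remainder is a quadratic form in the eigenvalues of `∂𝒰`. -/

noncomputable section

namespace TopGrav

open LPoly

variable {φ ψ : ℂ → ℂ} {d r : ℂ} {s : ℂ → ℂ} {F : Jet → ℂ}

/-- The eigenvalue `v₁ + s u₁` of `∂𝒰`. -/
def pVar (s : ℂ → ℂ) (x : Jet) : ℂ := x 1 0 + s (x 0 1) * x 1 1

/-- The eigenvalue `v₁ - s u₁` of `∂𝒰`. -/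
def qVar (s : ℂ → ℂ) (x : Jet) : ℂ := x 1 0 - s (x 0 1) * x 1 1

/-- A point with given `u` and `∂𝒰`. -/
def fibrePoint (s : ℂ → ℂ) (u p q : ℂ) : Jet
  | 0 => ![0, u]
  | 1 => ![(p + q) / 2, (p - q) / (2 * s u)]
  | _ + 2 => 0

theorem compl_zero_isPreconnected : IsPreconnected ({0}ᶜ : Set ℂ) :=
  (isConnected_compl_singleton_of_one_lt_rank (by simp) 0).isPreconnected

/-- A solution of `z g'' = g'` on the complement of the origin. -/
theorem exists_eq_sq_add_const {g g' g'' : ℂ → ℂ} (hg : ∀ z ≠ 0, HasDerivAt g (g' z) z)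
    (hg' : ∀ z ≠ 0, HasDerivAt g' (g'' z) z) (h : ∀ z ≠ 0, z * g'' z = g' z) :
    ∃ α β, ∀ z ≠ 0, g z = α * z ^ 2 + β := by
  obtain ⟨K, hK⟩ := exists_eq_const_mul_of_deriv (f := g') (e := fun z => z) (e' := fun _ => 1)
    isOpen_compl_singleton compl_zero_isPreconnected hg' (fun z _ => hasDerivAt_id' z)
    (fun z hz => hz) fun z hz => by rw [mul_one, mul_comm]; exact h z hz
  have hd : ∀ z ≠ 0, HasDerivAt (fun w => g w - K / 2 * w ^ 2) 0 z := fun z hz => by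
    refine ((hg z hz).sub ((hasDerivAt_pow 2 z).const_mul (K / 2))).congr_deriv ?_
    rw [hK z hz]
    push_cast
    ring
  obtain ⟨β, hβ⟩ := isOpen_compl_singleton.exists_is_const_of_deriv_eq_zero
    compl_zero_isPreconnected
    (fun z hz => (hd z hz).differentiableAt.differentiableWithinAt) fun z hz => (hd z hz).deriv
  exact ⟨K / 2, β, fun z hz => by rw [← hβ z hz]; ring⟩

namespace Background

variable (B : Background φ ψ d r s)
include B

theorem mem_domain' {x : Jet} : x ∈ domain φ ↔ x 0 1 ∈ Complex.slitPlane ∧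
    pVar s x ≠ 0 ∧ qVar s x ≠ 0 := B.mem_domain

theorem pVar_fibrePoint {u : ℂ} (hu : u ∈ Complex.slitPlane) (p q : ℂ) :
    pVar s (fibrePoint s u p q) = p := by
  have := B.s_ne u hu
  simp [pVar, fibrePoint]
  field_simp
  ring

theorem qVar_fibrePoint {u : ℂ} (hu : u ∈ Complex.slitPlane) (p q : ℂ) :
    qVar s (fibrePoint s u p q) = q := by
  have := B.s_ne u hu
  simp [qVar, fibrePoint]
  field_simp
  ring

theorem fibrePoint_mem {u : ℂ} (hu : u ∈ Complex.slitPlane) {p q : ℂ} (hp : p ≠ 0) (hq : q ≠ 0) :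
    fibrePoint s u p q ∈ domain φ := by
  rw [B.mem_domain', B.pVar_fibrePoint hu, B.qVar_fibrePoint hu]
  exact ⟨hu, hp, hq⟩

theorem remainder_eq_fibrePoint (hF : IsGenusTwoPotential φ ψ F) {x : Jet} (hx : x ∈ domain φ) :
    remainder φ ψ F x = remainder φ ψ F (fibrePoint s (x 0 1) (pVar s x) (qVar s x)) := by
  refine (B.remainder_eq (y := fibrePoint s (x 0 1) (pVar s x) (qVar s x)) hF hx rfl ?_).symm
  have := B.s_ne _ hx.1
  ext a
  fin_cases a
  · simp [fibrePoint, pVar, qVar]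
  · simp [fibrePoint, pVar, qVar]
    field_simp
    ring

theorem differentiableAt_remainder_fibrePoint (hF : IsGenusTwoPotential φ ψ F) {u : ℂ}
    (hu : u ∈ Complex.slitPlane) {q t : ℂ} (ht : t ≠ 0) (hq : q ≠ 0) :
    DifferentiableAt ℂ (fun z => remainder φ ψ F (fibrePoint s u z q)) t := by
  set w : Jet := fun n => if n = 1 then ![1 / 2, 1 / (2 * s u)] else 0 with hw
  have he : ∀ z, fibrePoint s u z q = fibrePoint s u 0 q + z • w := fun z => by
    ext n a
    match n with
    | 0 => simp [fibrePoint, hw]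
    | 1 => fin_cases a <;> simp [fibrePoint, hw] <;> ring
    | n + 2 => simp [fibrePoint, hw]
  have h2 := B.jetDifferentiableAt_remainder hF (B.fibrePoint_mem hu ht hq)
  rw [he] at h2
  rw [funext fun z => congrArg (remainder φ ψ F) (he z)]
  exact (hasDerivAt_of_hasLineDerivAt (h2.hasLineDerivAt w)).differentiableAt

theorem remainder_dilaton (hF : IsGenusTwoPotential φ ψ F) {x : Jet} (hx : x ∈ domain φ) :
    lineDeriv ℂ (remainder φ ψ F) x (fun n a => (n : ℂ) * x n a) = 2 * remainder φ ψ F x := by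
  have h3 := B.represents_along B.represents_potential (X := fun y n a => (n : ℂ) * y n a)
      (c := Sym.dil) (fun n a y hy => by
        cases n with
        | zero => simp [Sym.dil]
        | succ n => simp [Sym.dil, eval_mul (B.good hy), B.eval_jet hy, eval_mon, evalZ, evalN])
      x hx
  rw [eval_eq_of_isZero_sub Sym.deriv_dil_potential, eval_mul (B.good hx), eval_mon,
    ← B.represents_potential x hx] at h3
  rw [B.lineDeriv_remainder hF hx]
  refine (congrArg₂ _ (hF.dilaton x hx) h3).trans ?_
  simp only [remainder, evalZ, evalN]
  push_cast
  ring

/-- Along the ray `z ↦ (z p, z q)` the dilaton equation reads `z f' = 2 f`. As the punctured plane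
is connected, `f` is a multiple of `z²` there. -/
theorem remainder_homogeneous (hF : IsGenusTwoPotential φ ψ F) {u : ℂ}
    (hu : u ∈ Complex.slitPlane) {p q : ℂ} (hp : p ≠ 0) (hq : q ≠ 0) :
    remainder φ ψ F (fibrePoint s u p q) = q ^ 2 * remainder φ ψ F (fibrePoint s u (p / q) 1) := by
  set w : Jet := fun n => if n = 1 then ![(p + q) / 2, (p - q) / (2 * s u)] else 0 with hw
  have he : ∀ z, fibrePoint s u (z * p) (z * q) = fibrePoint s u 0 0 + z • w := fun z => by
    ext n a
    match n with
    | 0 => simp [fibrePoint, hw]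
    | 1 => fin_cases a <;> simp [fibrePoint, hw] <;> ring
    | n + 2 => simp [fibrePoint, hw]
  have hder : ∀ z ∈ ({0}ᶜ : Set ℂ), HasDerivAt
      (fun z => remainder φ ψ F (fibrePoint s u (z * p) (z * q)))
      (2 * remainder φ ψ F (fibrePoint s u (z * p) (z * q)) / z) z := by
    intro z hz
    have hz0 : z ≠ 0 := hz
    have hx := B.fibrePoint_mem hu (mul_ne_zero hz0 hp) (mul_ne_zero hz0 hq)
    have h1 := B.remainder_dilaton hF hx
    have hJ := B.jetDifferentiableAt_remainder hF hx
    have h2 : (fun n a => (n : ℂ) * fibrePoint s u (z * p) (z * q) n a : Jet) = z • w := by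
      ext n a
      match n with
      | 0 => simp [hw]
      | 1 => fin_cases a <;> simp [fibrePoint, hw] <;> ring
      | n + 2 => simp [fibrePoint, hw]
    rw [h2, hJ.lineDeriv_smul] at h1
    have h3 := hJ.hasLineDerivAt w
    rw [eq_div_of_mul_eq hz0 ((mul_comm _ _).trans h1)] at h3
    rw [he] at h3
    have h4 := hasDerivAt_of_hasLineDerivAt h3
    simpa only [← he] using h4
  obtain ⟨K, hK⟩ := exists_eq_const_mul_of_deriv (U := {0}ᶜ)
    (f := fun z => remainder φ ψ F (fibrePoint s u (z * p) (z * q)))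
    (f' := fun z => 2 * remainder φ ψ F (fibrePoint s u (z * p) (z * q)) / z)
    (e := fun z => z ^ 2) (e' := fun z => 2 * z) isOpen_compl_singleton
    compl_zero_isPreconnected hder
    (fun z _ => by simpa using hasDerivAt_pow 2 z) (fun z hz => pow_ne_zero 2 hz)
    fun z hz => by
      have : z ≠ 0 := hz
      field_simp
  have h1 := hK 1 one_ne_zero
  -- The parameter `q⁻¹` carries `(p, q)` to `(p/q, 1)`.
  have h2 := hK q⁻¹ (inv_ne_zero hq)
  simp only [one_mul, one_pow, mul_one, inv_mul_cancel₀ hq, inv_mul_eq_div] at h1 h2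
  rw [h1, h2]
  field_simp

/-- The derivative, in a direction along which `u` is constant, of a function of the form
`qⁿ k(p / q)`. -/
theorem hasLineDerivAt_of_homogeneous {G : Jet → ℂ} {k : ℂ → ℂ} {k' : ℂ} {n : ℕ} {x v : Jet}
    (hx : x ∈ domain φ) (hv : v 0 1 = 0)
    (hG : ∀ y ∈ domain φ, y 0 1 = x 0 1 → G y = qVar s y ^ n * k (pVar s y / qVar s y))
    (hk : HasDerivAt k k' (pVar s x / qVar s x)) :
    HasLineDerivAt ℂ G
      (n * qVar s x ^ (n - 1) * (v 1 0 - s (x 0 1) * v 1 1) * k (pVar s x / qVar s x)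
        + qVar s x ^ n * (k' * (((v 1 0 + s (x 0 1) * v 1 1) * qVar s x
            - pVar s x * (v 1 0 - s (x 0 1) * v 1 1)) / qVar s x ^ 2))) x v := by
  have hu : ∀ z : ℂ, (x + z • v) 0 1 = x 0 1 := fun z => by simp [hv]
  have hp : HasDerivAt (fun z : ℂ => pVar s (x + z • v)) (v 1 0 + s (x 0 1) * v 1 1) 0 := by
    simp only [pVar, hu]
    exact (hasDerivAt_line x v 1 0).add ((hasDerivAt_line x v 1 1).const_mul _)
  have hq : HasDerivAt (fun z : ℂ => qVar s (x + z • v)) (v 1 0 - s (x 0 1) * v 1 1) 0 := by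
    simp only [qVar, hu]
    exact (hasDerivAt_line x v 1 0).sub ((hasDerivAt_line x v 1 1).const_mul _)
  have e0 : x + (0 : ℂ) • v = x := by simp
  have hd := hp.fun_div hq (by simpa using (B.mem_domain'.1 hx).2.2)
  have hkd := HasDerivAt.comp_of_eq (h₂ := k) (0 : ℂ) hk hd (by rw [e0])
  have hf := (hq.fun_pow n).fun_mul hkd
  refine (HasDerivAt.congr_of_eventuallyEq hf ?_).congr_deriv ?_
  · filter_upwards [B.eventually_mem_domain hx v] with z hz
    exact hG _ hz (hu z)
  · simp only [e0, Function.comp]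

/-- The fields `ð_{1,a}` fix `u` and act on first jets through `(∂𝒰)²`: `ð_{1,0}` sends `p, q` to
`p², q²`, and `ð_{1,1}` sends them to `s p², -s q²`. The result has the same homogeneous shape in
degree `n + 1`, so the formula can be iterated. The first part asserts existence of the derivative
because `remainder_recursion` needs it. -/
theorem eth_one_homogeneous {G : Jet → ℂ} {k : ℂ → ℂ} {k' : ℂ} {n : ℕ} {x : Jet}
    (hx : x ∈ domain φ)
    (hG : ∀ y ∈ domain φ, y 0 1 = x 0 1 → G y = qVar s y ^ n * k (pVar s y / qVar s y))
    (hk : HasDerivAt k k' (pVar s x / qVar s x)) :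
    HasLineDerivAt ℂ G (qVar s x ^ (n + 1) * (n * k (pVar s x / qVar s x)
        + (pVar s x / qVar s x) * (pVar s x / qVar s x - 1) * k')) x (ethField φ 1 0 x) ∧
    eth φ 1 1 G x = s (x 0 1) * qVar s x ^ (n + 1) * (-(n * k (pVar s x / qVar s x))
        + (pVar s x / qVar s x) * (pVar s x / qVar s x + 1) * k') := by
  have hq := (B.mem_domain'.1 hx).2.2
  have hv : ∀ a, ethField φ 1 a x 0 1 = 0 := fun a => rfl
  have hn : ∀ n : ℕ, (n : ℂ) * qVar s x ^ (n - 1) * qVar s x = n * qVar s x ^ n := fun n => by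
    cases n with
    | zero => simp
    | succ n => rw [Nat.add_sub_cancel, mul_assoc, ← pow_succ]
  have e : ∀ a b, ethField φ 1 a x 1 b = (dU φ x ^ 2) a b := fun a b => by
    rw [ethField, faa_self]
  have h := fun a => B.hasLineDerivAt_of_homogeneous hx (hv a) hG hk
  have hpq : ∀ a, ethField φ 1 a x 1 0 + s (x 0 1) * ethField φ 1 a x 1 1
        = (if a = 0 then 1 else s (x 0 1)) * pVar s x ^ 2 ∧
      ethField φ 1 a x 1 0 - s (x 0 1) * ethField φ 1 a x 1 1
        = (if a = 0 then 1 else -s (x 0 1)) * qVar s x ^ 2 := fun a => by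
    simp only [e, B.dU_eq hx.1, pow_two, Matrix.mul_apply, Fin.sum_univ_two, pVar, qVar]
    fin_cases a <;> constructor <;> simp <;> ring
  constructor
  · refine HasDerivAt.congr_deriv (h 0) ?_
    rw [(hpq 0).1, (hpq 0).2]
    have := hn n
    simp only [if_true, one_mul]
    rw [pow_two (qVar s x), ← mul_assoc ((n : ℂ) * _), this]
    field_simp
    ring
  · refine (h 1).lineDeriv.trans ?_
    rw [(hpq 1).1, (hpq 1).2]
    have := hn n
    simp only [one_ne_zero, if_false]
    rw [pow_two (qVar s x), show (n : ℂ) * qVar s x ^ (n - 1) * (-s (x 0 1) * (qVar s x * qVar s x))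
      = -s (x 0 1) * ((n : ℂ) * qVar s x ^ (n - 1) * qVar s x) * qVar s x by ring, this]
    field_simp
    ring

/-- Potential and particular solution obey the same inhomogeneous recursion. The coefficients come
from `⟨⟨O_0 O_0 O_c⟩⟩_0 = ð_{0,c} u`, an entry of `∂𝒰`. -/
theorem remainder_recursion (hF : IsGenusTwoPotential φ ψ F) {x : Jet} (hx : x ∈ domain φ)
    {D : ℂ} (hD : HasLineDerivAt ℂ (eth φ 1 0 (remainder φ ψ F)) D x (ethField φ 1 0 x)) :
    D = 3 * (x 1 0 * eth φ 1 0 (remainder φ ψ F) x + x 1 1 * eth φ 1 1 (remainder φ ψ F) x) := by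
  have hsplit : ∀ a, ∀ y ∈ domain φ, eth φ 1 a F y
      = eth φ 1 a (remainder φ ψ F) y + eth φ 1 a (fun y => F20 φ y + F21 φ ψ y) y := by
    intro a y hy
    simp only [eth, along, B.lineDeriv_remainder hF hy, sub_add_cancel]
  have h1 := fun a => B.represents_eth B.represents_potential 1 a
  have h2 : HasLineDerivAt ℂ (eth φ 1 0 F) _ x (ethField φ 1 0 x) :=
    HasDerivAt.congr_of_eventuallyEq
      (hD.add (B.hasLineDerivAt (h1 0) hx fun n b => B.represents_faa n 1 0 b x hx)) (by
        filter_upwards [B.eventually_mem_domain hx (ethField φ 1 0 x)] with z hz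
        exact hsplit 0 _ hz)
  have h3 := hF.trr22 0 0 x hx
  have hc : ∀ c, cor0 φ 0 0 [c] x = dU φ x c 1 := fun c => along_coord _ 0 1 x
  have h5 := eval_eq_of_isZero_sub Sym.eth_one_eth_one_potential (env φ ψ d r s x)
  rw [eval_sub, eval_mul (B.good hx), eval_sum2, eval_mon, ← B.represents_R22 0 0 x hx] at h5
  simp only [eval_mul (B.good hx), ← h1 _ x hx, ← B.represents_cor0 _ _ _ x hx, dual_eq] at h5
  have h6 : eth φ 1 0 (eth φ 1 0 F) x = _ := h2.lineDeriv
  rw [h6, ← h5] at h3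
  simp only [hsplit _ x hx, hc, Fin.sum_univ_two, B.dU_eq hx.1, evalZ, evalN] at h3
  simp [dual] at h3
  change _ + (Sym.eth 1 0 (Sym.eth 1 0 Sym.potential)).eval _ - _ = _ at h3
  linear_combination h3

/-- The remainder is a quadratic form in the eigenvalues of `∂𝒰`. -/
theorem remainder_quadratic (hF : IsGenusTwoPotential φ ψ F) {u : ℂ} (hu : u ∈ Complex.slitPlane) :
    ∃ α β : ℂ, ∀ x ∈ domain φ, x 0 1 = u →
      remainder φ ψ F x = α * pVar s x ^ 2 + β * qVar s x ^ 2 := by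
  set g := fun z => remainder φ ψ F (fibrePoint s u z 1) with hg
  have hform : ∀ y ∈ domain φ, y 0 1 = u →
      remainder φ ψ F y = qVar s y ^ 2 * g (pVar s y / qVar s y) := by
    intro y hy hyu
    have := B.mem_domain'.1 hy
    rw [B.remainder_eq_fibrePoint hF hy, hyu, B.remainder_homogeneous hF hu this.2.1 this.2.2]
  have hd0 : DifferentiableOn ℂ g {0}ᶜ := fun z hz =>
    (B.differentiableAt_remainder_fibrePoint hF hu hz one_ne_zero).differentiableWithinAt
  have hd1 := hd0.deriv isOpen_compl_singleton
  have hd2 := hd1.deriv isOpen_compl_singleton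
  have hg1 : ∀ z ≠ 0, HasDerivAt g (deriv g z) z := fun z hz =>
    (hd0.differentiableAt (isOpen_compl_singleton.mem_nhds hz)).hasDerivAt
  have hg2 : ∀ z ≠ 0, HasDerivAt (deriv g) (deriv (deriv g) z) z := fun z hz =>
    (hd1.differentiableAt (isOpen_compl_singleton.mem_nhds hz)).hasDerivAt
  -- The recursion yields this expression times `z (z - 1)²`. The excluded value `z = 1`, where `∂u
  -- = 0`, is recovered afterwards by continuity of `g''`.
  have hode : ∀ z ≠ 0, z ≠ 1 → z * deriv (deriv g) z - deriv g z = 0 := by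
    intro z hz hz1
    have hx := B.fibrePoint_mem hu hz one_ne_zero
    have hxu : fibrePoint s u z 1 0 1 = u := rfl
    have hp := B.pVar_fibrePoint hu z 1
    have hq := B.qVar_fibrePoint hu z 1
    have hk : ∀ z ≠ 0, HasDerivAt (fun z => 2 * g z + z * (z - 1) * deriv g z)
        (2 * deriv g z + ((2 * z - 1) * deriv g z + z * (z - 1) * deriv (deriv g) z)) z :=
      fun z hz => by
        refine (((hg1 z hz).const_mul 2).fun_add
          (((hasDerivAt_id' z).fun_mul ((hasDerivAt_id' z).sub_const 1)).fun_mul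
            (hg2 z hz))).congr_deriv ?_
        ring
    have he : ∀ y ∈ domain φ, y 0 1 = u → eth φ 1 0 (remainder φ ψ F) y
        = qVar s y ^ 3 * (fun z => 2 * g z + z * (z - 1) * deriv g z) (pVar s y / qVar s y) := by
      intro y hy hyu
      have h0 := B.mem_domain'.1 hy
      refine ((B.eth_one_homogeneous hy (fun w hw hwy => hform w hw (hwy.trans hyu))
        (hg1 _ (div_ne_zero h0.2.1 h0.2.2))).1.lineDeriv).trans ?_
      push_cast
      ring
    have h1 := (B.eth_one_homogeneous hx (fun w hw hwy => he w hw (hwy.trans hxu))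
      (hk _ (by rwa [hp, hq, div_one]))).1
    have h2 := (B.eth_one_homogeneous hx (fun w hw hwy => hform w hw (hwy.trans hxu))
      (hg1 _ (by rwa [hp, hq, div_one]))).2
    have h3 := B.remainder_recursion hF hx h1
    rw [h2, he _ hx hxu, hp, hq, div_one] at h3
    have hs := B.s_ne u hu
    simp [fibrePoint] at h3
    field_simp at h3
    have h4 : z * (z - 1) ^ 2 * (z * deriv (deriv g) z - deriv g z) = 0 := by
      linear_combination h3 / 2
    simpa [hz, sub_ne_zero.2 hz1] using h4
  have hode1 : ∀ z ≠ 0, z * deriv (deriv g) z = deriv g z := by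
    intro z hz
    rw [← sub_eq_zero]
    rcases eq_or_ne z 1 with rfl | hz1
    · have hc : ContinuousAt (fun z => z * deriv (deriv g) z - deriv g z) 1 :=
        (continuousAt_id.mul (hd2.differentiableAt
          (isOpen_compl_singleton.mem_nhds hz)).continuousAt).sub (hg2 1 hz).continuousAt
      refine tendsto_nhds_unique (hc.tendsto.mono_left (nhdsWithin_le_nhds (s := {1}ᶜ))) ?_
      refine tendsto_const_nhds.congr' ?_
      filter_upwards [self_mem_nhdsWithin,
        nhdsWithin_le_nhds (isOpen_compl_singleton.mem_nhds hz)] with w h1 h0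
      exact (hode w h0 h1).symm
    · exact hode z hz hz1
  obtain ⟨α, β, h⟩ := exists_eq_sq_add_const hg1 hg2 hode1
  refine ⟨α, β, fun x hx hxu => ?_⟩
  have h0 := B.mem_domain'.1 hx
  have hq := h0.2.2
  rw [hform x hx hxu, h _ (div_ne_zero h0.2.1 h0.2.2)]
  field_simp

end Background

end TopGrav

end

/-! ### The Virasoro constraints on the coefficients of the quadratic form. -/

noncomputable section

namespace TopGrav

open LPoly

variable {φ ψ : ℂ → ℂ} {d r : ℂ} {s : ℂ → ℂ} {F : Jet → ℂ}

namespace Sym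

/-- With the next two identities, this shows that at `v = 0` the field `ℒ₁` fixes `u` and exchanges
`∂v` and `∂u` up to factors. -/
theorem ell1_zero_one : isZero (add (ell1 0 1) (mul (mon 2 [] [0, 1]) (euler 1))) = true := by
  decide +kernel

theorem ell1_one_zero : isZero (add (ell1 1 0)
    (add (mul (mul (sub (mon 3 [] []) (mon 1 [] [1])) (mon 1 [] [0, 1])) (jet 1 0))
      (mul (mon 3 [1, 1] []) (jet 1 1)))) = true := by
  decide +kernel

theorem ell1_one_one : isZero (add (ell1 1 1)
    (add (mul (mul (mul (mon 3 [] []) oneSubD) (mon 1 [] [0, 1])) (jet 1 1))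
      (mul (mon 3 [-1, 1] []) (jet 1 0)))) = true := by
  decide +kernel

end Sym

/-- The function `a(u) ((∂v)² + s(u)² (∂u)²) + b(u) ∂v ∂u`. -/
def quadForm (s a b : ℂ → ℂ) (x : Jet) : ℂ :=
  a (x 0 1) * (x 1 0 ^ 2 + s (x 0 1) ^ 2 * x 1 1 ^ 2) + b (x 0 1) * (x 1 0 * x 1 1)

/-- The function `h₀` determined by the Virasoro constraint `L₁ Z = 0`. -/
def hSol (d r : ℂ) (s : ℂ → ℂ) (u : ℂ) : ℂ :=
  -(d * (1 - d) ^ 2 * (3 * d - 1) * (3 * d - 5) * (d - 2)) / 5760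
    * (s u / (s u * ((1 - d) * u + r)) ^ 3)

namespace Background

variable (B : Background φ ψ d r s)
include B

theorem hasLineDerivAt_quadForm {a b : ℂ → ℂ} {a' b' : ℂ} {x : Jet}
    (hx : x 0 1 ∈ Complex.slitPlane) (v : Jet) (ha : HasDerivAt a a' (x 0 1))
    (hb : HasDerivAt b b' (x 0 1)) :
    HasLineDerivAt ℂ (quadForm s a b)
      (a' * v 0 1 * (x 1 0 ^ 2 + s (x 0 1) ^ 2 * x 1 1 ^ 2)
        + 2 * a (x 0 1) * (x 1 0 * v 1 0 + s (x 0 1) ^ 2 * x 1 1 * v 1 1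
          + d * s (x 0 1) ^ 2 / ((1 - d) * x 0 1 + r) * v 0 1 * x 1 1 ^ 2)
        + b' * v 0 1 * (x 1 0 * x 1 1) + b (x 0 1) * (v 1 0 * x 1 1 + x 1 0 * v 1 1)) x v := by
  have h0 := hasDerivAt_comp_line v ha
  have h1 := hasDerivAt_comp_line v hb
  have h2 := hasDerivAt_comp_line v (B.hasDerivAt_s _ hx)
  have h3 := hasDerivAt_line x v 1 0
  have h4 := hasDerivAt_line x v 1 1
  refine HasDerivAt.congr_deriv ((h0.fun_mul ((h3.fun_pow 2).fun_add
    ((h2.fun_pow 2).fun_mul (h4.fun_pow 2)))).fun_add (h1.fun_mul (h3.fun_mul h4))) ?_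
  simp
  ring

theorem smallPoint_mem (v : ℂ) {u : ℂ} (hu : u ∈ Complex.slitPlane) :
    smallPoint v u ∈ domain φ :=
  B.mem_domain.2 ⟨hu, by simp [smallPoint], by simp [smallPoint]⟩

/-- The remainder is a quadratic form with coefficients given by the functions `h_a`. -/
theorem exists_remainder_eq_quadForm (hF : IsGenusTwoPotential φ ψ F) :
    ∃ a b : ℂ → ℂ, (∀ x ∈ domain φ, remainder φ ψ F x = quadForm s a b x) ∧
      ∀ v, ∀ u ∈ Complex.slitPlane, hFun φ ψ F 0 v u = 2 * a u ∧ hFun φ ψ F 1 v u = b u := by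
  have h : ∀ u, ∃ α β : ℂ, u ∈ Complex.slitPlane → ∀ x ∈ domain φ, x 0 1 = u →
      remainder φ ψ F x = α * pVar s x ^ 2 + β * qVar s x ^ 2 := fun u => by
    by_cases hu : u ∈ Complex.slitPlane
    · obtain ⟨α, β, h⟩ := B.remainder_quadratic hF hu
      exact ⟨α, β, fun _ => h⟩
    · exact ⟨0, 0, fun h => absurd h hu⟩
  choose α β h using h
  have h1 : ∀ x ∈ domain φ, remainder φ ψ F x
      = quadForm s (fun u => α u + β u) (fun u => 2 * s u * (α u - β u)) x := fun x hx => by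
    rw [h _ hx.1 x hx rfl]
    simp only [pVar, qVar, quadForm]
    ring
  refine ⟨_, _, h1, fun v u hu => ?_⟩
  have hx := B.smallPoint_mem v hu
  -- The direction `∂/∂(∂u^i)` leaves `u` fixed, so the coefficients are frozen to constants and
  -- their regularity is not needed yet.
  have h2 : ∀ i : Fin 2, hFun φ ψ F i v u = _ := fun i => HasDerivAt.deriv
    (HasDerivAt.congr_of_eventuallyEq (B.hasLineDerivAt_quadForm (x := smallPoint v u)
      (a := fun _ => α u + β u) (b := fun _ => 2 * s u * (α u - β u)) hu
      (coordField 1 i (smallPoint v u)) (hasDerivAt_const _ _) (hasDerivAt_const _ _)) (by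
        filter_upwards [B.eventually_mem_domain hx (coordField 1 i (smallPoint v u))] with z hz
        refine (h1 _ hz).trans ?_
        have hzu : (smallPoint v u + z • coordField 1 i (smallPoint v u)) 0 1 = u := by
          simp [coordField, smallPoint]
        simp only [quadForm, hzu]))
  rw [h2 0, h2 1]
  constructor <;> simp [smallPoint, coordField]

/-- The coefficients were chosen for each `u` separately. Their regularity is recovered from that of
the remainder by moving `u` with `(∂v, ∂u) = (1, τ)` fixed. -/
theorem differentiableAt_of_remainder_eq {a b : ℂ → ℂ} (hF : IsGenusTwoPotential φ ψ F)
    (h : ∀ x ∈ domain φ, remainder φ ψ F x = quadForm s a b x) {u : ℂ}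
    (hu : u ∈ Complex.slitPlane) : DifferentiableAt ℂ a u ∧ DifferentiableAt ℂ b u := by
  have hs := B.s_ne u hu
  have hsd := (B.hasDerivAt_s u hu).differentiableAt
  set base : ℂ → Jet := fun τ n => if n = 1 then ![1, τ] else 0 with hbase
  set w : Jet := coordField 0 1 0 with hw
  have hu0 : ∀ τ z : ℂ, (base τ + z • w) 0 1 = z := fun τ z => by simp [hbase, hw, coordField]
  have hv1 : ∀ τ z : ℂ, (base τ + z • w) 1 0 = 1 := fun τ z => by simp [hbase, hw, coordField]
  have hu1 : ∀ τ z : ℂ, (base τ + z • w) 1 1 = τ := fun τ z => by simp [hbase, hw, coordField]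
  have key : ∀ τ, 1 + s u * τ ≠ 0 → 1 - s u * τ ≠ 0 →
      DifferentiableAt ℂ (fun z => a z * (1 + s z ^ 2 * τ ^ 2) + b z * τ) u := by
    intro τ hp hq
    have hx : base τ + u • w ∈ domain φ := B.mem_domain.2 (by
      rw [hu0, hv1, hu1]; exact ⟨hu, hp, hq⟩)
    have hd := (hasDerivAt_of_hasLineDerivAt
      ((B.jetDifferentiableAt_remainder hF hx).hasLineDerivAt w)).differentiableAt
    refine hd.congr_of_eventuallyEq ?_
    have hc := hsd.continuousAt.mul_const τ
    filter_upwards [Complex.isOpen_slitPlane.mem_nhds hu,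
      (hc.const_add 1).eventually_ne hp, (hc.const_sub 1).eventually_ne hq] with z h1 h2 h3
    rw [h _ (B.mem_domain.2 (by rw [hu0, hv1, hu1]; exact ⟨h1, h2, h3⟩))]
    simp only [quadForm, hu0, hv1, hu1]
    ring
  have ha : DifferentiableAt ℂ a u := by simpa using key 0 (by simp) (by simp)
  -- This `τ` gives `p = 3/2` and `q = 1/2` at `u`. It is nonzero, so `b` can be isolated once `a`
  -- is known to be differentiable.
  have hb := key (1 / (2 * s u)) (by field_simp; norm_num) (by field_simp; norm_num)
  refine ⟨ha, ?_⟩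
  have h2 : DifferentiableAt ℂ (fun z => 2 * s u * ((a z * (1 + s z ^ 2 * (1 / (2 * s u)) ^ 2)
      + b z * (1 / (2 * s u))) - a z * (1 + s z ^ 2 * (1 / (2 * s u)) ^ 2))) u := by
    fun_prop
  refine h2.congr_of_eventuallyEq (Filter.Eventually.of_forall fun z => ?_)
  field_simp
  ring

/-- The two coefficients of a quadratic form are determined by its values on the domain. -/
theorem eq_zero_of_quadratic {α β u : ℂ} (hu : u ∈ Complex.slitPlane)
    (h : ∀ x ∈ domain φ, x 0 0 = 0 → x 0 1 = u →
      α * (x 1 0 ^ 2 + s u ^ 2 * x 1 1 ^ 2) + β * (x 1 0 * x 1 1) = 0) : α = 0 ∧ β = 0 := by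
  have hs := B.s_ne u hu
  -- At `p = q = 1` one has `∂u = 0`, which isolates `α`; the point `p = 1`, `q = 2` then gives `β`.
  have h1 := h _ (B.fibrePoint_mem hu one_ne_zero one_ne_zero) rfl rfl
  have h2 := h _ (B.fibrePoint_mem hu one_ne_zero two_ne_zero) rfl rfl
  simp [fibrePoint] at h1 h2
  subst h1
  refine ⟨rfl, ?_⟩
  simpa [hs, show (1 : ℂ) + 2 ≠ 0 by norm_num, show (1 : ℂ) - 2 ≠ 0 by norm_num] using h2

omit B in
theorem euler_one (x : Jet) : TopGrav.euler d r 1 x = (1 - d) * x 0 1 + r := by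
  have : 1 - (d / 2 - -d / 2) = 1 - d := by ring
  simp [TopGrav.euler, μ, R1, this]

omit B in
theorem ell0_zero_one (x : Jet) : ell0 d r 0 1 x = -((1 - d) * x 0 1 + r) := by
  exact congrArg Neg.neg (euler_one x)

/-- The differential equations for `h_a` that are equivalent to `L₀ Z = 0`. -/
theorem deriv_of_virasoroL0 {a b : ℂ → ℂ} (hF : IsGenusTwoPotential φ ψ F)
    (h : ∀ x ∈ domain φ, remainder φ ψ F x = quadForm s a b x) (hL : VirasoroL0 φ d r F) {u : ℂ}
    (hu : u ∈ Complex.slitPlane) :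
    ((1 - d) * u + r) * deriv a u = (d - 3) * a u ∧
      ((1 - d) * u + r) * deriv b u = (2 * d - 3) * b u := by
  obtain ⟨ha, hb⟩ := B.differentiableAt_of_remainder_eq hF h hu
  have he := B.euler_ne u hu
  have key := B.eq_zero_of_quadratic (u := u)
    (α := ((1 - d) * u + r) * deriv a u - (d - 3) * a u)
    (β := ((1 - d) * u + r) * deriv b u - (2 * d - 3) * b u) hu fun x hx _ hxu => by
    have h1 := B.represents_along B.represents_potential (X := L0 d r)
      (fun n a => B.represents_ell0 n a) x hx
    rw [eval_eq_zero_of_isZero Sym.deriv_ell0_potential] at h1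
    have h2 : lineDeriv ℂ (remainder φ ψ F) x (L0 d r x) = 0 := by
      rw [B.lineDeriv_remainder hF hx]
      exact (congrArg₂ _ (hL x hx) h1).trans (sub_zero 0)
    subst hxu
    have h3 := HasDerivAt.deriv (HasDerivAt.congr_of_eventuallyEq
      (B.hasLineDerivAt_quadForm hx.1 (L0 d r x) ha.hasDerivAt hb.hasDerivAt) (by
        filter_upwards [B.eventually_mem_domain hx (L0 d r x)] with z hz
        exact h _ hz))
    have e0 : L0 d r x 0 1 = -((1 - d) * x 0 1 + r) := ell0_zero_one x
    have e1 : ∀ i, L0 d r x 1 i = tot (ell0 d r 0 i) x - (1 - d) / 2 * x 1 i := fun i => rfl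
    have e2 : tot (ell0 d r 0 0) x = -x 1 0 := by
      have : ell0 d r 0 0 = fun y => -y 0 0 := by ext y; simp [ell0, euler, R1]
      rw [this]
      exact (hasDerivAt_line x (shift x) 0 0).neg.deriv
    have e3 : tot (ell0 d r 0 1) x = -(1 - d) * x 1 1 := by
      have : ell0 d r 0 1 = fun y => -((1 - d) * y 0 1 + r) := funext ell0_zero_one
      rw [this]
      refine (((hasDerivAt_line x (shift x) 0 1).const_mul (1 - d)).add_const r).neg.deriv.trans ?_
      simp [shift]
      ring
    have h4 := h2.symm.trans h3
    rw [e0, e1, e1, e2, e3] at h4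
    field_simp at h4
    linear_combination h4 / 2
  exact ⟨sub_eq_zero.1 key.1, sub_eq_zero.1 key.2⟩

theorem eval_h0 {x : Jet} (hx : x ∈ domain φ) : Sym.h0.eval (env φ ψ d r s x) = hSol d r s (x 0 1) := by
  simp only [Sym.h0, eval_mul (B.good hx), eval_rat _ (-1) 5760 dvd_rfl, eval_mon, eval_add,
    eval_oneSubD, evalZ, evalN, hSol]
  simp [zpow_neg]
  ring

/-- The constraint `L₁ Z = 0` determines `h_a`. -/
theorem eq_of_virasoroL1 {a b : ℂ → ℂ} (hF : IsGenusTwoPotential φ ψ F)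
    (h : ∀ x ∈ domain φ, remainder φ ψ F x = quadForm s a b x) (hL : VirasoroL1 φ ψ d r F) {u : ℂ}
    (hu : u ∈ Complex.slitPlane) : 2 * a u = hSol d r s u ∧ b u = 0 := by
  have hs := B.s_ne u hu
  have he := B.euler_ne u hu
  -- Since `ℒ₁` exchanges `∂v` and `∂u` at `v = 0`, `b` moves to the diagonal part and the deviation
  -- of `2 a` from `hSol` to the mixed term.
  have key := B.eq_zero_of_quadratic (u := u) (α := ((1 - d) * u + r) * b u)
    (β := 2 * (2 * a u - hSol d r s u) * ((1 - d) * u + r) * s u ^ 2) hu fun x hx hx0 hxu => by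
    have hg := B.good hx
    have h1 := B.hasLineDerivAt_eval (add Sym.potential Sym.correction) hx (v := L1 φ d r x)
      fun n i => B.represents_ell1 n i x hx
    have h2 := eval_eq_zero_of_isZero Sym.deriv_ell1_potential (env φ ψ d r s x)
    -- The genus 1 source cancels: `ℒ₁` has the same value on `F` and on the corrected particular
    -- solution.
    rw [eval_add, ← B.represents_virasoroSource x hx, ← hL x hx, add_left_inj] at h2
    rw [h2] at h1
    have h3 := HasDerivAt.sub
      ((B.jetDifferentiableAt_of_form hF.form hx).hasLineDerivAt (L1 φ d r x)) h1
    have e0 : L1 φ d r x 0 1 = 0 := by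
      have := eval_eq_zero_of_isZero Sym.ell1_zero_one (env φ ψ d r s x)
      rw [eval_add, ← B.represents_ell1 0 1 x hx, eval_mul hg] at this
      simpa [L1, eval_mon, evalZ, evalN, hx0] using this
    have e1 : L1 φ d r x 1 0 = -(3 * (s u ^ 2 * ((1 - d) * u + r)) * x 1 1) := by
      have := eval_eq_zero_of_isZero Sym.ell1_one_zero (env φ ψ d r s x)
      simp only [eval_add, ← B.represents_ell1 1 0 x hx, eval_mul hg, B.eval_jet hx] at this
      simp [eval_mon, evalZ, evalN, hx0, hxu] at this
      rw [L1]
      linear_combination this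
    have e2 : L1 φ d r x 1 1 = -(3 * ((1 - d) * u + r) * x 1 0) := by
      have := eval_eq_zero_of_isZero Sym.ell1_one_one (env φ ψ d r s x)
      simp only [eval_add, ← B.represents_ell1 1 1 x hx, eval_mul hg, B.eval_jet hx] at this
      simp [eval_mon, evalZ, evalN, hx0, hxu, hs] at this
      rw [L1]
      linear_combination this
    -- As `ℒ₁ u = 0` at `v = 0`, the coefficients may again be treated as constants.
    have h4 : HasDerivAt (fun z : ℂ => F (x + z • L1 φ d r x)
        - (add Sym.potential Sym.correction).eval (env φ ψ d r s (x + z • L1 φ d r x))) _ 0 :=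
      HasDerivAt.congr_of_eventuallyEq (B.hasLineDerivAt_quadForm hx.1 (L1 φ d r x)
      (a := fun _ => a u - hSol d r s u / 2) (b := fun _ => b u)
      (hasDerivAt_const _ _) (hasDerivAt_const _ _)) (by
        filter_upwards [B.eventually_mem_domain hx (L1 φ d r x)] with z hz
        have hzu : (x + z • L1 φ d r x) 0 1 = u := by simp [e0, hxu]
        have h5 := h _ hz
        generalize x + z • L1 φ d r x = y at hz hzu h5 ⊢
        simp only [quadForm, remainder, hzu] at h5 ⊢
        rw [eval_add, ← B.represents_potential _ hz, Sym.correction, eval_mul (B.good hz),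
          eval_mul (B.good hz), eval_add, B.eval_h0 hz, hzu, eval_rat _ 1 4 (by norm_num), eval_mon,
          eval_mon]
        simp [evalZ, evalN, hzu]
        linear_combination h5)
    have h5 := (sub_self (along (L1 φ d r) F x)).symm.trans (h3.unique h4)
    rw [e0, e1, e2] at h5
    simp only [hxu] at h5
    linear_combination h5 / 3
  constructor
  · have := key.2
    simpa [he, hs, sub_eq_zero] using this
  · have := key.1
    simpa [he] using this

end Background

end TopGrav

end

noncomputable section

namespace TopGrav

/-! ### The backgrounds of charge `d` and the `ℂP¹`-model -/

theorem slitPlane_isPreconnected : IsPreconnected Complex.slitPlane :=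
  (Complex.starConvex_one_slitPlane.isPathConnected
    Complex.one_mem_slitPlane).isConnected.isPreconnected

theorem hasDerivAt_cpow_const' {c u : ℂ} (hu : u ∈ Complex.slitPlane) :
    HasDerivAt (fun w => w ^ c) (c * u ^ c / u) u := by
  refine ((hasDerivAt_id' u).cpow_const hu).congr_deriv ?_
  rw [Complex.cpow_sub _ _ (Complex.slitPlane_ne_zero hu), Complex.cpow_one]
  ring

/-- A square root of `φ'` for charge `d`. -/
def sqrtD (d u : ℂ) : ℂ := ((1 + d) / (1 - d)) ^ (1 / 2 : ℂ) * u ^ (d / (1 - d))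

theorem sqrtD_sq (d u : ℂ) : sqrtD d u ^ 2 = (1 + d) / (1 - d) * u ^ (2 * d / (1 - d)) := by
  rw [sqrtD, mul_pow, ← Complex.cpow_nat_mul, ← Complex.cpow_nat_mul]
  congr 1
  · norm_num
  · congr 1
    push_cast
    ring

theorem background_phiD {d : ℂ} (h1 : d ≠ 1) (h2 : d ≠ -1) :
    Background (phiD d) (psiFun d) d 0 (sqrtD d) := by
  have hd : 1 - d ≠ 0 := sub_ne_zero.2 h1.symm
  have hd' : d - 1 ≠ 0 := sub_ne_zero.2 h1
  have hd2 : 1 + d ≠ 0 := fun h => h2 (by linear_combination h)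
  refine ⟨fun u hu => ?_, fun u hu => ?_, fun u hu => ?_, fun u hu => ?_, fun u hu => ?_⟩ <;>
    have h0 := Complex.slitPlane_ne_zero hu
  · refine mul_ne_zero ?_ ?_
    · simp [Complex.cpow_eq_zero_iff, hd, hd2]
    · simp [Complex.cpow_eq_zero_iff, h0]
  · simp [hd, h0]
  · refine (hasDerivAt_cpow_const' hu).congr_deriv ?_
    rw [sqrtD_sq, mul_div_assoc]
    congr 1
    rw [show (1 + d) / (1 - d) = 2 * d / (1 - d) + 1 by field_simp; ring,
      Complex.cpow_add _ _ h0, Complex.cpow_one, mul_div_cancel_right₀ _ h0]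
  · refine ((hasDerivAt_cpow_const' hu).const_mul _).congr_deriv ?_
    rw [sqrtD]
    field_simp
    ring
  · refine ((Complex.hasDerivAt_log hu).const_mul _).congr_deriv ?_
    field_simp
    ring

/-- Because `s/(s ℰ¹)³ = 1/(s² (ℰ¹)³)`, only `s² = φ'` enters and the branch of the root is
irrelevant. -/
theorem hSol_sqrtD {d : ℂ} (h1 : d ≠ 1) (h2 : d ≠ -1) {u : ℂ} (hu : u ≠ 0) :
    hSol d 0 (sqrtD d) u = h0Value d u := by
  have hd : 1 - d ≠ 0 := sub_ne_zero.2 h1.symm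
  have hd2 : 1 + d ≠ 0 := fun h => h2 (by linear_combination h)
  have hd3 : d + 1 ≠ 0 := by rwa [add_comm]
  have hp : u ^ (2 * d / (1 - d)) ≠ 0 := by simp [Complex.cpow_eq_zero_iff, hu]
  have hs := sqrtD_sq d u
  have hs0 : sqrtD d u ≠ 0 := fun h => by
    rw [h, zero_pow two_ne_zero] at hs
    exact mul_ne_zero (div_ne_zero hd2 hd) hp hs.symm
  have he : u ^ ((d - 3) / (1 - d)) = (u ^ (2 * d / (1 - d)) * u ^ 3)⁻¹ := by
    rw [← Complex.cpow_natCast, ← Complex.cpow_add _ _ hu, ← Complex.cpow_neg]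
    congr 1
    push_cast
    field_simp
    ring
  have hs3 : sqrtD d u / (sqrtD d u * ((1 - d) * u + 0)) ^ 3
      = (sqrtD d u ^ 2)⁻¹ / ((1 - d) * u) ^ 3 := by
    field_simp
    ring
  rw [hSol, h0Value, he, hs3, hs, add_comm 1 d]
  field_simp

theorem iteratedDeriv_psiFun (d : ℂ) (n : ℕ) {u : ℂ} (hu : u ∈ Complex.slitPlane) :
    iteratedDeriv (n + 1) (psiFun d) u
      = d * (3 * d - 1) / (24 * (d - 1)) * ((-1) ^ n * n.factorial * u ^ (-(n + 1 : ℤ))) := by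
  induction n generalizing u with
  | zero =>
    rw [zero_add, iteratedDeriv_one]
    refine ((Complex.hasDerivAt_log hu).const_mul _).deriv.trans ?_
    simp
  | succ n ih =>
    have h0 := Complex.slitPlane_ne_zero hu
    have h : iteratedDeriv (n + 1) (psiFun d) =ᶠ[nhds u] fun u =>
        d * (3 * d - 1) / (24 * (d - 1)) * ((-1) ^ n * n.factorial * u ^ (-(n + 1 : ℤ))) := by
      filter_upwards [Complex.isOpen_slitPlane.mem_nhds hu] with w hw
      exact ih hw
    rw [iteratedDeriv_succ, h.deriv_eq, (((hasDerivAt_zpow _ u (Or.inl h0)).const_mul _).const_mul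
      _).deriv, Nat.factorial_succ, pow_succ, show -((n + 1 : ℕ) + 1 : ℤ) = -(n + 1 : ℤ) - 1 by
        push_cast; ring]
    push_cast
    ring

/-- On this power of `u` all five terms are multiples of `u⁻⁴`, which leaves an affine function of
`c`. -/
theorem bpExpr_eq {d : ℂ} (h1 : d ≠ 1) (h2 : d ≠ -1) {h : ℂ → ℂ} {c : ℂ}
    (hh : ∀ u ∈ Complex.slitPlane, h u = c * u ^ ((d - 3) / (1 - d))) {u : ℂ}
    (hu : u ∈ Complex.slitPlane) :
    bpExpr (phiD d) (psiFun d) h u = -(3 * (1 + d)) / (1 - d) ^ 2 / u ^ 4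
      * (c - -(d * (3 * d - 1) * (3 * d - 5) * (d - 2)) / (5760 * (d + 1))) := by
  have B := background_phiD h1 h2
  have hd : 1 - d ≠ 0 := sub_ne_zero.2 h1.symm
  have hd' : d - 1 ≠ 0 := sub_ne_zero.2 h1
  have hd2 : 1 + d ≠ 0 := fun h => h2 (by linear_combination h)
  have hd3 : d + 1 ≠ 0 := by rwa [add_comm]
  have h0 := Complex.slitPlane_ne_zero hu
  have hd1 : deriv h u = c * ((d - 3) / (1 - d) * u ^ ((d - 3) / (1 - d)) / u) := by
    rw [← ((hasDerivAt_cpow_const' hu).const_mul c).deriv]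
    refine Filter.EventuallyEq.deriv_eq ?_
    filter_upwards [Complex.isOpen_slitPlane.mem_nhds hu] with w hw
    exact hh w hw
  have hp : sqrtD d u ^ 2 * u ^ ((d - 3) / (1 - d)) = (1 + d) / (1 - d) / u ^ 3 := by
    rw [sqrtD_sq, mul_assoc, ← Complex.cpow_add _ _ h0,
      show 2 * d / (1 - d) + (d - 3) / (1 - d) = -(3 : ℕ) by push_cast; field_simp; ring,
      Complex.cpow_neg, Complex.cpow_natCast, div_eq_mul_inv _ (u ^ 3)]
  have e1 := iteratedDeriv_psiFun d 0 hu
  have e2 := iteratedDeriv_psiFun d 1 hu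
  have e3 := iteratedDeriv_psiFun d 2 hu
  have e4 := iteratedDeriv_psiFun d 3 hu
  rw [zero_add, iteratedDeriv_one] at e1
  norm_num at e1 e2 e3 e4
  rw [bpExpr, (B.hasDerivAt_φ u hu).deriv, B.iteratedDeriv_two_φ hu, hd1, hh u hu, e1, e2, e3, e4]
  have : sqrtD d u ^ 2 * (c * ((d - 3) / (1 - d) * u ^ ((d - 3) / (1 - d)) / u))
      - 1 / 2 * (2 * sqrtD d u ^ 2 * d / ((1 - d) * u + 0)) * (c * u ^ ((d - 3) / (1 - d)))
      = (sqrtD d u ^ 2 * u ^ ((d - 3) / (1 - d))) * (c * (-3 / (1 - d)) / u) := by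
    field_simp
    ring
  rw [this, hp]
  field_simp
  ring

/-- For `d = 1` the Euler component is the constant `r = 2`, and the formulas for general charge
specialise without singularity. -/
theorem background_phiCP1 :
    Background phiCP1 psiCP1 1 2 (fun u => Complex.exp (u / 2)) := by
  refine ⟨fun u hu => Complex.exp_ne_zero _, fun u hu => by norm_num, fun u hu => ?_, fun u hu => ?_,
    fun u hu => ?_⟩
  · rw [← Complex.exp_nat_mul, show ((2 : ℕ) : ℂ) * (u / 2) = u by push_cast; ring]
    exact Complex.hasDerivAt_exp u
  · refine ((Complex.hasDerivAt_exp _).comp u ((hasDerivAt_id' u).div_const 2)).congr_deriv ?_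
    ring
  · refine ((hasDerivAt_id' u).const_mul _).congr_deriv ?_
    norm_num

end TopGrav

end

/-! ### Conclusion for both families of backgrounds. -/

open TopGrav in
theorem mainTheorem3 :
    (∀ d : ℂ, d ≠ 1 → d ≠ -1 →
      ∀ F₂ : Jet → ℂ, IsGenusTwoPotential (phiD d) (psiFun d) F₂ →
        VirasoroL0 (phiD d) d 0 F₂ →
        -- homogeneity imposed by `L₀Z = 0`
        (∃ K : Fin 2 → ℂ, ∀ a : Fin 2, ∀ v : ℂ, ∀ u ∈ Complex.slitPlane,
          hFun (phiD d) (psiFun d) F₂ a v u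
            = K a * u ^ (((1 + (a : ℕ)) * d - 3) / (1 - d))) ∧
        -- the constraint `L₁Z = 0` determines `h_0`, `h_1` and `F₂`
        (VirasoroL1 (phiD d) (psiFun d) d 0 F₂ →
          (∀ v : ℂ, ∀ u ∈ Complex.slitPlane,
            hFun (phiD d) (psiFun d) F₂ 1 v u = 0 ∧
            hFun (phiD d) (psiFun d) F₂ 0 v u = h0Value d u) ∧
          ∀ x ∈ domain (phiD d),
            F₂ x = F20 (phiD d) x + F21 (phiD d) (psiFun d) x
              + 1 / 2 * (x 1 0 ^ 2 + deriv (phiD d) (x 0 1) * x 1 1 ^ 2) * h0Value d (x 0 1)) ∧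
        -- so does, for `h_0`, the Belorousski-Pandharipande equation
        (∀ v : ℂ,
          (∀ u ∈ Complex.slitPlane,
            bpExpr (phiD d) (psiFun d) (hFun (phiD d) (psiFun d) F₂ 0 v) u = 0) ↔
          ∀ u ∈ Complex.slitPlane, hFun (phiD d) (psiFun d) F₂ 0 v u = h0Value d u)) ∧
    -- the case `d = 1`
    (∀ F₂ : Jet → ℂ, IsGenusTwoPotential phiCP1 psiCP1 F₂ →
      VirasoroL0 phiCP1 1 2 F₂ → VirasoroL1 phiCP1 psiCP1 1 2 F₂ →
        (∀ a : Fin 2, ∀ v : ℂ, ∀ u ∈ Complex.slitPlane, hFun phiCP1 psiCP1 F₂ a v u = 0) ∧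
        ∀ x ∈ domain phiCP1, F₂ x = F20 phiCP1 x + F21 phiCP1 psiCP1 x) := by
  refine ⟨fun d h1 h2 F₂ hF hL0 => ?_, fun F₂ hF _ hL1 => ?_⟩
  · have B := background_phiD h1 h2
    have hd : 1 - d ≠ 0 := sub_ne_zero.2 h1.symm
    have hd2 : 1 + d ≠ 0 := fun h => h2 (by linear_combination h)
    obtain ⟨a, b, hab, hh⟩ := B.exists_remainder_eq_quadForm hF
    have hode := fun u hu => B.deriv_of_virasoroL0 hF hab hL0 (u := u) hu
    have hdiff := fun u hu => B.differentiableAt_of_remainder_eq hF hab (u := u) hu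
    obtain ⟨K0, hK0⟩ := exists_eq_const_mul_of_deriv Complex.isOpen_slitPlane
      slitPlane_isPreconnected (fun u hu => (hdiff u hu).1.hasDerivAt)
      (fun u hu => hasDerivAt_cpow_const' (c := (d - 3) / (1 - d)) hu)
      (fun u hu => by simp [Complex.cpow_eq_zero_iff, Complex.slitPlane_ne_zero hu])
      fun u hu => by
        have h0 := Complex.slitPlane_ne_zero hu
        have := (hode u hu).1
        field_simp
        linear_combination u ^ ((d - 3) / (1 - d)) * this
    obtain ⟨K1, hK1⟩ := exists_eq_const_mul_of_deriv Complex.isOpen_slitPlane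
      slitPlane_isPreconnected (fun u hu => (hdiff u hu).2.hasDerivAt)
      (fun u hu => hasDerivAt_cpow_const' (c := (2 * d - 3) / (1 - d)) hu)
      (fun u hu => by simp [Complex.cpow_eq_zero_iff, Complex.slitPlane_ne_zero hu])
      fun u hu => by
        have h0 := Complex.slitPlane_ne_zero hu
        have := (hode u hu).2
        field_simp
        linear_combination u ^ ((2 * d - 3) / (1 - d)) * this
    have hh0 : ∀ v, ∀ u ∈ Complex.slitPlane, hFun (phiD d) (psiFun d) F₂ 0 v u
        = 2 * K0 * u ^ ((d - 3) / (1 - d)) := fun v u hu => by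
      rw [(hh v u hu).1, hK0 u hu, mul_assoc]
    -- The factor 2 appears because `h_0 = 2 a` while `h_1 = b`.
    refine ⟨⟨![2 * K0, K1], fun i v u hu => ?_⟩, fun hL1 => ⟨fun v u hu => ?_, fun x hx => ?_⟩,
      fun v => ?_⟩
    · fin_cases i
      · simpa using hh0 v u hu
      · simpa [one_add_one_eq_two] using ((hh v u hu).2.trans (hK1 u hu))
    · have h3 := B.eq_of_virasoroL1 hF hab hL1 hu
      rw [(hh v u hu).1, (hh v u hu).2, h3.1, h3.2, hSol_sqrtD h1 h2 (Complex.slitPlane_ne_zero hu)]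
      exact ⟨rfl, rfl⟩
    · have h3 := B.eq_of_virasoroL1 hF hab hL1 hx.1
      rw [hSol_sqrtD h1 h2 (Complex.slitPlane_ne_zero hx.1)] at h3
      have h4 := hab x hx
      rw [quadForm, h3.2, remainder] at h4
      rw [(B.hasDerivAt_φ _ hx.1).deriv, ← h3.1]
      linear_combination h4
    · have hK : ∀ u ∈ Complex.slitPlane, u ^ ((d - 3) / (1 - d)) ≠ 0 := fun u hu => by
        simp [Complex.cpow_eq_zero_iff, Complex.slitPlane_ne_zero hu]
      have key : ∀ u ∈ Complex.slitPlane,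
          (bpExpr (phiD d) (psiFun d) (hFun (phiD d) (psiFun d) F₂ 0 v) u = 0 ↔
            hFun (phiD d) (psiFun d) F₂ 0 v u = h0Value d u) := fun u hu => by
        rw [bpExpr_eq h1 h2 (hh0 v) hu, hh0 v u hu, h0Value, mul_left_inj' (hK u hu)]
        simp [hd, hd2, Complex.slitPlane_ne_zero hu, sub_eq_zero]
      exact forall₂_congr key
  · have B := background_phiCP1
    obtain ⟨a, b, hab, hh⟩ := B.exists_remainder_eq_quadForm hF
    have h3 := fun u hu => B.eq_of_virasoroL1 hF hab hL1 (u := u) hu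
    -- The factor `(1 - d)²` in `hSol` vanishes at `d = 1`.
    have h4 : ∀ u ∈ Complex.slitPlane, a u = 0 ∧ b u = 0 := fun u hu =>
      ⟨by simpa [hSol] using (h3 u hu).1, (h3 u hu).2⟩
    refine ⟨fun i v u hu => ?_, fun x hx => ?_⟩
    · fin_cases i
      · exact (hh v u hu).1.trans (by rw [(h4 u hu).1, mul_zero])
      · exact (hh v u hu).2.trans (h4 u hu).2
    · have h5 := hab x hx
      rw [quadForm, (h4 _ hx.1).1, (h4 _ hx.1).2, remainder] at h5
      linear_combination h5
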